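/- **Lemma (convergence), hyperbolic case.** Let $1\le d\le 3$, let $\Omega\subset\mathbb R^d$ be a polygonal domain with boundary $\Gamma$, let $\mu>0$, and let $a:\overline\Omega\to\mathbb R^d$ be Lipschitz continuous and divergence-free with $\|a\|_{L^\infty(\Omega)}\le 1$. Let $\mathcal T$ be a conforming triangulation of $\Omega$ into simplices $K$ of diameter $h_K\le 1$, with outward unit normals $n$ on $\partial K$, and let $\Gamma^0$ be the union of all facets. Write $a_n=|a\cdot n|$, $\partial K_+=\{x\in\partial K: a\cdot n\ge 0\}$, $\partial K_-=\{x\in\partial K: a\cdot n<0\}$, and similarly $\Gamma_\pm$. For $k\in\mathbb N$ and $0\le l\le 1$ put $$W_h=\{w\in L^2(\Omega): w|_K\in P_k(K)\ \forall K\},\quad \bar W_h=\{\bar w\in H^l(\Gamma^0): \bar w|_F\in P_k(F)\ \forall \text{ facets } F\},\quad W_h^\star=W_h\times\bar W_h ,$$ where $P_k$ denotes polynomials of degree at most $k$, and $W^\star(h)=(W_h+H^1(\Omega))\times(\bar W_h+H^{1/2}(\Gamma^0))$. For pairs $\mathbf w=(w,\bar w)$, $\mathbf v=(v,\bar v)$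 let $$B_A(\mathbf w,\mathbf v)=\int_\Omega\mu wv\,dx-\sum_K\int_K w\,a\cdot\nabla v\,dx-\sum_K\int_{\partial K_+}a\cdot n\,w(\bar v-v)\,ds-\sum_K\int_{\partial K_-}a\cdot n\,\bar w(\bar v-v)\,ds+\int_{\Gamma_+}a\cdot n\,\bar w\bar v\,ds,$$ $$L(\mathbf v)=\int_\Omega fv\,dx+\int_{\Gamma_-}g\bar v\,ds,$$ $$|||\mathbf v|||_A^2=\mu\|v\|_{0,\Omega}^2+\sum_Kh_K\|a\cdot\nabla v\|_{0,K}^2+\sum_K\|a_n^{1/2}(\bar v-v)\|_{0,\partial K}^2+\|a_n^{1/2}\bar v\|_{0,\Gamma}^2,$$ $$|||\mathbf v|||_{A'}^2=|||\mathbf v|||_A^2+\sum_Kh_K^{-1}\|v\|_{0,K}^2+\sum_K\|a_n^{1/2}\bar v\|_{0,\partial K_-}^2+\sum_K\|a_n^{1/2}v\|_{0,\partial K_+}^2 .$$ For every $\sigma$ there are constants $\beta_A>0$ and $C_A>0$, independent of the mesh, such that for every such triangulation that is shape-regular with parameter $\sigma$ (every $K$ contains a ball of some radius $r>0$ with $h_K\le\sigma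 r$) the following holds: 1. (inf-sup stability) $\displaystyle\sup_{\mathbf w_h\in W_h^\star}\frac{B_A(\mathbf v_h,\mathbf w_h)}{|||\mathbf w_h|||_A}\ge\beta_A|||\mathbf v_h|||_A$ for all $\mathbf v_h\in W_h^\star$ (quotients with zero denominator count as $0$); 2. (continuity) $|B_A(\mathbf w,\mathbf v_h)|\le C_A|||\mathbf w|||_{A'}|||\mathbf v_h|||_A$ for all $\mathbf w\in W^\star(h)$, $\mathbf v_h\in W_h^\star$; 3. (convergence) if $u\in H^1(\Omega)$ solves $\mu u+a\cdot\nabla u=f$ in $\Omega$ with $-u\,a\cdot n=g$ on $\Gamma_-$, if $\mathbf u=(u,u)$ (with the trace of $u$ on $\Gamma^0$ in the second slot), and if $\mathbf u_h\in W_h^\star$ solves $B_A(\mathbf u_h,\mathbf v_h)=L(\mathbf v_h)$ for all $\mathbf v_h\in W_h^\star$, then $$|||\mathbf u-\mathbf u_h|||_A\le\Big(1+\frac{C_A}{\beta_A}\Big)\inf_{\mathbf v_h\in W_h^\star}|||\mathbf u-\mathbf v_h|||_{A'} .$$ -/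

import Mathlib

open MeasureTheory Filter Topology
open scoped ContDiff NNReal ENNReal

noncomputable section

namespace InterfaceStab

/-- Euclidean space `ℝ^d`. -/
abbrev E (d : ℕ) := EuclideanSpace ℝ (Fin d)

/-- Smooth functions with compact support in the open set `Ω`. -/
def IsTestFunction {d : ℕ} (Ω : Set (E d)) (φ : E d → ℝ) : Prop :=
  ContDiff ℝ ∞ φ ∧ HasCompactSupport φ ∧ tsupport φ ⊆ Ω

/-- `G` is the weak gradient of `u` on `Ω`. -/
def IsWeakGradient {d : ℕ} (Ω : Set (E d)) (u : E d → ℝ) (G : E d → E d) : Prop :=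
  ∀ φ : E d → ℝ, IsTestFunction Ω φ →
    ∫ x in Ω, u x • gradient φ x = -∫ x in Ω, φ x • G x

/-- The field `a` is divergence-free on `Ω` (in the sense of distributions, which for
Lipschitz fields is the same as almost everywhere). -/
def DivergenceFree {d : ℕ} (Ω : Set (E d)) (a : E d → E d) : Prop :=
  ∀ φ : E d → ℝ, IsTestFunction Ω φ → ∫ x in Ω, inner ℝ (a x) (gradient φ x) = 0

/-- `q` is a polynomial function on `ℝ^d` of total degree at most `k`. -/
def IsPoly {d : ℕ} (k : ℕ) (q : E d → ℝ) : Prop :=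
  ∃ p : MvPolynomial (Fin d) ℝ, p.totalDegree ≤ k ∧ ∀ x : E d, q x = MvPolynomial.eval (fun i => x i) p

/-- A (conforming) triangulation of the polygonal domain `Ω ⊆ ℝ^d` into finitely many
non-degenerate closed simplices. Two distinct cells meet in the convex hull of their common
vertices (a common face, possibly empty), and `Ω` is the interior of the union of the cells. -/
structure Triangulation {d : ℕ} (Ω : Set (E d)) where
  /-- the number of cells -/
  numCells : ℕ
  /-- the cells -/
  cell : Fin numCells → Affine.Simplex ℝ (E d) d
  distinct : Function.Injective fun K => Set.range (cell K).points
  conforming : ∀ K K', (cell K).closedInterior ∩ (cell K').closedInterior ⊆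
    convexHull ℝ (Set.range (cell K).points ∩ Set.range (cell K').points)
  domain_eq : Ω = interior (⋃ K, (cell K).closedInterior)

/-- A function defined separately on each of `m` cells, together with its (weak) gradient on each
cell and its trace on the boundary of each cell, taken from inside that cell. Which gradients and
traces belong to which function is fixed by `Triangulation.Wh` and `IsH1`. -/
structure CellFn (m d : ℕ) where
  val : Fin m → E d → ℝ
  grad : Fin m → E d → E d
  tr : Fin m → E d → ℝ

instance (m d : ℕ) : Add (CellFn m d) :=
  ⟨fun v w => ⟨v.val + w.val, v.grad + w.grad, v.tr + w.tr⟩⟩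

instance (m d : ℕ) : Sub (CellFn m d) :=
  ⟨fun v w => ⟨v.val - w.val, v.grad - w.grad, v.tr - w.tr⟩⟩

/-- Pairs `(v, v̄)` of a cell function and a facet function. -/
abbrev Pair (m d : ℕ) := CellFn m d × (E d → ℝ)

/-- `u ∈ H¹(Ω)` with weak gradient `G`, and `t` is the trace of `u` on `Γ₀ ⊆ closure Ω`: the value
at `u` of the continuous extension to `H¹(Ω)` of the restriction map
`φ ↦ φ|_Γ₀`, `C^∞(closure Ω) → L²(Γ₀)`. -/
structure IsH1 {d : ℕ} (Ω Γ₀ : Set (E d)) (u : E d → ℝ) (G : E d → E d) (t : E d → ℝ) :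
    Prop where
  memLp : MemLp u 2 (volume.restrict Ω)
  grad_memLp : MemLp G 2 (volume.restrict Ω)
  weakGradient : IsWeakGradient Ω u G
  trace_memLp : MemLp t 2 ((μHE[d - 1] : Measure (E d)).restrict Γ₀)
  trace : ∃ φ : ℕ → E d → ℝ, (∀ n, ContDiff ℝ ∞ (φ n)) ∧
    Tendsto (fun n => eLpNorm (φ n - u) 2 (volume.restrict Ω)) atTop (𝓝 0) ∧
    Tendsto (fun n => eLpNorm (gradient (φ n) - G) 2 (volume.restrict Ω)) atTop (𝓝 0) ∧
    Tendsto (fun n => eLpNorm (φ n - t) 2 ((μHE[d - 1] : Measure (E d)).restrict Γ₀)) atTop (𝓝 0)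

namespace Triangulation

variable {d : ℕ} [NeZero d] {Ω : Set (E d)} (T : Triangulation Ω)

/-- The cell `K` as a closed set. -/
def cellSet (K : Fin T.numCells) : Set (E d) := (T.cell K).closedInterior

/-- The facet of the cell `K` opposite to its `i`-th vertex. The boundary of `K` is the union of
its `d + 1` facets. -/
def facet (K : Fin T.numCells) (i : Fin (d + 1)) : Set (E d) :=
  ((T.cell K).faceOpposite i).closedInterior

/-- The outward unit normal to `K` on its `i`-th facet: it points from the opposite
vertex to the orthogonal projection of that vertex to the hyperplane of the facet. -/
def normal (K : Fin T.numCells) (i : Fin (d + 1)) : E d :=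
  ‖(T.cell K).altitudeFoot i - (T.cell K).points i‖⁻¹ •
    ((T.cell K).altitudeFoot i - (T.cell K).points i)

/-- The union of all facets. -/
def skeleton : Set (E d) := ⋃ K, ⋃ i, T.facet K i

/-- The surface measure on the facets. -/
def surf : Measure (E d) := (μHE[d - 1] : Measure (E d)).restrict T.skeleton

/-- The size `h_K` of the cell `K`: its diameter. -/
def size (K : Fin T.numCells) : ℝ := Metric.diam (T.cellSet K)

/-- Every cell contains a ball of radius at least `h_K / σ`. -/
def ShapeRegular (σ : ℝ) : Prop :=
  ∀ K, ∃ c : E d, ∃ r : ℝ, 0 < r ∧ Metric.closedBall c r ⊆ T.cellSet K ∧ T.size K ≤ σ * r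

/-- The facet lies on the boundary `Γ = ∂Ω`. -/
def IsBoundary (K : Fin T.numCells) (i : Fin (d + 1)) : Prop := T.facet K i ⊆ frontier Ω

/-- The part of the `i`-th facet of `K` that belongs to `∂K₊`. -/
def outflow (a : E d → E d) (K : Fin T.numCells) (i : Fin (d + 1)) : Set (E d) :=
  {x ∈ T.facet K i | 0 ≤ inner ℝ (a x) (T.normal K i)}

/-- The part of the `i`-th facet of `K` that belongs to `∂K₋`. -/
def inflow (a : E d → E d) (K : Fin T.numCells) (i : Fin (d + 1)) : Set (E d) :=
  {x ∈ T.facet K i | inner ℝ (a x) (T.normal K i) < 0}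

/-! ### Function spaces -/

/-- `W_h`: polynomials of degree at most `k` on each cell. -/
def Wh (k : ℕ) : Set (CellFn T.numCells d) :=
  {v | ∀ K, IsPoly k (v.val K) ∧ v.grad K = gradient (v.val K) ∧ v.tr K = v.val K}

/-- The surface gradient of `φ` on the `i`-th facet of `K`. -/
def surfGrad (φ : E d → ℝ) (K : Fin T.numCells) (i : Fin (d + 1)) (x : E d) : E d :=
  gradient φ x - inner ℝ (gradient φ x) (T.normal K i) • T.normal K i

open Classical in
/-- The Sobolev space `H^l(Γ⁰)`, `0 ≤ l ≤ 1`, on the union of all facets: `L²` for `l = 0`, the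
Sobolev-Slobodeckij space for `0 < l < 1`, and for `l = 1` the closure of the smooth functions in
the norm `(‖w‖² + ∑_F ‖∇_F w‖²)^{1/2}` with the surface gradients `∇_F`. -/
def HSob (l : ℝ) : Set (E d → ℝ) :=
  {w | MemLp w 2 T.surf ∧
    if l = 0 then True
    else if l = 1 then
      ∃ (φ : ℕ → E d → ℝ) (G : Fin T.numCells → Fin (d + 1) → E d → E d),
        (∀ n, ContDiff ℝ ∞ (φ n)) ∧
        Tendsto (fun n => eLpNorm (φ n - w) 2 T.surf) atTop (𝓝 0) ∧
        ∀ K i, Tendsto (fun n => eLpNorm (T.surfGrad (φ n) K i - G K i) 2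
          ((μHE[d - 1] : Measure (E d)).restrict (T.facet K i))) atTop (𝓝 0)
    else
      MemLp (fun p : E d × E d => (w p.1 - w p.2) / dist p.1 p.2 ^ (((d : ℝ) - 1) / 2 + l)) 2
        (T.surf.prod T.surf)}

/-- `W̄_h` (there is no Dirichlet boundary). -/
def WhBar (k : ℕ) (l : ℝ) : Set (E d → ℝ) :=
  {w | w ∈ T.HSob l ∧ ∀ K i, ∃ q : E d → ℝ, IsPoly k q ∧
    w =ᵐ[(μHE[d - 1] : Measure (E d)).restrict (T.facet K i)] q}

/-- `W_h^⋆ = W_h × W̄_h`. -/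
def WhStar (k : ℕ) (l : ℝ) : Set (Pair T.numCells d) := T.Wh k ×ˢ T.WhBar k l

/-- A function in `H¹(Ω)`, seen as a cell function. -/
def ofH1 (u : E d → ℝ) (G : E d → E d) (t : E d → ℝ) : CellFn T.numCells d :=
  ⟨fun _ => u, fun _ => G, fun _ => t⟩

/-- `W(h) = W_h + H¹(Ω)`. -/
def WExt (k : ℕ) : Set (CellFn T.numCells d) :=
  {v | ∃ w ∈ T.Wh k, ∃ u G t, IsH1 Ω T.skeleton u G t ∧ v = w + T.ofH1 u G t}

/-- `W̄(h) = W̄_h + H^{1/2}(Γ⁰)`. -/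
def WBarExt (k : ℕ) (l : ℝ) : Set (E d → ℝ) :=
  {v | ∃ w ∈ T.WhBar k l, ∃ z ∈ T.HSob (1 / 2), v = w + z}

/-- `W^⋆(h) = W(h) × W̄(h)`. -/
def WStarExt (k : ℕ) (l : ℝ) : Set (Pair T.numCells d) := T.WExt k ×ˢ T.WBarExt k l

/-! ### The method for `κ = 0` -/

open Classical in
/-- The bilinear form `B_A`. -/
def BA (μ : ℝ) (a : E d → E d) (w v : Pair T.numCells d) : ℝ :=
  (∑ K, ∫ x in T.cellSet K, μ * w.1.val K x * v.1.val K x)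
  - (∑ K, ∫ x in T.cellSet K, w.1.val K x * inner ℝ (a x) (v.1.grad K x))
  - (∑ K, ∑ i, ∫ x in T.outflow a K i,
      inner ℝ (a x) (T.normal K i) * w.1.tr K x * (v.2 x - v.1.tr K x) ∂μHE[d - 1])
  - (∑ K, ∑ i, ∫ x in T.inflow a K i,
      inner ℝ (a x) (T.normal K i) * w.2 x * (v.2 x - v.1.tr K x) ∂μHE[d - 1])
  + ∑ K, ∑ i, if T.IsBoundary K i then
      ∫ x in T.outflow a K i, inner ℝ (a x) (T.normal K i) * w.2 x * v.2 x ∂μHE[d - 1] else 0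

open Classical in
/-- The linear form `L`, with `Γ_N = Γ₋`. -/
def linForm (a : E d → E d) (f g : E d → ℝ) (v : Pair T.numCells d) : ℝ :=
  (∑ K, ∫ x in T.cellSet K, f x * v.1.val K x)
  + ∑ K, ∑ i, if T.IsBoundary K i then
      ∫ x in T.inflow a K i, g x * v.2 x ∂μHE[d - 1] else 0

/-- `u_h ∈ W_h^⋆` solves the finite element problem. -/
def IsDiscreteSolution (μ : ℝ) (a : E d → E d) (k : ℕ) (l : ℝ) (f g : E d → ℝ)
    (uh : Pair T.numCells d) : Prop :=
  uh ∈ T.WhStar k l ∧ ∀ vh ∈ T.WhStar k l, T.BA μ a uh vh = T.linForm a f g vh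

/-- `u ∈ H¹(Ω)` (with weak gradient `G` and trace `t` on the facets) solves `μ u + a · ∇u = f`
in `Ω` and `-u a · n = g` on the inflow boundary `Γ₋`. -/
structure IsStrongSolution (μ : ℝ) (a : E d → E d) (f g : E d → ℝ)
    (u : E d → ℝ) (G : E d → E d) (t : E d → ℝ) : Prop where
  isH1 : IsH1 Ω T.skeleton u G t
  equation : ∀ᵐ x ∂(volume.restrict Ω), μ * u x + inner ℝ (a x) (G x) = f x
  boundary : ∀ K i, T.IsBoundary K i →
    ∀ᵐ x ∂((μHE[d - 1] : Measure (E d)).restrict (T.inflow a K i)),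
      -(t x) * inner ℝ (a x) (T.normal K i) = g x

/-! ### Norms -/

open Classical in
/-- The stability norm `|||v|||_A`. -/
def normA (μ : ℝ) (a : E d → E d) (v : Pair T.numCells d) : ℝ :=
  √(μ * (∑ K, ∫ x in T.cellSet K, v.1.val K x ^ 2)
    + (∑ K, T.size K * ∫ x in T.cellSet K, inner ℝ (a x) (v.1.grad K x) ^ 2)
    + (∑ K, ∑ i, ∫ x in T.facet K i,
        |inner ℝ (a x) (T.normal K i)| * (v.2 x - v.1.tr K x) ^ 2 ∂μHE[d - 1])
    + ∑ K, ∑ i, if T.IsBoundary K i then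
        ∫ x in T.facet K i, |inner ℝ (a x) (T.normal K i)| * v.2 x ^ 2 ∂μHE[d - 1] else 0)

/-- The continuity norm `|||v|||_{A'}`. -/
def normA' (μ : ℝ) (a : E d → E d) (v : Pair T.numCells d) : ℝ :=
  √(T.normA μ a v ^ 2
    + (∑ K, (T.size K)⁻¹ * ∫ x in T.cellSet K, v.1.val K x ^ 2)
    + (∑ K, ∑ i, ∫ x in T.inflow a K i,
        |inner ℝ (a x) (T.normal K i)| * v.2 x ^ 2 ∂μHE[d - 1])
    + ∑ K, ∑ i, ∫ x in T.outflow a K i,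
        |inner ℝ (a x) (T.normal K i)| * v.1.tr K x ^ 2 ∂μHE[d - 1])

/-- The inf-sup condition with constant `β`. -/
def InfSup (μ : ℝ) (a : E d → E d) (k : ℕ) (l β : ℝ) : Prop :=
  ∀ vh ∈ T.WhStar k l,
    β * T.normA μ a vh ≤ ⨆ wh : T.WhStar k l, T.BA μ a vh wh / T.normA μ a wh

/-- Continuity of the bilinear form with constant `C`. -/
def Continuity (μ : ℝ) (a : E d → E d) (k : ℕ) (l C : ℝ) : Prop :=
  ∀ w ∈ T.WStarExt k l, ∀ vh ∈ T.WhStar k l,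
    |T.BA μ a w vh| ≤ C * T.normA' μ a w * T.normA μ a vh

end Triangulation

end InterfaceStab

end

/-!
The bilinear form is controlled by one identity: on a simplex `K`, for the divergence-free field `a`
and smooth `p`, `q`,
`∫_K p a·∇q + ∫_K q a·∇p = ∑_F ∫_F (a·n) p q`  (`integration_by_parts`).
Since `a` is only Lipschitz and divergence-free in the sense of distributions, this divergence
theorem is proved by testing with a product of smoothed barycentric coordinates and letting the
boundary layer shrink (`divergence_theorem`, `tendsto_boundaryLayer`). The flux of a single-valued
facet function through interior facets cancels, because such a facet belongs to exactly two cells,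
with opposite normals (`sum_facet_eq_sum_boundary`).

*Continuity* (`abs_BA_le`) is the Cauchy-Schwarz inequality in the weights `h_K` and `|a·n|`,
applied to the five terms of the form, so the constant is `5`.

*Inf-sup stability* (`exists_testPair`). On the diagonal, integration by parts gives
`μ ‖v‖² + ½ ∑ ∫ |a·n| (v̄ - v)² + ½ ∫_Γ |a·n| v̄²` (`BA_self`): everything in the stability norm except
the streamline term `S = ∑ h_K ‖a·∇v‖²`. That term is recovered by the test function
`z = h_K a(x_K)·∇v`, where `x_K` is a vertex of `K`; it is a polynomial of the same degree. Because
`a` varies by at most `Λ h_K` on `K`, the inverse inequality bounds the effect of freezing `a` by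
`‖v‖`, and Young's inequality together with the discrete trace inequality gives
`B_A(v, (z, 0)) ≥ S / 4 - c₁ J - c₂ μ ‖v‖²` with `J` the jump part of the norm
(`le_BA_streamlinePair`). A small multiple of `(z, 0)` added to `v` is the required test pair. The
inverse and trace inequalities on shape-regular simplices (`exists_inverse_const`) come from the
equivalence of norms on polynomials, scaled to the inscribed ball, and from the divergence theorem
for the radial field.

*Convergence* (`normA_sub_le`) is Céa's argument. The exact solution satisfies the discrete equations
(`BA_strongSolution`), by integration by parts for `H¹` functions, which follows from smooth
approximation. The test pair for the discrete error `v_h - u_h` has the same facet component as the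
error and thus is a difference of two discrete pairs; so Galerkin orthogonality applies to it for
every choice of the space of facet functions.
-/

set_option linter.unusedSectionVars false

noncomputable section

namespace InterfaceStab


/-! ### Barycentric coordinates and facets of a simplex -/

section Simplex

variable {d : ℕ} [NeZero d] (s : Affine.Simplex ℝ (E d) d)

/-- The vertices of a nondegenerate `d`-simplex in `ℝ^d`, as an affine basis; its coordinates are
the barycentric coordinates of the simplex. -/
def bary : AffineBasis (Fin (d + 1)) ℝ (E d) :=
  ⟨s.points, s.independent, by
    rw [s.independent.affineSpan_eq_top_iff_card_eq_finrank_add_one]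
    simp⟩

/-- The outward unit normal on the facet opposite to the `i`-th vertex. -/
def unitNormal (i : Fin (d + 1)) : E d :=
  ‖s.altitudeFoot i - s.points i‖⁻¹ • (s.altitudeFoot i - s.points i)

lemma bary_apply (i : Fin (d + 1)) : bary s i = s.points i := rfl

lemma norm_altitudeFoot_sub (i : Fin (d + 1)) :
    ‖s.altitudeFoot i - s.points i‖ = s.height i := by
  rw [Affine.Simplex.height, dist_comm, dist_eq_norm]

lemma norm_unitNormal (i : Fin (d + 1)) : ‖unitNormal s i‖ = 1 := by
  have h : ‖s.altitudeFoot i - s.points i‖ ≠ 0 := by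
    rw [norm_altitudeFoot_sub]; exact (s.height_pos i).ne'
  rw [unitNormal, norm_smul, norm_inv, norm_norm, inv_mul_cancel₀ h]

lemma inner_unitNormal_self (i : Fin (d + 1)) :
    inner ℝ (unitNormal s i) (unitNormal s i) = 1 := by
  rw [real_inner_self_eq_norm_sq, norm_unitNormal, one_pow]

/-- The `i`-th barycentric coordinate measures the distance to the `i`-th facet in units of the
height. -/
lemma coord_eq (i : Fin (d + 1)) (x : E d) :
    (bary s).coord i x = inner ℝ (s.altitudeFoot i - x) (unitNormal s i) / s.height i := by
  have hH := (s.height_pos i).ne'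
  -- an affine map that agrees with the coordinate on all vertices
  let f : E d →ᵃ[ℝ] ℝ :=
    { toFun := fun x => inner ℝ (s.altitudeFoot i - x) (unitNormal s i) / s.height i
      linear := -((s.height i)⁻¹ • (innerₗ (E d) (unitNormal s i)))
      map_vadd' := fun p v => by
        simp only [vadd_eq_add, LinearMap.neg_apply, LinearMap.smul_apply, innerₗ_apply_apply,
          smul_eq_mul, sub_add_eq_sub_sub_swap, inner_sub_left, real_inner_comm]
        field_simp
        ring }
  have hf : (bary s).coord i = f := by
    refine AffineMap.ext_on (bary s).tot ?_
    rintro _ ⟨j, rfl⟩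
    change _ = inner ℝ (s.altitudeFoot i - bary s j) (unitNormal s i) / s.height i
    rw [AffineBasis.coord_apply, bary_apply]
    by_cases hij : i = j
    · subst hij
      rw [if_pos rfl, unitNormal, inner_smul_right, real_inner_self_eq_norm_sq,
        norm_altitudeFoot_sub]
      field_simp
    · rw [if_neg hij, unitNormal, inner_smul_right]
      have h := s.inner_vsub_altitudeFoot_vsub_altitudeFoot_eq_zero hij
      simp only [vsub_eq_sub] at h
      rw [← neg_sub (s.points j), ← neg_sub (s.points i), inner_neg_neg, h]
      simp
  rw [hf]; rfl

lemma mem_closedInterior_iff (x : E d) :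
    x ∈ s.closedInterior ↔ ∀ j, 0 ≤ (bary s).coord j x := by
  have h := (bary s).sum_coord_apply_eq_one x
  have hx := (bary s).affineCombination_coord_eq_self x
  conv_lhs => rw [← hx]
  erw [Affine.Simplex.affineCombination_mem_closedInterior_iff h]
  refine ⟨fun h j => (h j).1, fun h' j => ⟨h' j, ?_⟩⟩
  rw [← h]
  exact Finset.single_le_sum (fun i _ => h' i) (Finset.mem_univ j)

lemma mem_faceOpposite_iff (i : Fin (d + 1)) (x : E d) :
    x ∈ (s.faceOpposite i).closedInterior ↔
      (bary s).coord i x = 0 ∧ ∀ j, 0 ≤ (bary s).coord j x := by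
  have h := (bary s).sum_coord_apply_eq_one x
  have hx := (bary s).affineCombination_coord_eq_self x
  conv_lhs => rw [← hx]
  rw [Affine.Simplex.faceOpposite]
  erw [Affine.Simplex.affineCombination_mem_closedInterior_face_iff_nonneg _ _ h]
  simp only [Finset.mem_compl, Finset.mem_singleton, not_not, forall_eq]
  constructor
  · rintro ⟨h1, h2⟩
    refine ⟨h2, fun j => ?_⟩
    by_cases hj : j = i
    · subst hj; exact h2.ge
    · exact h1 j hj
  · rintro ⟨h1, h2⟩
    exact ⟨fun j _ => h2 j, h1⟩

lemma interior_closedInterior :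
    interior s.closedInterior = {x | ∀ j, 0 < (bary s).coord j x} := by
  rw [← (bary s).interior_convexHull]
  congr 1
  rw [← Affine.Simplex.convexHull_eq_closedInterior]; rfl

lemma faceOpposite_subset (i : Fin (d + 1)) :
    (s.faceOpposite i).closedInterior ⊆ s.closedInterior :=
  s.closedInterior_faceOpposite_subset_closedInterior i

lemma point_mem_closedInterior (i : Fin (d + 1)) : s.points i ∈ s.closedInterior :=
  s.point_mem_closedInterior i

lemma continuous_coord (i : Fin (d + 1)) : Continuous ((bary s).coord i) :=
  continuous_barycentric_coord (bary s) i

lemma closedInterior_subset_closure_interior :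
    s.closedInterior ⊆ closure (interior s.closedInterior) := by
  have hc : Convex ℝ s.closedInterior := by
    rw [← Affine.Simplex.convexHull_eq_closedInterior]; exact convex_convexHull _ _
  have hne : (interior s.closedInterior).Nonempty := by
    rw [← Affine.Simplex.convexHull_eq_closedInterior]
    exact ⟨_, (bary s).centroid_mem_interior_convexHull⟩
  rw [hc.closure_interior_eq_closure_of_nonempty_interior hne]
  exact subset_closure

/-- A ball contained in a simplex has diameter at most each height. -/
lemma two_mul_radius_le_height {c : E d} {r : ℝ} (hr : 0 < r)
    (hb : Metric.closedBall c r ⊆ s.closedInterior) (i : Fin (d + 1)) :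
    2 * r ≤ s.height i := by
  have hH := s.height_pos i
  have hm : c - r • unitNormal s i ∈ s.closedInterior := hb (by
    simp [norm_smul, norm_unitNormal, abs_of_pos hr])
  have hp : c + r • unitNormal s i ∈ s.closedInterior := hb (by
    simp [norm_smul, norm_unitNormal, abs_of_pos hr])
  have h1 := (mem_closedInterior_iff s _).1 hp i
  have h2 : (bary s).coord i (c - r • unitNormal s i) ≤ 1 := by
    rw [← (bary s).sum_coord_apply_eq_one (c - r • unitNormal s i)]
    exact Finset.single_le_sum (fun j _ => (mem_closedInterior_iff s _).1 hm j)
      (Finset.mem_univ i)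
  rw [coord_eq] at h1 h2
  rw [div_le_one hH] at h2
  rw [le_div_iff₀ hH, zero_mul] at h1
  simp only [inner_sub_left, inner_add_left, inner_smul_left, inner_unitNormal_self] at h1 h2
  simp at h1 h2
  linarith

lemma inner_sub_unitNormal_of_coord_eq_zero {i : Fin (d + 1)} {x y : E d}
    (hx : (bary s).coord i x = 0) (hy : (bary s).coord i y = 0) :
    inner ℝ (x - y) (unitNormal s i) = 0 := by
  have hH := (s.height_pos i).ne'
  rw [coord_eq, div_eq_zero_iff, or_iff_left hH, inner_sub_left] at hx hy
  rw [inner_sub_left]; linarith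

lemma coord_add_eq (i : Fin (d + 1)) (x v : E d) :
    (bary s).coord i (x + v) = (bary s).coord i x - inner ℝ v (unitNormal s i) / s.height i := by
  rw [coord_eq, coord_eq, ← sub_div]
  congr 1
  simp only [inner_sub_left, inner_add_left]
  ring

lemma coord_altitudeFoot (i : Fin (d + 1)) : (bary s).coord i (s.altitudeFoot i) = 0 := by
  rw [coord_eq]; simp

lemma coord_point (i j : Fin (d + 1)) :
    (bary s).coord i (s.points j) = if i = j then 1 else 0 := by
  rw [← bary_apply, AffineBasis.coord_apply]

/-- The zero set of a barycentric coordinate is a null set. -/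
lemma volume_coord_eq_zero (i : Fin (d + 1)) :
    volume {x : E d | (bary s).coord i x = 0} = 0 := by
  let A : AffineSubspace ℝ (E d) := (AffineSubspace.mk' (0 : ℝ) ⊥).comap ((bary s).coord i)
  have hA : (A : Set (E d)) = {x : E d | (bary s).coord i x = 0} := by
    ext x; simp [A]
  rw [← hA]
  refine Measure.addHaar_affineSubspace _ _ fun h => ?_
  have : s.points i ∈ (A : Set (E d)) := by rw [h]; trivial
  rw [hA, Set.mem_ofPred_eq, coord_point, if_pos rfl] at this
  exact one_ne_zero this

lemma ae_mem_interior :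
    ∀ᵐ x ∂(volume.restrict s.closedInterior), x ∈ interior s.closedInterior := by
  rw [ae_restrict_iff' s.isClosed_closedInterior.measurableSet]
  have h : ∀ᵐ x : E d, ∀ i, (bary s).coord i x ≠ 0 :=
    ae_all_iff.2 fun i => by
      rw [ae_iff]; simpa using volume_coord_eq_zero s i
  filter_upwards [h] with x hx hxs
  rw [interior_closedInterior]
  exact fun j => lt_of_le_of_ne ((mem_closedInterior_iff s x).1 hxs j) (hx j).symm

end Simplex


/-! ### The surface measure of a facet -/

section Coordinates

variable {d : ℕ} (p m : E d) (hm : ‖m‖ = 1)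

include hm in
lemma finrank_orthogonal_unit : Module.finrank ℝ (ℝ ∙ m)ᗮ = d - 1 := by
  have h := (ℝ ∙ m).finrank_add_finrank_orthogonal
  have h0 : m ≠ 0 := by rintro rfl; simp at hm
  rw [finrank_span_singleton h0, finrank_euclideanSpace_fin] at h
  omega

/-- Cartesian coordinates adapted to the hyperplane through `p` orthogonal to `m`. -/
def slab (q : ℝ × (ℝ ∙ m)ᗮ) : E d := p + (q.1 • m + q.2)

include hm in
/-- Splitting off the direction of a unit vector preserves Lebesgue measure. -/
lemma measurePreserving_slab : MeasurePreserving (slab p m) ∧ MeasurableEmbedding (slab p m) := by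
  let e1 : ℝ ≃ᵐ (ℝ ∙ m) := (LinearIsometryEquiv.toSpanUnitSingleton m hm).toMeasurableEquiv
  have he1 : MeasurePreserving e1 := (LinearIsometryEquiv.toSpanUnitSingleton m hm).measurePreserving
  let e2 : ℝ × (ℝ ∙ m)ᗮ ≃ᵐ (ℝ ∙ m) × (ℝ ∙ m)ᗮ := e1.prodCongr (MeasurableEquiv.refl _)
  have he2 : MeasurePreserving e2 := he1.prod (MeasurePreserving.id volume)
  let e3 := e2.trans ((ℝ ∙ m).measurableEquivProd p).symm
  have he3 : MeasurePreserving e3 := by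
    have h := (ℝ ∙ m).measurePreserving_measurableEquivProd p
    rw [InnerProductSpace.euclideanHausdorffMeasure_eq_volume] at h
    exact he2.trans h.symm
  have he : (e3 : ℝ × (ℝ ∙ m)ᗮ → E d) = slab p m := by
    funext q
    simp only [e3, MeasurableEquiv.coe_trans, Function.comp_apply,
      Submodule.measurableEquivProd_symm_apply, slab, vadd_eq_add]
    rw [add_comm]
    rfl
  rw [← he]
  exact ⟨he3, e3.measurableEmbedding⟩

include hm in
lemma integral_eq_integral_slab {f : E d → ℝ} (hf : Integrable f) :
    Integrable (fun q => f (slab p m q)) ∧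
      ∫ x, f x = ∫ τ : ℝ, ∫ y : (ℝ ∙ m)ᗮ, f (slab p m (τ, y)) := by
  obtain ⟨h1, h2⟩ := measurePreserving_slab p m hm
  have hi : Integrable (fun q => f (slab p m q)) := (h1.integrable_comp_emb h2).2 hf
  refine ⟨hi, ?_⟩
  rw [← h1.integral_comp h2]
  exact integral_prod _ hi

include hm in
/-- The surface measure of a hyperplane is its Lebesgue measure. -/
lemma map_volume_hyperplane :
    (volume : Measure (ℝ ∙ m)ᗮ).map (fun y => slab p m (0, y)) =
      (μHE[d - 1] : Measure (E d)).restrict (Set.range fun y => slab p m (0, y)) := by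
  have hiso : Isometry fun y : (ℝ ∙ m)ᗮ => slab p m (0, y) :=
    Isometry.of_dist_eq fun x y => by simp [slab, dist_eq_norm]
  rw [← hiso.map_euclideanHausdorffMeasure, ← finrank_orthogonal_unit m hm,
    InnerProductSpace.euclideanHausdorffMeasure_eq_volume]

include hm in
lemma measurableEmbedding_hyperplane :
    MeasurableEmbedding fun y : (ℝ ∙ m)ᗮ => slab p m (0, y) := by
  have hiso : Isometry fun y : (ℝ ∙ m)ᗮ => slab p m (0, y) :=
    Isometry.of_dist_eq fun x y => by simp [slab, dist_eq_norm]
  exact hiso.isClosedEmbedding.measurableEmbedding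

include hm in
lemma setIntegral_hyperplane {F : Set (E d)} (hF : MeasurableSet F)
    (hsub : F ⊆ Set.range fun y => slab p m (0, y)) (g : E d → ℝ) :
    ∫ x in F, g x ∂μHE[d - 1] = ∫ y : (ℝ ∙ m)ᗮ, F.indicator g (slab p m (0, y)) := by
  have hm' := measurableEmbedding_hyperplane p m hm
  rw [← hm'.integral_map, map_volume_hyperplane p m hm, integral_indicator hF,
    Measure.restrict_restrict hF, Set.inter_eq_left.2 hsub]

include hm in
lemma hausdorff_lt_top_of_subset_hyperplane {F : Set (E d)} (hF : IsCompact F)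
    (hsub : F ⊆ Set.range fun y => slab p m (0, y)) :
    (μHE[d - 1] : Measure (E d)) F < ⊤ := by
  have hm' := measurableEmbedding_hyperplane p m hm
  have hiso : Isometry fun y : (ℝ ∙ m)ᗮ => slab p m (0, y) :=
    Isometry.of_dist_eq fun x y => by simp [slab, dist_eq_norm]
  have h : (μHE[d - 1] : Measure (E d)) F =
      volume ((fun y : (ℝ ∙ m)ᗮ => slab p m (0, y)) ⁻¹' F) := by
    rw [← hm'.map_apply, map_volume_hyperplane p m hm, Measure.restrict_apply hF.measurableSet,
      Set.inter_eq_left.2 hsub]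
  rw [h]
  exact (hiso.isClosedEmbedding.isCompact_preimage hF).measure_lt_top

end Coordinates

section FacetMeasure

variable {d : ℕ} [NeZero d] (s : Affine.Simplex ℝ (E d) d)

lemma norm_neg_unitNormal (i : Fin (d + 1)) : ‖-unitNormal s i‖ = 1 := by
  rw [norm_neg, norm_unitNormal]

/-- In coordinates adapted to a facet, the corresponding barycentric coordinate is the normal
coordinate divided by the height. -/
lemma coord_slab (i : Fin (d + 1)) (q : ℝ × (ℝ ∙ (-unitNormal s i))ᗮ) :
    (bary s).coord i (slab (s.altitudeFoot i) (-unitNormal s i) q) = q.1 / s.height i := by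
  have hq : inner ℝ (q.2 : E d) (unitNormal s i) = 0 := by
    have := Submodule.mem_orthogonal_singleton_iff_inner_left.1 q.2.2
    simpa using this
  rw [slab, coord_add_eq, coord_altitudeFoot, inner_add_left, hq, inner_smul_left, inner_neg_left,
    inner_unitNormal_self]
  simp [neg_div]

lemma facet_subset_hyperplane (i : Fin (d + 1)) :
    {x | (bary s).coord i x = 0} ⊆
      Set.range fun y => slab (s.altitudeFoot i) (-unitNormal s i) (0, y) := by
  intro x hx
  have h := inner_sub_unitNormal_of_coord_eq_zero s hx (coord_altitudeFoot s i)
  refine ⟨⟨x - s.altitudeFoot i, ?_⟩, by simp [slab]⟩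
  rw [Submodule.mem_orthogonal_singleton_iff_inner_left, inner_neg_right, h, neg_zero]

lemma isCompact_faceOpposite (i : Fin (d + 1)) : IsCompact (s.faceOpposite i).closedInterior :=
  (s.faceOpposite i).isCompact_closedInterior

lemma hausdorff_facet_lt_top (i : Fin (d + 1)) :
    (μHE[d - 1] : Measure (E d)) (s.faceOpposite i).closedInterior < ⊤ :=
  hausdorff_lt_top_of_subset_hyperplane (s.altitudeFoot i) _ (norm_neg_unitNormal s i)
    (isCompact_faceOpposite s i) fun x hx =>
      facet_subset_hyperplane s i ((mem_faceOpposite_iff s i x).1 hx).1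

lemma setIntegral_facet (i : Fin (d + 1)) (g : E d → ℝ) :
    ∫ x in (s.faceOpposite i).closedInterior, g x ∂μHE[d - 1] =
      ∫ y : (ℝ ∙ (-unitNormal s i))ᗮ, (s.faceOpposite i).closedInterior.indicator g
        (slab (s.altitudeFoot i) (-unitNormal s i) (0, y)) :=
  setIntegral_hyperplane _ _ (norm_neg_unitNormal s i)
    (isCompact_faceOpposite s i).isClosed.measurableSet
    (fun x hx => facet_subset_hyperplane s i ((mem_faceOpposite_iff s i x).1 hx).1) g

/-- Almost every point of the hyperplane of a facet avoids the zero sets of the other barycentric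
coordinates. -/
lemma ae_coord_ne_zero_of_ne {i j : Fin (d + 1)} (hij : j ≠ i) :
    ∀ᵐ y : (ℝ ∙ (-unitNormal s i))ᗮ,
      (bary s).coord j (slab (s.altitudeFoot i) (-unitNormal s i) (0, y)) ≠ 0 := by
  set m := -unitNormal s i with hm
  let A : AffineSubspace ℝ (E d) := (AffineSubspace.mk' (0 : ℝ) ⊥).comap ((bary s).coord j)
  let ι : (ℝ ∙ m)ᗮ →ᵃ[ℝ] E d :=
    AffineMap.const ℝ _ (s.altitudeFoot i) + (ℝ ∙ m)ᗮ.subtype.toAffineMap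
  have hι : ∀ y, ι y = slab (s.altitudeFoot i) m (0, y) := fun y => by simp [ι, slab]
  have hA : ((A.comap ι : AffineSubspace ℝ _) : Set (ℝ ∙ m)ᗮ) =
      {y | ¬ (bary s).coord j (slab (s.altitudeFoot i) m (0, y)) ≠ 0} := by
    ext y; simp [A, hι]
  rw [ae_iff, ← hA]
  refine Measure.addHaar_affineSubspace _ _ fun h => ?_
  obtain ⟨y, hy⟩ := facet_subset_hyperplane s i (show s.points j ∈ _ by
    rw [Set.mem_ofPred_eq, coord_point, if_neg hij.symm])
  have : y ∈ ((A.comap ι : AffineSubspace ℝ _) : Set (ℝ ∙ m)ᗮ) := by rw [h]; trivial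
  rw [hA, Set.mem_ofPred_eq, not_not] at this
  simp only at hy
  rw [hy, coord_point, if_pos rfl] at this
  exact one_ne_zero this

end FacetMeasure


/-! ### Boundary layers of a simplex -/

section Ramp

/-- A smooth monotone function that vanishes on `(-∞, 1]` and equals `1` on `[2, ∞)`. -/
def ramp (t : ℝ) : ℝ := Real.smoothTransition (t - 1)

lemma contDiff_ramp : ContDiff ℝ ∞ ramp :=
  Real.smoothTransition.contDiff.comp (contDiff_id.sub contDiff_const)

lemma ramp_of_le_one {t : ℝ} (ht : t ≤ 1) : ramp t = 0 :=
  Real.smoothTransition.zero_of_nonpos (by linarith)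

lemma ramp_of_two_le {t : ℝ} (ht : 2 ≤ t) : ramp t = 1 :=
  Real.smoothTransition.one_of_one_le (by linarith)

lemma ramp_nonneg (t : ℝ) : 0 ≤ ramp t := Real.smoothTransition.nonneg _

lemma ramp_le_one (t : ℝ) : ramp t ≤ 1 := Real.smoothTransition.le_one _

lemma continuous_ramp : Continuous ramp := contDiff_ramp.continuous

lemma continuous_deriv_ramp : Continuous (deriv ramp) :=
  contDiff_ramp.continuous_deriv (by simp)

lemma deriv_ramp_of_le_one {t : ℝ} (ht : t ≤ 1) : deriv ramp t = 0 := by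
  refine IsLocalMin.deriv_eq_zero (Eventually.of_forall fun x => ?_)
  rw [ramp_of_le_one ht]; exact ramp_nonneg x

lemma deriv_ramp_of_two_le {t : ℝ} (ht : 2 ≤ t) : deriv ramp t = 0 := by
  refine IsLocalMax.deriv_eq_zero (Eventually.of_forall fun x => ?_)
  rw [ramp_of_two_le ht]; exact ramp_le_one x

lemma hasCompactSupport_deriv_ramp : HasCompactSupport (deriv ramp) :=
  HasCompactSupport.intro (K := Set.Icc 1 2) isCompact_Icc fun t ht => by
    by_cases h : t ≤ 1
    · exact deriv_ramp_of_le_one h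
    · refine deriv_ramp_of_two_le (not_lt.1 fun h2 => ht ⟨by linarith, h2.le⟩)

lemma integrable_deriv_ramp : Integrable (deriv ramp) :=
  continuous_deriv_ramp.integrable_of_hasCompactSupport hasCompactSupport_deriv_ramp

lemma integral_deriv_ramp : ∫ t, deriv ramp t = 1 := by
  have h := integral_of_hasDerivAt_of_tendsto (f := ramp) (f' := deriv ramp) (m := 0) (n := 1)
    (fun x => ((contDiff_ramp.differentiable (by simp)) x).hasDerivAt) integrable_deriv_ramp
    (tendsto_const_nhds.congr' ((eventually_le_atBot 1).mono fun t ht => (ramp_of_le_one ht).symm))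
    (tendsto_const_nhds.congr' ((eventually_ge_atTop 2).mono fun t ht => (ramp_of_two_le ht).symm))
  simpa using h

end Ramp

section BoundaryLayer

variable {d : ℕ} [NeZero d] (s : Affine.Simplex ℝ (E d) d)

lemma exists_norm_le_of_slab_mem (i : Fin (d + 1)) :
    ∃ R : ℝ, ∀ q : ℝ × (ℝ ∙ (-unitNormal s i))ᗮ,
      slab (s.altitudeFoot i) (-unitNormal s i) q ∈ s.closedInterior → ‖q.2‖ ≤ R := by
  obtain ⟨R, hR⟩ := s.isCompact_closedInterior.isBounded.subset_closedBall (s.altitudeFoot i)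
  refine ⟨R + s.height i, fun q hq => ?_⟩
  have hH := s.height_pos i
  have h1 := (mem_closedInterior_iff s _).1 hq
  have h2 : (bary s).coord i (slab (s.altitudeFoot i) (-unitNormal s i) q) ≤ 1 := by
    rw [← (bary s).sum_coord_apply_eq_one (slab (s.altitudeFoot i) (-unitNormal s i) q)]
    exact Finset.single_le_sum (fun j _ => h1 j) (Finset.mem_univ i)
  have h3 := h1 i
  rw [coord_slab] at h2 h3
  rw [div_le_one hH] at h2
  have h4 : 0 ≤ q.1 := by rwa [le_div_iff₀ hH, zero_mul] at h3
  have h5 : ‖q.1 • (-unitNormal s i) + (q.2 : E d)‖ ≤ R := by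
    have := hR hq
    rwa [Metric.mem_closedBall, dist_eq_norm, slab, add_sub_cancel_left] at this
  have h6 : ‖q.1 • (-unitNormal s i)‖ ≤ s.height i := by
    rw [norm_smul, norm_neg_unitNormal, mul_one, Real.norm_of_nonneg h4]; exact h2
  calc ‖q.2‖ = ‖(q.1 • (-unitNormal s i) + (q.2 : E d)) - q.1 • (-unitNormal s i)‖ := by
        rw [add_sub_cancel_left]; rfl
    _ ≤ _ := (norm_sub_le _ _).trans (add_le_add h5 h6)

lemma measurable_indicator_of_continuousOn {g : E d → ℝ} {K : Set (E d)} (hK : IsClosed K)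
    (hg : ContinuousOn g K) : Measurable (K.indicator g) := by
  classical
  rw [← Set.piecewise_eq_indicator]
  exact hg.measurable_piecewise continuousOn_const hK.measurableSet

lemma continuous_slab (p m : E d) : Continuous (slab p m) := by
  unfold slab; fun_prop

/-- The integrand on the slice at distance `ε t` from a facet, as the layer shrinks. -/
lemma tendsto_slice {g : E d → ℝ} (hg : ContinuousOn g s.closedInterior) (i : Fin (d + 1)) {t : ℝ}
    (ht : 0 < t) {y : (ℝ ∙ (-unitNormal s i))ᗮ}
    (hy : ∀ j, j ≠ i → (bary s).coord j (slab (s.altitudeFoot i) (-unitNormal s i) (0, y)) ≠ 0) :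
    Tendsto (fun ε : ℝ =>
      (∏ j ∈ Finset.univ.erase i,
        ramp ((bary s).coord j (slab (s.altitudeFoot i) (-unitNormal s i) (ε * t, y)) / ε)) *
        s.closedInterior.indicator g (slab (s.altitudeFoot i) (-unitNormal s i) (ε * t, y)))
      (𝓝[>] 0) (𝓝 ((s.faceOpposite i).closedInterior.indicator g
        (slab (s.altitudeFoot i) (-unitNormal s i) (0, y)))) := by
  set S := slab (s.altitudeFoot i) (-unitNormal s i) with hS
  have hSc : Continuous S := continuous_slab _ _
  have hlim : Tendsto (fun ε : ℝ => S (ε * t, y)) (𝓝[>] 0) (𝓝 (S (0, y))) := by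
    have h : Continuous fun ε : ℝ => S (ε * t, y) := by fun_prop
    have := h.tendsto 0
    simp only [zero_mul] at this
    exact this.mono_left nhdsWithin_le_nhds
  have hlimc : ∀ j, Tendsto (fun ε : ℝ => (bary s).coord j (S (ε * t, y))) (𝓝[>] 0)
      (𝓝 ((bary s).coord j (S (0, y)))) := fun j =>
    ((continuous_coord s j).tendsto _).comp hlim
  have hi : ∀ τ : ℝ, (bary s).coord i (S (τ, y)) = τ / s.height i := fun τ => coord_slab s i _
  by_cases hpos : ∀ j, j ≠ i → 0 < (bary s).coord j (S (0, y))
  · have hmem : S (0, y) ∈ (s.faceOpposite i).closedInterior := by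
      rw [mem_faceOpposite_iff]
      refine ⟨by rw [hi, zero_div], fun j => ?_⟩
      by_cases hj : j = i
      · rw [hj, hi, zero_div]
      · exact (hpos j hj).le
    rw [Set.indicator_of_mem hmem]
    have hev : ∀ᶠ ε in 𝓝[>] (0 : ℝ), S (ε * t, y) ∈ s.closedInterior := by
      have h1 : ∀ᶠ ε in 𝓝[>] (0 : ℝ), ∀ j, j ≠ i → 0 < (bary s).coord j (S (ε * t, y)) :=
        eventually_all.2 fun j => by
          by_cases hj : j = i
          · simp [hj]
          · filter_upwards [(hlimc j).eventually (lt_mem_nhds (hpos j hj))] with ε hε _ using hε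
      filter_upwards [h1, self_mem_nhdsWithin] with ε hε hε0
      rw [mem_closedInterior_iff]
      intro j
      by_cases hj : j = i
      · rw [hj, hi]
        have := s.height_pos i
        have : 0 < ε := hε0
        positivity
      · exact (hε j hj).le
    have hg1 : Tendsto (fun ε : ℝ => s.closedInterior.indicator g (S (ε * t, y))) (𝓝[>] 0)
        (𝓝 (g (S (0, y)))) := by
      have h1 := (hg _ (faceOpposite_subset s i hmem)).tendsto.comp
        (tendsto_nhdsWithin_iff.2 ⟨hlim, hev⟩)
      refine h1.congr' ?_
      filter_upwards [hev] with ε hε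
      rw [Set.indicator_of_mem hε]; rfl
    have hprod : Tendsto (fun ε : ℝ => ∏ j ∈ Finset.univ.erase i,
        ramp ((bary s).coord j (S (ε * t, y)) / ε)) (𝓝[>] 0) (𝓝 1) := by
      have h0 : (1 : ℝ) = ∏ j ∈ Finset.univ.erase i, (1 : ℝ) := by simp
      rw [h0]
      refine tendsto_finsetProd _ fun j hj => ?_
      have h1 : Tendsto (fun ε : ℝ => (bary s).coord j (S (ε * t, y)) * ε⁻¹) (𝓝[>] 0) atTop :=
        (hlimc j).pos_mul_atTop (hpos j (Finset.ne_of_mem_erase hj)) tendsto_inv_nhdsGT_zero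
      refine tendsto_const_nhds.congr' ?_
      filter_upwards [h1.eventually_ge_atTop 2] with ε hε
      rw [div_eq_mul_inv, ramp_of_two_le hε]
    simpa using hprod.mul hg1
  · push Not at hpos
    obtain ⟨j, hj, hle⟩ := hpos
    have hlt : (bary s).coord j (S (0, y)) < 0 := lt_of_le_of_ne hle (hy j hj)
    have hnot : S (0, y) ∉ (s.faceOpposite i).closedInterior := fun h =>
      absurd (((mem_faceOpposite_iff s i _).1 h).2 j) (not_le.2 hlt)
    rw [Set.indicator_of_notMem hnot]
    refine tendsto_const_nhds.congr' ?_
    filter_upwards [(hlimc j).eventually (gt_mem_nhds hlt)] with ε hε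
    rw [Set.indicator_of_notMem (fun h => absurd ((mem_closedInterior_iff s _).1 h j)
      (not_le.2 hε)), mul_zero]

lemma abs_prod_ramp_mul_le {ι : Type*} (J : Finset ι) (c : ι → ℝ) (a : ℝ) :
    |(∏ j ∈ J, ramp (c j)) * a| ≤ |a| := by
  rw [abs_mul, abs_of_nonneg (Finset.prod_nonneg fun j _ => ramp_nonneg _)]
  exact mul_le_of_le_one_left (abs_nonneg _)
    (Finset.prod_le_one (fun j _ => ramp_nonneg _) fun j _ => ramp_le_one _)

/-- The mass of the smoothed derivative of the indicator function of a simplex, near one facet,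
concentrates on that facet. -/
lemma tendsto_boundaryLayer {g : E d → ℝ} (hg : ContinuousOn g s.closedInterior)
    (i : Fin (d + 1)) :
    Tendsto (fun ε : ℝ => ∫ x in s.closedInterior, ε⁻¹ * (deriv ramp ((bary s).coord i x / ε) *
      ((∏ j ∈ Finset.univ.erase i, ramp ((bary s).coord j x / ε)) * g x))) (𝓝[>] 0)
      (𝓝 (s.height i * ∫ x in (s.faceOpposite i).closedInterior, g x ∂μHE[d - 1])) := by
  set S := slab (s.altitudeFoot i) (-unitNormal s i) with hS
  set K := s.closedInterior with hK
  set F := (s.faceOpposite i).closedInterior with hF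
  have hSc : Continuous S := continuous_slab _ _
  have hH := s.height_pos i
  have hKm : MeasurableSet K := s.isClosed_closedInterior.measurableSet
  obtain ⟨R, hR⟩ := exists_norm_le_of_slab_mem s i
  obtain ⟨M, hM⟩ := s.isCompact_closedInterior.exists_bound_of_continuousOn hg
  have hgm : Measurable (K.indicator g) :=
    measurable_indicator_of_continuousOn s.isClosed_closedInterior hg
  let P : ℝ → ℝ → (ℝ ∙ (-unitNormal s i))ᗮ → ℝ := fun ε t y =>
    (∏ j ∈ Finset.univ.erase i, ramp ((bary s).coord j (S (ε * t, y)) / ε)) *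
      K.indicator g (S (ε * t, y))
  let Y0 : ℝ := ∫ y : (ℝ ∙ (-unitNormal s i))ᗮ, F.indicator g (S (0, y))
  let B : (ℝ ∙ (-unitNormal s i))ᗮ → ℝ := (Metric.closedBall 0 R).indicator fun _ => |M|
  have hB : Integrable B :=
    (integrableOn_const (by exact (isCompact_closedBall _ _).measure_lt_top.ne)).integrable_indicator
      Metric.isClosed_closedBall.measurableSet
  have hPB : ∀ ε t y, ‖P ε t y‖ ≤ B y := by
    intro ε t y
    refine (abs_prod_ramp_mul_le _ _ _).trans ?_
    by_cases h : S (ε * t, y) ∈ K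
    · rw [Set.indicator_of_mem h]
      simp only [B]
      rw [Set.indicator_of_mem (by simpa using hR _ h)]
      exact (hM _ h).trans (le_abs_self M)
    · rw [Set.indicator_of_notMem h, abs_zero]
      exact Set.indicator_nonneg (fun _ _ => abs_nonneg M) y
  have hPm : ∀ ε t, Measurable (P ε t) := by
    intro ε t
    have h1 : Continuous fun y : (ℝ ∙ (-unitNormal s i))ᗮ => S (ε * t, y) := by fun_prop
    refine Measurable.mul ?_ (hgm.comp h1.measurable)
    refine Continuous.measurable (continuous_finsetProd _ fun j _ => ?_)
    exact continuous_ramp.comp (((continuous_coord s j).comp h1).div_const ε)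
  -- rewriting the volume integral as an iterated integral in rescaled coordinates
  have key : ∀ ε : ℝ, 0 < ε →
      Integrable (fun t => deriv ramp (t / s.height i) * ∫ y, P ε t y) ∧
      ∫ x in K, ε⁻¹ * (deriv ramp ((bary s).coord i x / ε) *
        ((∏ j ∈ Finset.univ.erase i, ramp ((bary s).coord j x / ε)) * g x)) =
      ∫ t : ℝ, deriv ramp (t / s.height i) * ∫ y, P ε t y := by
    intro ε hε
    let f : E d → ℝ := K.indicator fun x => ε⁻¹ * (deriv ramp ((bary s).coord i x / ε) *
        ((∏ j ∈ Finset.univ.erase i, ramp ((bary s).coord j x / ε)) * g x))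
    have hf : Integrable f := by
      refine IntegrableOn.integrable_indicator (ContinuousOn.integrableOn_compact
        s.isCompact_closedInterior ?_) hKm
      refine continuousOn_const.mul (ContinuousOn.mul ?_ (ContinuousOn.mul ?_ hg))
      · exact (continuous_deriv_ramp.comp ((continuous_coord s i).div_const ε)).continuousOn
      · exact (continuous_finsetProd _ fun j _ =>
          continuous_ramp.comp ((continuous_coord s j).div_const ε)).continuousOn
    obtain ⟨hi, he⟩ := integral_eq_integral_slab (s.altitudeFoot i) _ (norm_neg_unitNormal s i) hf
    have hG := hi.integral_prod_left
    have hval : ∀ t : ℝ, ε * ∫ y, f (S (ε * t, y)) =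
        deriv ramp (t / s.height i) * ∫ y, P ε t y := by
      intro t
      rw [← integral_const_mul, ← integral_const_mul]
      refine integral_congr_ae (Eventually.of_forall fun y => ?_)
      simp only [f, P]
      by_cases h : S (ε * t, y) ∈ K
      · rw [Set.indicator_of_mem h, Set.indicator_of_mem h, hS, coord_slab, ← mul_assoc,
          mul_inv_cancel₀ hε.ne', one_mul]
        congr 2
        field_simp
      · rw [Set.indicator_of_notMem h, Set.indicator_of_notMem h]; simp
    constructor
    · refine Integrable.congr ((hG.comp_mul_left' hε.ne').const_mul ε) ?_
      exact Eventually.of_forall hval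
    · rw [← integral_indicator hKm]
      change ∫ x, f x = _
      rw [he]
      have h2 := Measure.integral_comp_mul_left (fun τ => ∫ y, f (S (τ, y))) ε
      rw [abs_of_pos (inv_pos.2 hε), smul_eq_mul] at h2
      calc _ = ε * (ε⁻¹ * ∫ τ, ∫ y, f (S (τ, y))) := by
            rw [← mul_assoc, mul_inv_cancel₀ hε.ne', one_mul]
        _ = ∫ t, ε * ∫ y, f (S (ε * t, y)) := by rw [← h2, integral_const_mul]
        _ = _ := integral_congr_ae (Eventually.of_forall hval)
  -- the limit on each slice
  have hslice : ∀ t : ℝ, 0 < t → Tendsto (fun ε : ℝ => ∫ y, P ε t y) (𝓝[>] 0) (𝓝 Y0) := by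
    intro t ht
    refine tendsto_integral_filter_of_dominated_convergence B
      (Eventually.of_forall fun ε => (hPm ε t).aestronglyMeasurable)
      (Eventually.of_forall fun ε => Eventually.of_forall fun y => hPB ε t y) hB ?_
    have hae : ∀ᵐ y : (ℝ ∙ (-unitNormal s i))ᗮ, ∀ j, j ≠ i →
        (bary s).coord j (S (0, y)) ≠ 0 := ae_all_iff.2 fun j => by
      by_cases hj : j = i
      · simp [hj]
      · filter_upwards [ae_coord_ne_zero_of_ne s hj] with y hy _ using hy
    filter_upwards [hae] with y hy
    exact tendsto_slice s hg i ht hy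
  have hY : ∀ ε t, |∫ y, P ε t y| ≤ ∫ y, B y := fun ε t =>
    norm_integral_le_of_norm_le hB (Eventually.of_forall fun y => hPB ε t y)
  have hmain : Tendsto (fun ε : ℝ => ∫ t : ℝ, deriv ramp (t / s.height i) * ∫ y, P ε t y) (𝓝[>] 0)
      (𝓝 (∫ t : ℝ, deriv ramp (t / s.height i) * Y0)) := by
    refine tendsto_integral_filter_of_dominated_convergence
      (fun t => |deriv ramp (t / s.height i)| * ∫ y, B y) ?_ ?_ ?_ ?_
    · filter_upwards [self_mem_nhdsWithin] with ε hε using (key ε hε).1.aestronglyMeasurable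
    · refine Eventually.of_forall fun ε => Eventually.of_forall fun t => ?_
      rw [norm_mul]
      exact mul_le_mul_of_nonneg_left (hY ε t) (norm_nonneg _)
    · exact ((integrable_deriv_ramp.comp_div hH.ne').abs).mul_const _
    · refine Eventually.of_forall fun t => ?_
      by_cases ht : 0 < t
      · exact (hslice t ht).const_mul _
      · have : deriv ramp (t / s.height i) = 0 := deriv_ramp_of_le_one
          ((div_nonpos_of_nonpos_of_nonneg (not_lt.1 ht) hH.le).trans zero_le_one)
        simp [this]
  have hY0 : Y0 = ∫ x in F, g x ∂μHE[d - 1] := (setIntegral_facet s i g).symm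
  have hlast : ∫ t : ℝ, deriv ramp (t / s.height i) * Y0 =
      s.height i * ∫ x in F, g x ∂μHE[d - 1] := by
    rw [integral_mul_const, Measure.integral_comp_div, integral_deriv_ramp, abs_of_pos hH, hY0,
      smul_eq_mul, mul_one]
  rw [← hlast]
  refine hmain.congr' ?_
  filter_upwards [self_mem_nhdsWithin] with ε hε using (key ε hε).2.symm

end BoundaryLayer


/-! ### The divergence theorem on a simplex -/

section Divergence

variable {d : ℕ}

lemma inner_gradient_eq (f : E d → ℝ) (x v : E d) :
    inner ℝ v (gradient f x) = fderiv ℝ f x v := by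
  rw [gradient, real_inner_comm, InnerProductSpace.toDual_symm_apply]

variable [NeZero d] (s : Affine.Simplex ℝ (E d) d)

lemma hasFDerivAt_coord (i : Fin (d + 1)) (x : E d) :
    HasFDerivAt (fun x => (bary s).coord i x)
      (-((s.height i)⁻¹ • innerSL ℝ (unitNormal s i))) x := by
  have h : (fun x => (bary s).coord i x) = fun x =>
      (bary s).coord i 0 + (-((s.height i)⁻¹ • innerSL ℝ (unitNormal s i))) x := by
    funext x
    have := coord_add_eq s i 0 x
    rw [zero_add] at this
    simp only [this, neg_apply, smul_apply, innerSL_apply_apply, smul_eq_mul]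
    rw [real_inner_comm]; ring
  rw [h]
  exact (ContinuousLinearMap.hasFDerivAt _).const_add _

/-- A smooth function with compact support in the interior of the simplex that equals `1` where
all barycentric coordinates are at least `2ε`. -/
def cutoff (ε : ℝ) (x : E d) : ℝ := ∏ j, ramp ((bary s).coord j x / ε)

lemma contDiff_coord (i : Fin (d + 1)) : ContDiff ℝ ∞ fun x => (bary s).coord i x := by
  have h : (fun x => (bary s).coord i x) = fun x =>
      inner ℝ (s.altitudeFoot i - x) (unitNormal s i) / s.height i := by
    funext x; exact coord_eq s i x
  rw [h]
  exact ((contDiff_const.sub contDiff_id).inner ℝ contDiff_const).div_const _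

lemma contDiff_cutoff (ε : ℝ) : ContDiff ℝ ∞ (cutoff s ε) := by
  unfold cutoff
  exact contDiff_prod fun j _ => contDiff_ramp.comp ((contDiff_coord s j).div_const ε)

lemma isTestFunction_cutoff_mul {ε : ℝ} (hε : 0 < ε) {ψ : E d → ℝ} (hψ : ContDiff ℝ ∞ ψ) :
    IsTestFunction (interior s.closedInterior) fun x => cutoff s ε x * ψ x := by
  have hsub : tsupport (fun x => cutoff s ε x * ψ x) ⊆ {x | ∀ j, ε ≤ (bary s).coord j x} := by
    refine closure_minimal (fun x hx j => ?_) ?_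
    · by_contra hlt
      refine hx ?_
      simp only [cutoff]
      rw [Finset.prod_eq_zero (Finset.mem_univ j), zero_mul]
      exact ramp_of_le_one ((div_le_one hε).2 (not_le.1 hlt).le)
    · simp only [Set.ofPred_forall]
      exact isClosed_iInter fun j => isClosed_le continuous_const (continuous_coord s j)
  refine ⟨(contDiff_cutoff s ε).mul hψ, ?_, ?_⟩
  · refine HasCompactSupport.of_support_subset_isCompact s.isCompact_closedInterior fun x hx => ?_
    rw [mem_closedInterior_iff]
    exact fun j => hε.le.trans (hsub (subset_tsupport _ hx) j)
  · rw [interior_closedInterior]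
    exact fun x hx j => hε.trans_le (hsub hx j)

lemma fderiv_cutoff_mul {ε : ℝ} {ψ : E d → ℝ} (hψ : ContDiff ℝ ∞ ψ) (x v : E d) :
    fderiv ℝ (fun x => cutoff s ε x * ψ x) x v = cutoff s ε x * fderiv ℝ ψ x v -
      ∑ i, ε⁻¹ * (deriv ramp ((bary s).coord i x / ε) *
        ((∏ j ∈ Finset.univ.erase i, ramp ((bary s).coord j x / ε)) *
          (ψ x * inner ℝ v (unitNormal s i) / s.height i))) := by
  have h1 : ∀ i, HasFDerivAt (fun x => ramp ((bary s).coord i x / ε))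
      ((deriv ramp ((bary s).coord i x / ε)) •
        (ε⁻¹ • (-((s.height i)⁻¹ • innerSL ℝ (unitNormal s i))))) x := by
    intro i
    have h2 := (hasFDerivAt_coord s i x).const_smul ε⁻¹
    have h3 : (fun x => (bary s).coord i x / ε) = fun x => ε⁻¹ • (bary s).coord i x := by
      funext x; rw [smul_eq_mul, div_eq_inv_mul]
    have h4 : HasFDerivAt (fun x => (bary s).coord i x / ε)
      (ε⁻¹ • (-((s.height i)⁻¹ • innerSL ℝ (unitNormal s i)))) x := by rw [h3]; exact h2
    exact (((contDiff_ramp.differentiable (by simp)) _).hasDerivAt).comp_hasFDerivAt x h4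
  have h5 := HasFDerivAt.finsetProd (u := Finset.univ) (x := x) fun i _ => h1 i
  have h6 := h5.mul ((hψ.differentiable (by simp) x).hasFDerivAt)
  have h7 : (fun x => cutoff s ε x * ψ x) =
    (fun x => ∏ i, ramp ((bary s).coord i x / ε)) * ψ := rfl
  rw [h7, h6.fderiv]
  simp only [add_apply, smul_apply,
    sum_apply, smul_eq_mul, neg_apply, innerSL_apply_apply, cutoff,
    Finset.mul_sum]
  rw [sub_eq_add_neg, ← Finset.sum_neg_distrib]
  congr 1
  refine Finset.sum_congr rfl fun i _ => ?_
  rw [real_inner_comm v]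
  ring

/-- **Divergence theorem** on a simplex for a continuous vector field `a` whose distributional
divergence in the interior is the integrable function `D`. Testing the definition of `D` with
`cutoff s ε * ψ` and letting `ε → 0`, the derivatives of the cutoff produce the boundary
integrals. -/
theorem divergence_theorem {a : E d → E d} {D : E d → ℝ}
    (ha : ContinuousOn a s.closedInterior) (hD : IntegrableOn D s.closedInterior)
    (hdiv : ∀ φ, IsTestFunction (interior s.closedInterior) φ →
      ∫ x in s.closedInterior, inner ℝ (a x) (gradient φ x) =
        -∫ x in s.closedInterior, D x * φ x)
    {ψ : E d → ℝ} (hψ : ContDiff ℝ ∞ ψ) :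
    ∫ x in s.closedInterior, (inner ℝ (a x) (gradient ψ x) + D x * ψ x) =
      ∑ i, ∫ x in (s.faceOpposite i).closedInterior,
        inner ℝ (a x) (unitNormal s i) * ψ x ∂μHE[d - 1] := by
  set K := s.closedInterior with hK
  have hKm : MeasurableSet K := s.isClosed_closedInterior.measurableSet
  have hKc : IsCompact K := s.isCompact_closedInterior
  have hψc : Continuous ψ := hψ.continuous
  have hdψ : ContinuousOn (fun x => inner ℝ (a x) (gradient ψ x)) K := by
    simp only [inner_gradient_eq]
    exact (hψ.continuous_fderiv (by simp)).continuousOn.clm_apply ha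
  have hint1 : IntegrableOn (fun x => inner ℝ (a x) (gradient ψ x)) K :=
    hdψ.integrableOn_compact hKc
  have hint2 : IntegrableOn (fun x => D x * ψ x) K :=
    hD.mul_continuousOn hψc.continuousOn hKc
  have hint : IntegrableOn (fun x => inner ℝ (a x) (gradient ψ x) + D x * ψ x) K :=
    hint1.add hint2
  have hcut1 : ∀ ε x, |cutoff s ε x| ≤ 1 := fun ε x => by
    rw [cutoff, abs_of_nonneg (Finset.prod_nonneg fun j _ => ramp_nonneg _)]
    exact Finset.prod_le_one (fun j _ => ramp_nonneg _) fun j _ => ramp_le_one _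
  have hcutc : ∀ ε, Continuous (cutoff s ε) := fun ε => (contDiff_cutoff s ε).continuous
  have hg : ∀ i, ContinuousOn (fun x => ψ x * inner ℝ (a x) (unitNormal s i) / s.height i) K :=
    fun i => (hψc.continuousOn.mul (ha.inner continuousOn_const)).div_const _
  have hL : Tendsto (fun ε => ∫ x in K, cutoff s ε x *
      (inner ℝ (a x) (gradient ψ x) + D x * ψ x)) (𝓝[>] 0)
      (𝓝 (∫ x in K, (inner ℝ (a x) (gradient ψ x) + D x * ψ x))) := by
    refine tendsto_integral_filter_of_dominated_convergence
      (fun x => ‖inner ℝ (a x) (gradient ψ x) + D x * ψ x‖) ?_ ?_ hint.norm ?_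
    · exact Eventually.of_forall fun ε =>
        (hcutc ε).aestronglyMeasurable.mul hint.aestronglyMeasurable
    · refine Eventually.of_forall fun ε => Eventually.of_forall fun x => ?_
      rw [norm_mul]
      exact mul_le_of_le_one_left (norm_nonneg _) (hcut1 ε x)
    · filter_upwards [ae_mem_interior s] with x hx
      rw [interior_closedInterior] at hx
      have h1 : Tendsto (fun ε => cutoff s ε x) (𝓝[>] 0) (𝓝 1) := by
        have h0 : (1 : ℝ) = ∏ j : Fin (d + 1), (1 : ℝ) := by simp
        rw [h0]
        refine tendsto_finsetProd _ fun j _ => ?_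
        have h2 : Tendsto (fun ε : ℝ => (bary s).coord j x * ε⁻¹) (𝓝[>] 0) atTop :=
          tendsto_inv_nhdsGT_zero.const_mul_atTop (hx j)
        refine tendsto_const_nhds.congr' ?_
        filter_upwards [h2.eventually_ge_atTop 2] with ε hε
        rw [div_eq_mul_inv, ramp_of_two_le hε]
      simpa using h1.mul_const (inner ℝ (a x) (gradient ψ x) + D x * ψ x)
  have hR : Tendsto (fun ε : ℝ => ∑ i, ∫ x in K, ε⁻¹ * (deriv ramp ((bary s).coord i x / ε) *
      ((∏ j ∈ Finset.univ.erase i, ramp ((bary s).coord j x / ε)) *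
        (ψ x * inner ℝ (a x) (unitNormal s i) / s.height i)))) (𝓝[>] 0)
      (𝓝 (∑ i, ∫ x in (s.faceOpposite i).closedInterior,
        inner ℝ (a x) (unitNormal s i) * ψ x ∂μHE[d - 1])) := by
    refine tendsto_finsetSum _ fun i _ => ?_
    have h := tendsto_boundaryLayer s (hg i) i
    rw [← integral_const_mul] at h
    have hx : ∀ x, s.height i * (ψ x * inner ℝ (a x) (unitNormal s i) / s.height i) =
        inner ℝ (a x) (unitNormal s i) * ψ x := fun x => by
      rw [mul_div_cancel₀ _ (s.height_pos i).ne', mul_comm]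
    simp only [hx] at h
    exact h
  refine tendsto_nhds_unique hL (hR.congr' ?_)
  filter_upwards [self_mem_nhdsWithin] with ε hε
  have hint3 : ∀ i, IntegrableOn (fun x => ε⁻¹ * (deriv ramp ((bary s).coord i x / ε) *
      ((∏ j ∈ Finset.univ.erase i, ramp ((bary s).coord j x / ε)) *
        (ψ x * inner ℝ (a x) (unitNormal s i) / s.height i)))) K := by
    intro i
    refine ContinuousOn.integrableOn_compact hKc ?_
    refine continuousOn_const.mul (ContinuousOn.mul ?_ (ContinuousOn.mul ?_ (hg i)))
    · exact (continuous_deriv_ramp.comp ((continuous_coord s i).div_const ε)).continuousOn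
    · exact (continuous_finsetProd _ fun j _ =>
        continuous_ramp.comp ((continuous_coord s j).div_const ε)).continuousOn
  have hint4 : IntegrableOn (fun x => cutoff s ε x * inner ℝ (a x) (gradient ψ x)) K :=
    ContinuousOn.integrableOn_compact hKc ((hcutc ε).continuousOn.mul hdψ)
  have hint5 : IntegrableOn (fun x => D x * (cutoff s ε x * ψ x)) K :=
    hD.mul_continuousOn ((hcutc ε).mul hψc).continuousOn hKc
  have h := hdiv _ (isTestFunction_cutoff_mul s hε hψ)
  have hpt : ∀ x, inner ℝ (a x) (gradient (fun x => cutoff s ε x * ψ x) x) =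
      cutoff s ε x * inner ℝ (a x) (gradient ψ x) -
      ∑ i, ε⁻¹ * (deriv ramp ((bary s).coord i x / ε) *
        ((∏ j ∈ Finset.univ.erase i, ramp ((bary s).coord j x / ε)) *
          (ψ x * inner ℝ (a x) (unitNormal s i) / s.height i))) := fun x => by
    rw [inner_gradient_eq, inner_gradient_eq, fderiv_cutoff_mul s hψ]
  simp only [hpt] at h
  rw [integral_sub hint4 (integrable_finsetSum _ fun i _ => hint3 i),
    integral_finsetSum _ fun i _ => hint3 i] at h
  have h8 : ∫ x in K, cutoff s ε x * (inner ℝ (a x) (gradient ψ x) + D x * ψ x) =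
      (∫ x in K, cutoff s ε x * inner ℝ (a x) (gradient ψ x)) +
        ∫ x in K, D x * (cutoff s ε x * ψ x) := by
    rw [← integral_add hint4 hint5]
    refine integral_congr_ae (Eventually.of_forall fun x => ?_)
    simp only; ring
  rw [h8]
  linarith

end Divergence


/-! ### Divergence-free fields and traces on a facet -/

section DivergenceApplications

variable {d : ℕ}

lemma gradient_eq_zero_of_notMem_tsupport {φ : E d → ℝ} {x : E d} (hx : x ∉ tsupport φ) :
    gradient φ x = 0 := by
  rw [gradient, fderiv_of_notMem_tsupport _ hx, map_zero]

variable [NeZero d] (s : Affine.Simplex ℝ (E d) d)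

lemma divergence_theorem_of_divergenceFree {Ω : Set (E d)} {a : E d → E d}
    (hK : interior s.closedInterior ⊆ Ω) (ha : ContinuousOn a s.closedInterior)
    (hdiv : DivergenceFree Ω a) {ψ : E d → ℝ} (hψ : ContDiff ℝ ∞ ψ) :
    ∫ x in s.closedInterior, inner ℝ (a x) (gradient ψ x) =
      ∑ i, ∫ x in (s.faceOpposite i).closedInterior,
        inner ℝ (a x) (unitNormal s i) * ψ x ∂μHE[d - 1] := by
  have h := divergence_theorem s (D := 0) ha integrableOn_zero (fun φ hφ => ?_) hψ
  · simpa using h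
  · have h0 := hdiv φ ⟨hφ.1, hφ.2.1, hφ.2.2.trans hK⟩
    rw [setIntegral_eq_integral_of_forall_compl_eq_zero] at h0 ⊢
    · simpa using h0
    · intro x hx
      rw [gradient_eq_zero_of_notMem_tsupport fun h => hx (interior_subset (hφ.2.2 h)),
        inner_zero_right]
    · intro x hx
      rw [gradient_eq_zero_of_notMem_tsupport fun h => hx (hK (hφ.2.2 h)), inner_zero_right]

/-- The radial field `x - p` has divergence `d`. -/
lemma integral_inner_sub_gradient (p : E d) {φ : E d → ℝ} (hφ : ContDiff ℝ ∞ φ)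
    (hc : HasCompactSupport φ) :
    ∫ x, inner ℝ (x - p) (gradient φ x) = -∫ x, (d : ℝ) * φ x := by
  let b := EuclideanSpace.basisFun (Fin d) ℝ
  have hdc : Continuous (fderiv ℝ φ) := hφ.continuous_fderiv (by simp)
  have hdcs : HasCompactSupport (fderiv ℝ φ) := hc.fderiv ℝ
  have hj : ∀ j, ∫ x : E d, (x - p) j * fderiv ℝ φ x (b j) = -∫ x, φ x := by
    intro j
    have hd : ∀ x : E d, HasFDerivAt (fun x : E d => (x - p) j)
        (EuclideanSpace.proj j : E d →L[ℝ] ℝ) x := fun x => by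
      have h := (EuclideanSpace.proj j : E d →L[ℝ] ℝ).hasFDerivAt (x := x)
      exact h.sub_const (p j)
    have hd' : ∀ x : E d, fderiv ℝ (fun x : E d => (x - p) j) x (b j) = 1 := fun x => by
      rw [(hd x).fderiv]; simp [b]
    have hcj : Continuous fun x : E d => (x - p) j := by fun_prop
    have h := integral_mul_fderiv_eq_neg_fderiv_mul_of_integrable (μ := (volume : Measure (E d)))
      (f := fun x : E d => (x - p) j) (g := φ) (v := b j) ?_ ?_ ?_ (fun x _ => (hd x).differentiableAt)
      fun x _ => hφ.differentiable (by simp) x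
    · rw [h]; simp only [hd', one_mul]
    · simp only [hd', one_mul]
      exact hφ.continuous.integrable_of_hasCompactSupport hc
    · exact (hcj.mul (hdc.clm_apply continuous_const)).integrable_of_hasCompactSupport
        (HasCompactSupport.mul_left
          (hdcs.comp_left (g := fun L : E d →L[ℝ] ℝ => L (b j)) (by simp)))
    · exact (hcj.mul hφ.continuous).integrable_of_hasCompactSupport hc.mul_left
  have hpt : ∀ x, inner ℝ (x - p) (gradient φ x) = ∑ j, (x - p) j * fderiv ℝ φ x (b j) := by
    intro x
    rw [inner_gradient_eq]
    conv_lhs => rw [← b.sum_repr (x - p)]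
    rw [map_sum]
    simp [b]
  simp only [hpt]
  rw [integral_finsetSum]
  · simp only [hj]
    rw [integral_const_mul]; simp
  · intro j _
    have hcj : Continuous fun x : E d => (x - p) j := by fun_prop
    exact (hcj.mul (hdc.clm_apply continuous_const)).integrable_of_hasCompactSupport
        (HasCompactSupport.mul_left
          (hdcs.comp_left (g := fun L : E d →L[ℝ] ℝ => L (b j)) (by simp)))

/-- The trace of a smooth function on one facet in terms of volume integrals: the divergence
theorem for the field `x - p`, `p` the opposite vertex, which is tangential to all other facets. -/
lemma height_mul_integral_facet (i : Fin (d + 1)) {ψ : E d → ℝ} (hψ : ContDiff ℝ ∞ ψ) :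
    s.height i * ∫ x in (s.faceOpposite i).closedInterior, ψ x ∂μHE[d - 1] =
      ∫ x in s.closedInterior, (inner ℝ (x - s.points i) (gradient ψ x) + d * ψ x) := by
  rw [divergence_theorem s (a := fun x => x - s.points i) (D := fun _ => (d : ℝ))
    (by fun_prop) (integrableOn_const s.isCompact_closedInterior.measure_lt_top.ne)
    (fun φ hφ => ?_) hψ]
  · rw [Finset.sum_eq_single i]
    · rw [← integral_const_mul]
      refine setIntegral_congr_fun (isCompact_faceOpposite s i).isClosed.measurableSet fun x hx => ?_
      have h := ((mem_faceOpposite_iff s i x).1 hx).1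
      have h1 := coord_add_eq s i (s.points i) (x - s.points i)
      rw [add_sub_cancel, h, coord_point, if_pos rfl] at h1
      have hH := (s.height_pos i).ne'
      have h2 : inner ℝ (x - s.points i) (unitNormal s i) = s.height i := by
        field_simp at h1; linarith
      simp only [h2]
    · intro j _ hj
      refine setIntegral_eq_zero_of_forall_eq_zero fun x hx => ?_
      rw [inner_sub_unitNormal_of_coord_eq_zero s ((mem_faceOpposite_iff s j x).1 hx).1
        (by rw [coord_point, if_neg hj]), zero_mul]
    · simp
  · rw [setIntegral_eq_integral_of_forall_compl_eq_zero,
      setIntegral_eq_integral_of_forall_compl_eq_zero]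
    · exact integral_inner_sub_gradient _ hφ.1 hφ.2.1
    · intro x hx
      rw [image_eq_zero_of_notMem_tsupport fun h => hx (interior_subset (hφ.2.2 h)), mul_zero]
    · intro x hx
      rw [gradient_eq_zero_of_notMem_tsupport fun h => hx (interior_subset (hφ.2.2 h)),
        inner_zero_right]

end DivergenceApplications


/-! ### Polynomial functions -/

section Polynomials

variable {d : ℕ} {k : ℕ}

/-- Evaluation of polynomials on Euclidean space. -/
def evalLin (d : ℕ) : MvPolynomial (Fin d) ℝ →ₗ[ℝ] (E d → ℝ) where
  toFun p x := MvPolynomial.eval (fun i => x i) p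
  map_add' p q := by funext x; simp
  map_smul' c p := by funext x; simp

/-- The space of polynomial functions of degree at most `k`. -/
def polySpace (d k : ℕ) : Submodule ℝ (E d → ℝ) :=
  (MvPolynomial.restrictTotalDegree (Fin d) ℝ k).map (evalLin d)

instance : FiniteDimensional ℝ (polySpace d k) := by
  unfold polySpace; infer_instance

lemma mem_polySpace {q : E d → ℝ} : q ∈ polySpace d k ↔ IsPoly k q := by
  simp only [polySpace, Submodule.mem_map, MvPolynomial.mem_restrictTotalDegree, IsPoly]
  refine exists_congr fun p => and_congr_right fun _ => ?_
  rw [eq_comm, funext_iff]; rfl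

lemma hasFDerivAt_eval (p : MvPolynomial (Fin d) ℝ) (x : E d) :
    HasFDerivAt (fun x : E d => MvPolynomial.eval (fun i => x i) p)
      (∑ i, MvPolynomial.eval (fun i => x i) (MvPolynomial.pderiv i p) •
        (EuclideanSpace.proj i : E d →L[ℝ] ℝ)) x := by
  induction p using MvPolynomial.induction_on with
  | C c => simpa using hasFDerivAt_const c x
  | add p q hp hq =>
    simp only [map_add, add_smul, Finset.sum_add_distrib]
    exact hp.add hq
  | mul_X p j hp =>
    have h := hp.mul ((EuclideanSpace.proj j : E d →L[ℝ] ℝ).hasFDerivAt (x := x))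
    have h1 : (fun x : E d => MvPolynomial.eval (fun i => x i) (p * MvPolynomial.X j)) =
        (fun x : E d => MvPolynomial.eval (fun i => x i) p) *
          (EuclideanSpace.proj j : E d →L[ℝ] ℝ) := by
      funext x; simp
    rw [h1]
    convert! h using 1
    ext v
    simp only [MvPolynomial.pderiv_mul, MvPolynomial.pderiv_X, map_add, map_mul,
      MvPolynomial.eval_X, sum_apply, smul_apply, add_apply, PiLp.proj_apply, smul_eq_mul,
      add_mul, Finset.sum_add_distrib, Finset.mul_sum]
    rw [add_comm]
    congr 1
    · rw [Finset.sum_eq_single j]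
      · simp
      · intro i _ hi; simp [hi.symm]
      · simp
    · exact Finset.sum_congr rfl fun i _ => by ring

lemma totalDegree_pderiv_le {p : MvPolynomial (Fin d) ℝ} (hp : p.totalDegree ≤ k) (i : Fin d) :
    (MvPolynomial.pderiv i p).totalDegree ≤ k := by
  refine Finset.sup_le fun m hm => ?_
  have h : m + Finsupp.single i 1 ∈ p.support := by
    rw [MvPolynomial.mem_support_iff] at hm ⊢
    intro h0
    apply hm
    rw [MvPolynomial.coeff_pderiv, h0]; simp
  have h2 := (MvPolynomial.le_totalDegree h).trans hp
  rw [Finsupp.sum_add_index'] at h2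
  · exact (Nat.le_add_right _ _).trans h2
  · simp
  · simp

lemma contDiff_of_isPoly {q : E d → ℝ} (hq : IsPoly k q) : ContDiff ℝ ∞ q := by
  obtain ⟨p, -, hp⟩ := hq
  have h : q = fun x : E d => MvPolynomial.eval (fun i => x i) p := funext hp
  rw [h]
  clear h hp
  induction p using MvPolynomial.induction_on with
  | C c => simpa using contDiff_const
  | add p q hp hq =>
    simp only [map_add]
    exact hp.add hq
  | mul_X p j hp =>
    simp only [map_mul, MvPolynomial.eval_X]
    exact hp.mul (by fun_prop)

lemma isPoly_inner_gradient {q : E d → ℝ} (hq : IsPoly k q) (v : E d) :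
    IsPoly k fun x => inner ℝ v (gradient q x) := by
  obtain ⟨p, hpk, hp⟩ := hq
  have h : q = fun x : E d => MvPolynomial.eval (fun i => x i) p := funext hp
  refine ⟨∑ i, v i • MvPolynomial.pderiv i p, MvPolynomial.totalDegree_finsetSum_le fun i _ =>
    (MvPolynomial.totalDegree_smul_le _ _).trans (totalDegree_pderiv_le hpk i), fun x => ?_⟩
  simp only [inner_gradient_eq, h, (hasFDerivAt_eval p x).fderiv]
  simp [mul_comm]

lemma isPoly_comp_dilation {q : E d → ℝ} (hq : IsPoly k q) (c : E d) (r : ℝ) :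
    IsPoly k fun y => q (c + r • y) := by
  obtain ⟨p, hpk, hp⟩ := hq
  let g : Fin d → MvPolynomial (Fin d) ℝ := fun i =>
    MvPolynomial.C (c i) + MvPolynomial.C r * MvPolynomial.X i
  have hg : ∀ i, (g i).totalDegree ≤ 1 := fun i => by
    refine (MvPolynomial.totalDegree_add _ _).trans (max_le (by simp) ?_)
    refine (MvPolynomial.totalDegree_mul _ _).trans ?_
    simp
  refine ⟨MvPolynomial.aeval g p, ?_, fun y => ?_⟩
  · rw [MvPolynomial.aeval_def, MvPolynomial.eval₂_eq']
    refine MvPolynomial.totalDegree_finsetSum_le fun m hm => ?_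
    refine (MvPolynomial.totalDegree_mul _ _).trans ?_
    rw [MvPolynomial.algebraMap_eq, MvPolynomial.totalDegree_C, zero_add]
    refine (MvPolynomial.totalDegree_finsetProd _ _).trans ?_
    have hmk := (MvPolynomial.le_totalDegree hm).trans hpk
    rw [Finsupp.sum_fintype _ _ (by simp)] at hmk
    refine le_trans (Finset.sum_le_sum fun i _ => ?_) hmk
    exact (MvPolynomial.totalDegree_pow _ _).trans
      ((Nat.mul_le_mul_left _ (hg i)).trans (by simp))
  · simp only [hp]
    rw [MvPolynomial.aeval_def, MvPolynomial.eval₂_eq', MvPolynomial.eval_eq', map_sum]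
    refine Finset.sum_congr rfl fun m _ => ?_
    simp [g]

lemma IsPoly.add_smul {q q' : E d → ℝ} (hq : IsPoly k q) (hq' : IsPoly k q') (c : ℝ) :
    IsPoly k (q + c • q') := by
  rw [← mem_polySpace] at *
  exact Submodule.add_mem _ hq (Submodule.smul_mem _ _ hq')

lemma isPoly_zero : IsPoly k (0 : E d → ℝ) := by
  rw [← mem_polySpace]; exact Submodule.zero_mem _

lemma IsPoly.const_mul {q : E d → ℝ} (hq : IsPoly k q) (c : ℝ) : IsPoly k fun x => c * q x := by
  rw [← mem_polySpace] at *
  exact Submodule.smul_mem _ c hq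

lemma eq_zero_of_isPoly {q : E d → ℝ} (hq : IsPoly k q)
    (h : ∀ᵐ x ∂(volume.restrict (Metric.closedBall (0 : E d) 1)), q x = 0) : q = 0 := by
  have hc := (contDiff_of_isPoly hq).continuous
  have h1 : Set.EqOn q 0 (Metric.ball (0 : E d) 1) := by
    refine Measure.eqOn_open_of_ae_eq (μ := volume) ?_ Metric.isOpen_ball hc.continuousOn
      continuousOn_const
    exact ae_restrict_of_ae_restrict_of_subset Metric.ball_subset_closedBall h
  obtain ⟨p, -, hp⟩ := hq
  have han : AnalyticOnNhd ℝ q Set.univ := by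
    have : q = fun x : E d => MvPolynomial.eval (fun i => x i) p := funext hp
    rw [this]
    intro x _
    have h2 := AnalyticAt.aeval_mvPolynomial (𝕜 := ℝ) (f := fun (x : E d) (i : Fin d) => x i)
      (fun i => (EuclideanSpace.proj i : E d →L[ℝ] ℝ).analyticAt x) p
    exact h2
  refine han.eq_of_eventuallyEq (z₀ := 0) (fun x _ => analyticAt_const) ?_
  filter_upwards [Metric.isOpen_ball.mem_nhds (Metric.mem_ball_self one_pos)] with x hx using h1 hx

end Polynomials


/-! ### Inverse and discrete trace inequalities -/

section InverseEstimates

variable {d : ℕ} {k : ℕ}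

/-- A linear map on a finite-dimensional space is bounded by any injective one. -/
lemma exists_norm_le_of_injective {V F₁ F₂ : Type*} [AddCommGroup V] [Module ℝ V]
    [FiniteDimensional ℝ V] [NormedAddCommGroup F₁] [NormedSpace ℝ F₁] [NormedAddCommGroup F₂]
    [NormedSpace ℝ F₂] (L₁ : V →ₗ[ℝ] F₁) (L₂ : V →ₗ[ℝ] F₂) (h : Function.Injective L₁) :
    ∃ C, 0 ≤ C ∧ ∀ v, ‖L₂ v‖ ≤ C * ‖L₁ v‖ := by
  let e := LinearEquiv.ofInjective L₁ h
  let T : L₁.range →L[ℝ] F₂ := LinearMap.toContinuousLinearMap (L₂ ∘ₗ e.symm.toLinearMap)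
  refine ⟨‖T‖, T.opNorm_nonneg, fun v => ?_⟩
  have h1 := T.le_opNorm (e v)
  have h2 : T (e v) = L₂ v := by simp [T]
  rw [h2] at h1
  exact h1

lemma norm_toLp_sq {α F : Type*} [MeasurableSpace α] {ν : Measure α} [NormedAddCommGroup F]
    {f : α → F} (hf : MemLp f 2 ν) : ‖hf.toLp f‖ ^ 2 = ∫ x, ‖f x‖ ^ 2 ∂ν := by
  rw [Lp.norm_toLp, hf.eLpNorm_eq_integral_rpow_norm (by simp) (by simp)]
  have h0 : 0 ≤ ∫ x, ‖f x‖ ^ 2 ∂ν := integral_nonneg fun x => by positivity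
  simp only [ENNReal.toReal_ofNat, Real.rpow_ofNat]
  rw [ENNReal.toReal_ofReal (by positivity), ← Real.rpow_natCast, ← Real.rpow_mul h0]
  norm_num

lemma continuous_gradient_of_isPoly {q : E d → ℝ} (hq : IsPoly k q) : Continuous (gradient q) := by
  unfold gradient
  exact (LinearIsometryEquiv.continuous _).comp
    ((contDiff_of_isPoly hq).continuous_fderiv (by simp))

lemma memLp_of_continuous_of_isCompact {X F : Type*} [TopologicalSpace X] [MeasurableSpace X]
    [OpensMeasurableSpace X] [TopologicalSpace.PseudoMetrizableSpace X] [NormedAddCommGroup F]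
    {ν : Measure X} {f : X → F} {K : Set X} (hK : IsCompact K)
    (hKm : MeasurableSet K) (hν : ν K < ⊤) (hf : ContinuousOn f K) :
    MemLp f 2 (ν.restrict K) := by
  obtain ⟨C, hC⟩ := hK.exists_bound_of_continuousOn hf
  have : IsFiniteMeasure (ν.restrict K) := ⟨by simpa using hν⟩
  exact MemLp.of_bound (hf.aestronglyMeasurable_of_isCompact hK hKm) C
    ((ae_restrict_iff' hKm).2 (Eventually.of_forall hC))

/-- Comparison of the gradient on a large ball with the function on the unit ball: norms on the
finite-dimensional space of polynomials are equivalent. -/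
lemma exists_gradient_bound_unit (d k : ℕ) (ρ : ℝ) : ∃ C, 0 ≤ C ∧ ∀ q : E d → ℝ, IsPoly k q →
    ∫ x in Metric.closedBall 0 ρ, ‖gradient q x‖ ^ 2 ≤
      C * ∫ x in Metric.closedBall 0 1, q x ^ 2 := by
  have hm1 : ∀ q : polySpace d k,
      MemLp (q : E d → ℝ) 2 (volume.restrict (Metric.closedBall (0 : E d) 1)) := fun q =>
    memLp_of_continuous_of_isCompact (isCompact_closedBall _ _)
      Metric.isClosed_closedBall.measurableSet (isCompact_closedBall _ _).measure_lt_top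
      (contDiff_of_isPoly (mem_polySpace.1 q.2)).continuous.continuousOn
  have hm2 : ∀ q : polySpace d k,
      MemLp (gradient (q : E d → ℝ)) 2 (volume.restrict (Metric.closedBall (0 : E d) ρ)) := fun q =>
    memLp_of_continuous_of_isCompact (isCompact_closedBall _ _)
      Metric.isClosed_closedBall.measurableSet (isCompact_closedBall _ _).measure_lt_top
      (continuous_gradient_of_isPoly (mem_polySpace.1 q.2)).continuousOn
  have hdiff : ∀ q : polySpace d k, Differentiable ℝ (q : E d → ℝ) := fun q =>
    (contDiff_of_isPoly (mem_polySpace.1 q.2)).differentiable (by simp)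
  let L₁ : polySpace d k →ₗ[ℝ] Lp ℝ 2 (volume.restrict (Metric.closedBall (0 : E d) 1)) :=
    { toFun := fun q => (hm1 q).toLp
      map_add' := fun q q' => MemLp.toLp_add (hm1 q) (hm1 q')
      map_smul' := fun c q => MemLp.toLp_const_smul c (hm1 q) }
  have hadd : ∀ q q' : polySpace d k, gradient ((q + q' : polySpace d k) : E d → ℝ) =
      gradient (q : E d → ℝ) + gradient (q' : E d → ℝ) := fun q q' => by
    funext x
    simp only [gradient, Submodule.coe_add, Pi.add_apply]
    rw [fderiv_add (hdiff q x) (hdiff q' x), map_add]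
  have hsmul : ∀ (c : ℝ) (q : polySpace d k), gradient ((c • q : polySpace d k) : E d → ℝ) =
      c • gradient (q : E d → ℝ) := fun c q => by
    funext x
    simp only [gradient, Submodule.coe_smul, Pi.smul_apply]
    rw [fderiv_const_smul (hdiff q x), map_smulₛₗ]
    simp
  let L₂ : polySpace d k →ₗ[ℝ] Lp (E d) 2 (volume.restrict (Metric.closedBall (0 : E d) ρ)) :=
    { toFun := fun q => (hm2 q).toLp
      map_add' := fun q q' => by
        rw [← MemLp.toLp_add (hm2 q) (hm2 q')]
        exact MemLp.toLp_congr _ _ (by rw [hadd])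
      map_smul' := fun c q => by
        rw [RingHom.id_apply, ← MemLp.toLp_const_smul c (hm2 q)]
        exact MemLp.toLp_congr _ _ (by rw [hsmul]) }
  have hinj : Function.Injective L₁ := by
    rw [injective_iff_map_eq_zero]
    intro q hq
    have h1 : (q : E d → ℝ) =ᵐ[volume.restrict (Metric.closedBall (0 : E d) 1)] 0 := by
      have h2 := (hm1 q).coeFn_toLp
      have h3 : (hm1 q).toLp = 0 := hq
      rw [h3] at h2
      exact h2.symm.trans (Lp.coeFn_zero _ _ _)
    exact Subtype.ext (eq_zero_of_isPoly (mem_polySpace.1 q.2) h1)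
  obtain ⟨C, hC0, hC⟩ := exists_norm_le_of_injective L₁ L₂ hinj
  refine ⟨C ^ 2, sq_nonneg C, fun q hq => ?_⟩
  have h := hC ⟨q, mem_polySpace.2 hq⟩
  have h1 : ‖L₂ ⟨q, mem_polySpace.2 hq⟩‖ ^ 2 = _ := norm_toLp_sq (hm2 ⟨q, mem_polySpace.2 hq⟩)
  have h2 : ‖L₁ ⟨q, mem_polySpace.2 hq⟩‖ ^ 2 = _ := norm_toLp_sq (hm1 ⟨q, mem_polySpace.2 hq⟩)
  simp only [Real.norm_eq_abs, sq_abs] at h1 h2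
  rw [← h1, ← h2, ← mul_pow]
  exact pow_le_pow_left₀ (norm_nonneg _) h 2

lemma setIntegral_closedBall_dilation (f : E d → ℝ) (c : E d) {r : ℝ} (hr : 0 < r) (ρ : ℝ) :
    ∫ x in Metric.closedBall c (ρ * r), f x =
      r ^ d * ∫ y in Metric.closedBall 0 ρ, f (c + r • y) := by
  rw [← integral_indicator Metric.isClosed_closedBall.measurableSet,
    ← integral_indicator Metric.isClosed_closedBall.measurableSet]
  set g := (Metric.closedBall c (ρ * r)).indicator f with hg
  have h1 : ∀ y, (Metric.closedBall 0 ρ).indicator (fun y => f (c + r • y)) y = g (c + r • y) := by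
    intro y
    have hiff : c + r • y ∈ Metric.closedBall c (ρ * r) ↔ y ∈ Metric.closedBall (0 : E d) ρ := by
      rw [Metric.mem_closedBall, dist_eq_norm, add_sub_cancel_left, norm_smul,
        Real.norm_of_nonneg hr.le, mem_closedBall_zero_iff, mul_comm, mul_le_mul_iff_left₀ hr]
    by_cases hy : y ∈ Metric.closedBall (0 : E d) ρ
    · rw [Set.indicator_of_mem hy, hg, Set.indicator_of_mem (hiff.2 hy)]
    · rw [Set.indicator_of_notMem hy, hg, Set.indicator_of_notMem (fun h => hy (hiff.1 h))]
  simp only [h1]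
  rw [Measure.integral_comp_smul volume (fun x => g (c + x)) r, integral_add_left_eq_self g c,
    finrank_euclideanSpace_fin, abs_of_pos (by positivity), smul_eq_mul, ← mul_assoc,
    mul_inv_cancel₀ (by positivity), one_mul]

lemma gradient_comp_dilation {q : E d → ℝ} (hq : IsPoly k q) (c : E d) (r : ℝ) (y : E d) :
    gradient (fun y => q (c + r • y)) y = r • gradient q (c + r • y) := by
  have h1 : HasFDerivAt (fun y : E d => c + r • y) (r • ContinuousLinearMap.id ℝ (E d)) y :=
    ((hasFDerivAt_id y).const_smul r).const_add c
  have h2 := (((contDiff_of_isPoly hq).differentiable (by simp) (c + r • y)).hasFDerivAt).comp y h1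
  have h3 : fderiv ℝ (fun y => q (c + r • y)) y = r • fderiv ℝ q (c + r • y) := by
    have := h2.fderiv
    rw [Function.comp_def] at this
    rw [this]; ext v; simp
  rw [gradient, h3, map_smulₛₗ]
  simp [gradient]

lemma mul_sq_integral_gradient_le {σ C : ℝ}
    (hC : ∀ q : E d → ℝ, IsPoly k q → ∫ x in Metric.closedBall 0 σ, ‖gradient q x‖ ^ 2 ≤
      C * ∫ x in Metric.closedBall 0 1, q x ^ 2) (hC0 : 0 ≤ C)
    {K : Set (E d)} (hK : IsCompact K) {c : E d} {r : ℝ} (hr : 0 < r)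
    (hb : Metric.closedBall c r ⊆ K) (hd : Metric.diam K ≤ σ * r)
    {q : E d → ℝ} (hq : IsPoly k q) :
    r ^ 2 * ∫ x in K, ‖gradient q x‖ ^ 2 ≤ C * ∫ x in K, q x ^ 2 := by
  have hsub : K ⊆ Metric.closedBall c (σ * r) := fun x hx =>
    (Metric.dist_le_diam_of_mem hK.isBounded hx (hb (Metric.mem_closedBall_self hr.le))).trans hd
  have hgc := continuous_gradient_of_isPoly hq
  have hqc := (contDiff_of_isPoly hq).continuous
  have h1 : ∫ x in K, ‖gradient q x‖ ^ 2 ≤ ∫ x in Metric.closedBall c (σ * r), ‖gradient q x‖ ^ 2 :=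
    setIntegral_mono_set ((by fun_prop : Continuous fun x => ‖gradient q x‖ ^ 2).continuousOn.integrableOn_compact
      (isCompact_closedBall _ _)) (Eventually.of_forall fun x => by positivity)
      (Eventually.of_forall hsub)
  have h2 : ∫ x in Metric.closedBall c (1 * r), q x ^ 2 ≤ ∫ x in K, q x ^ 2 := by
    rw [one_mul]
    exact setIntegral_mono_set ((hqc.pow 2).continuousOn.integrableOn_compact hK)
      (Eventually.of_forall fun x => by positivity) (Eventually.of_forall hb)
  have h3 := hC _ (isPoly_comp_dilation hq c r)
  simp only [gradient_comp_dilation hq, norm_smul, mul_pow, Real.norm_eq_abs, sq_abs] at h3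
  rw [integral_const_mul] at h3
  rw [setIntegral_closedBall_dilation _ _ hr] at h1 h2
  calc r ^ 2 * ∫ x in K, ‖gradient q x‖ ^ 2
      ≤ r ^ 2 * (r ^ d * ∫ y in Metric.closedBall 0 σ, ‖gradient q (c + r • y)‖ ^ 2) := by gcongr
    _ = r ^ d * (r ^ 2 * ∫ y in Metric.closedBall 0 σ, ‖gradient q (c + r • y)‖ ^ 2) := by ring
    _ ≤ r ^ d * (C * ∫ y in Metric.closedBall 0 1, q (c + r • y) ^ 2) := by gcongr
    _ = C * (r ^ d * ∫ y in Metric.closedBall 0 1, q (c + r • y) ^ 2) := by ring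
    _ ≤ _ := by gcongr

/-- Inverse and discrete trace inequalities on simplices of diameter `h` that contain a ball of
radius at least `h / σ`. -/
lemma exists_inverse_const (d k : ℕ) [NeZero d] (σ : ℝ) : ∃ C, 0 < C ∧
    ∀ (s : Affine.Simplex ℝ (E d) d) (c : E d) (r : ℝ), 0 < r →
      Metric.closedBall c r ⊆ s.closedInterior → Metric.diam s.closedInterior ≤ σ * r →
      ∀ q : E d → ℝ, IsPoly k q →
        Metric.diam s.closedInterior ^ 2 * ∫ x in s.closedInterior, ‖gradient q x‖ ^ 2 ≤
          C * ∫ x in s.closedInterior, q x ^ 2 ∧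
        ∀ i, Metric.diam s.closedInterior *
          ∫ x in (s.faceOpposite i).closedInterior, q x ^ 2 ∂μHE[d - 1] ≤
            C * ∫ x in s.closedInterior, q x ^ 2 := by
  obtain ⟨C, hC0, hC⟩ := exists_gradient_bound_unit d k σ
  refine ⟨σ ^ 2 * C + |σ| * (d + |σ| * (1 + C)) + 1, by positivity,
    fun s c r hr hb hd q hq => ?_⟩
  have hK := s.isCompact_closedInterior
  set K := s.closedInterior with hKdef
  set h := Metric.diam K with hh
  have h0 : 0 ≤ h := Metric.diam_nonneg
  have hσ : 0 ≤ σ := nonneg_of_mul_nonneg_left (h0.trans hd) hr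
  rw [abs_of_nonneg hσ]
  have hqc := (contDiff_of_isPoly hq).continuous
  have hgc := continuous_gradient_of_isPoly hq
  set I := ∫ x in K, q x ^ 2 with hI
  set J := ∫ x in K, ‖gradient q x‖ ^ 2 with hJ
  have hI0 : 0 ≤ I := integral_nonneg fun x => by positivity
  have hJ0 : 0 ≤ J := integral_nonneg fun x => by positivity
  have hinv : r ^ 2 * J ≤ C * I := mul_sq_integral_gradient_le hC hC0 hK hr hb hd hq
  constructor
  · calc h ^ 2 * J ≤ (σ * r) ^ 2 * J := by gcongr
      _ = σ ^ 2 * (r ^ 2 * J) := by ring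
      _ ≤ σ ^ 2 * (C * I) := by gcongr
      _ = σ ^ 2 * C * I := by ring
      _ ≤ _ := by
        refine mul_le_mul_of_nonneg_right ?_ hI0
        have : 0 ≤ σ * (d + σ * (1 + C)) := by positivity
        linarith
  · intro i
    set F := ∫ x in (s.faceOpposite i).closedInterior, q x ^ 2 ∂μHE[d - 1] with hF
    have hF0 : 0 ≤ F := integral_nonneg fun x => by positivity
    have hsm : ContDiff ℝ ∞ fun x => q x ^ 2 := (contDiff_of_isPoly hq).pow 2
    have htr := height_mul_integral_facet s i hsm
    have hrH := two_mul_radius_le_height s hr hb i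
    have hint1 : IntegrableOn (fun x => q x ^ 2) K := (hqc.pow 2).continuousOn.integrableOn_compact hK
    have hint2 : IntegrableOn (fun x => ‖gradient q x‖ ^ 2) K :=
      (hgc.norm.pow 2).continuousOn.integrableOn_compact hK
    have hgsq : ∀ x v, inner ℝ v (gradient (fun x => q x ^ 2) x) =
        2 * q x * inner ℝ v (gradient q x) := by
      intro x v
      have := ((contDiff_of_isPoly hq).differentiable (by simp) x).hasFDerivAt.pow 2
      rw [inner_gradient_eq, inner_gradient_eq, this.fderiv]
      simp
    have hpt : ∀ x ∈ K, inner ℝ (x - s.points i) (gradient (fun x => q x ^ 2) x) + d * q x ^ 2 ≤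
        (d + σ) * q x ^ 2 + σ * r ^ 2 * ‖gradient q x‖ ^ 2 := by
      intro x hx
      rw [hgsq]
      have h1 : |inner ℝ (x - s.points i) (gradient q x)| ≤ σ * r * ‖gradient q x‖ := by
        refine (abs_real_inner_le_norm _ _).trans ?_
        gcongr
        rw [← dist_eq_norm]
        exact (Metric.dist_le_diam_of_mem hK.isBounded hx (s.point_mem_closedInterior i)).trans hd
      have h2 : 2 * q x * inner ℝ (x - s.points i) (gradient q x) ≤
          2 * |q x| * (σ * r * ‖gradient q x‖) := by
        calc _ ≤ |2 * q x * inner ℝ (x - s.points i) (gradient q x)| := le_abs_self _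
          _ = 2 * |q x| * |inner ℝ (x - s.points i) (gradient q x)| := by
            rw [abs_mul, abs_mul, abs_two]
          _ ≤ _ := by gcongr
      have h3 : 0 ≤ σ * (|q x| - r * ‖gradient q x‖) ^ 2 := by positivity
      have h4 : |q x| ^ 2 = q x ^ 2 := sq_abs _
      nlinarith
    have hle : s.height i * F ≤ (d + σ) * I + σ * (r ^ 2 * J) := by
      rw [htr]
      calc _ ≤ ∫ x in K, ((d + σ) * q x ^ 2 + σ * r ^ 2 * ‖gradient q x‖ ^ 2) := by
            refine setIntegral_mono_on ?_ ((hint1.const_mul _).add (hint2.const_mul _))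
              hK.isClosed.measurableSet hpt
            simp only [hgsq]
            exact ContinuousOn.integrableOn_compact hK (Continuous.continuousOn (by fun_prop))
        _ = _ := by
            rw [integral_add (hint1.const_mul _) (hint2.const_mul _), integral_const_mul,
              integral_const_mul]
            ring
    have h5 : r * F ≤ (d + σ * (1 + C)) * I := by
      have h6 : r * F ≤ s.height i * F := by
        refine mul_le_mul_of_nonneg_right ?_ hF0
        linarith
      have h7 : σ * (r ^ 2 * J) ≤ σ * (C * I) := by gcongr
      linarith
    calc h * F ≤ σ * r * F := by gcongr
      _ = σ * (r * F) := by ring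
      _ ≤ σ * ((d + σ * (1 + C)) * I) := by gcongr
      _ = σ * (d + σ * (1 + C)) * I := by ring
      _ ≤ _ := by
        refine mul_le_mul_of_nonneg_right ?_ hI0
        have : 0 ≤ σ ^ 2 * C := by positivity
        linarith

end InverseEstimates


/-! ### Interior facets of a triangulation -/

namespace Triangulation

variable {d : ℕ} [NeZero d] {Ω : Set (E d)} (T : Triangulation Ω)

lemma isOpen_domain {Ω : Set (E d)} (T : Triangulation Ω) : IsOpen Ω := by
  rw [T.domain_eq]; exact isOpen_interior

lemma interior_cellSet_subset (K : Fin T.numCells) : interior (T.cellSet K) ⊆ Ω := by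
  conv_rhs => rw [T.domain_eq]
  exact interior_mono (Set.subset_iUnion (fun K => (T.cell K).closedInterior) K)

lemma cellSet_subset_closure (K : Fin T.numCells) : T.cellSet K ⊆ closure Ω :=
  (closedInterior_subset_closure_interior _).trans (closure_mono (T.interior_cellSet_subset K))

lemma normal_eq (K : Fin T.numCells) (i : Fin (d + 1)) :
    T.normal K i = unitNormal (T.cell K) i := rfl

/-- The vertices of the `i`-th facet of `K`. -/
def facetVertices (K : Fin T.numCells) (i : Fin (d + 1)) : Set (E d) := (T.cell K).points '' {i}ᶜ

lemma facet_eq_convexHull (K : Fin T.numCells) (i : Fin (d + 1)) :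
    T.facet K i = convexHull ℝ (T.facetVertices K i) := by
  rw [facet, ← Affine.Simplex.convexHull_eq_closedInterior,
    Affine.Simplex.range_faceOpposite_points, facetVertices]

/-- A barycentric coordinate of `K` vanishes on the intersection with another cell unless the
corresponding vertex is shared. -/
lemma points_mem_range_of_coord_ne_zero {K K' : Fin T.numCells} {y : E d} (hy : y ∈ T.cellSet K)
    (hy' : y ∈ T.cellSet K') {j : Fin (d + 1)} (hj : (bary (T.cell K)).coord j y ≠ 0) :
    (T.cell K).points j ∈ Set.range (T.cell K').points := by
  by_contra hn
  have h := T.conforming K K' ⟨hy, hy'⟩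
  have hc : Convex ℝ {x | (bary (T.cell K)).coord j x = 0} := by
    have h1 : {x | (bary (T.cell K)).coord j x = 0} =
        (bary (T.cell K)).coord j ⁻¹' {0} := rfl
    rw [h1]
    exact (convex_singleton 0).affine_preimage _
  refine hj (convexHull_min ?_ hc h)
  rintro _ ⟨⟨m, rfl⟩, hm⟩
  rw [Set.mem_ofPred_eq, coord_point, if_neg]
  rintro rfl
  exact hn hm

lemma eq_of_range_subset {K K' : Fin T.numCells}
    (h : ∀ j, (T.cell K).points j ∈ Set.range (T.cell K').points) : K = K' := by
  refine T.distinct ?_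
  have h1 : Set.range (T.cell K).points ⊆ Set.range (T.cell K').points := by
    rintro _ ⟨j, rfl⟩; exact h j
  refine Set.eq_of_subset_of_ncard_le h1 ?_ (Set.finite_range _)
  rw [Set.ncard_range_of_injective (T.cell K').independent.injective,
    Set.ncard_range_of_injective (T.cell K).independent.injective]

lemma eq_of_mem_interior {K K' : Fin T.numCells} {y : E d} (hy : y ∈ interior (T.cellSet K))
    (hy' : y ∈ T.cellSet K') : K = K' := by
  refine T.eq_of_range_subset fun j =>
    T.points_mem_range_of_coord_ne_zero (interior_subset hy) hy' (j := j) ?_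
  rw [cellSet, interior_closedInterior] at hy
  exact (hy j).ne'

/-- The facet has points in its relative interior. -/
lemma exists_coord_pos (s : Affine.Simplex ℝ (E d) d) (i : Fin (d + 1)) :
    ∃ z, (bary s).coord i z = 0 ∧ ∀ j, j ≠ i → 0 < (bary s).coord j z := by
  have hne : (interior s.closedInterior).Nonempty := by
    rw [← Affine.Simplex.convexHull_eq_closedInterior]
    exact ⟨_, (bary s).centroid_mem_interior_convexHull⟩
  obtain ⟨w, hw⟩ := hne
  rw [interior_closedInterior] at hw
  have hd : 0 < d := Nat.pos_of_ne_zero (NeZero.ne d)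
  obtain ⟨m, hm⟩ : ∃ m : Fin (d + 1), m ≠ i := by
    have : Nontrivial (Fin (d + 1)) := Fin.nontrivial_iff_two_le.2 (by omega)
    exact exists_ne i
  have hlt : (bary s).coord i w < 1 := by
    rw [← (bary s).sum_coord_apply_eq_one w]
    exact Finset.single_lt_sum hm (Finset.mem_univ i) (Finset.mem_univ m) (hw m)
      fun j _ _ => (hw j).le
  have h1 : 0 < 1 - (bary s).coord i w := by linarith
  -- the central projection of an interior point from the opposite vertex
  refine ⟨AffineMap.lineMap (s.points i) w (1 - (bary s).coord i w)⁻¹, ?_, fun j hj => ?_⟩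
  · rw [AffineMap.apply_lineMap, coord_point, if_pos rfl, AffineMap.lineMap_apply]
    simp only [vsub_eq_sub, smul_eq_mul, vadd_eq_add]
    field_simp
    ring
  · rw [AffineMap.apply_lineMap, coord_point, if_neg hj, AffineMap.lineMap_apply]
    simp only [vsub_eq_sub, smul_eq_mul, vadd_eq_add, sub_zero, add_zero]
    have := hw j
    positivity

/-- An affine function that vanishes at all vertices but one is a multiple of a barycentric
coordinate. -/
lemma affineMap_eq_mul_coord (s : Affine.Simplex ℝ (E d) d) (i : Fin (d + 1)) (f : E d →ᵃ[ℝ] ℝ)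
    (hf : ∀ j, j ≠ i → f (s.points j) = 0) (x : E d) :
    f x = f (s.points i) * (bary s).coord i x := by
  have h : f = f (s.points i) • (bary s).coord i := by
    refine AffineMap.ext_on (bary s).tot ?_
    rintro _ ⟨j, rfl⟩
    change f (s.points j) = f (s.points i) * (bary s).coord i (s.points j)
    rw [coord_point]
    by_cases hj : i = j
    · subst hj; simp
    · rw [hf j (Ne.symm hj), if_neg hj, mul_zero]
  conv_lhs => rw [h]
  simp

lemma coord_eq_mul_of_facetVertices_eq {K K' : Fin T.numCells} {i i' : Fin (d + 1)}
    (h : T.facetVertices K i = T.facetVertices K' i') :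
    ∃ c : ℝ, (∀ x, (bary (T.cell K')).coord i' x = c * (bary (T.cell K)).coord i x) ∧
      T.normal K' i' = (c * (T.cell K').height i' / (T.cell K).height i) • T.normal K i := by
  have hH := (T.cell K).height_pos i
  have hH' := (T.cell K').height_pos i'
  have hc := affineMap_eq_mul_coord (T.cell K) i ((bary (T.cell K')).coord i') fun j hj => by
    have h1 : (T.cell K).points j ∈ T.facetVertices K' i' := by
      rw [← h]; exact ⟨j, hj, rfl⟩
    obtain ⟨m, hm, hmj⟩ := h1
    rw [← hmj, coord_point, if_neg (fun h => hm h.symm)]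
  refine ⟨_, hc, ?_⟩
  set c := (bary (T.cell K')).coord i' ((T.cell K).points i) with hcdef
  refine ext_inner_left ℝ fun v => ?_
  have h1 := hc (0 + v)
  have h0 := hc 0
  rw [coord_add_eq, coord_add_eq, h0] at h1
  rw [inner_smul_right, normal_eq, normal_eq]
  have h2 : inner ℝ v (unitNormal (T.cell K') i') / (T.cell K').height i' =
      c * (inner ℝ v (unitNormal (T.cell K) i) / (T.cell K).height i) := by linarith
  rw [div_eq_iff hH'.ne'] at h2
  rw [h2]; ring

/-- A facet that is not part of the boundary belongs to a second cell, on its other side. -/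
lemma exists_neighbour {K : Fin T.numCells} {i : Fin (d + 1)} (hb : ¬ T.IsBoundary K i) :
    ∃ K' i', T.facetVertices K' i' = T.facetVertices K i ∧ T.normal K' i' = -T.normal K i := by
  set s := T.cell K with hs
  have hH := s.height_pos i
  obtain ⟨x, hxF, hxb⟩ := Set.not_subset.1 hb
  have hxK := (mem_faceOpposite_iff s i x).1 hxF
  have hxΩ : x ∈ Ω := by
    have h1 : x ∈ closure Ω := T.cellSet_subset_closure K (faceOpposite_subset s i hxF)
    rw [frontier, T.isOpen_domain.interior_eq] at hxb
    by_contra hx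
    exact hxb ⟨h1, hx⟩
  -- a point of the domain in the relative interior of the facet
  obtain ⟨y, hyΩ, hyi, hyj⟩ : ∃ y ∈ Ω, (bary s).coord i y = 0 ∧
      ∀ j, j ≠ i → 0 < (bary s).coord j y := by
    obtain ⟨z, hzi, hzj⟩ := exists_coord_pos s i
    have hlim : Tendsto (fun t : ℝ => AffineMap.lineMap (k := ℝ) x z t) (𝓝[>] 0) (𝓝 x) := by
      have h1 : Continuous fun t : ℝ => AffineMap.lineMap (k := ℝ) x z t :=
        AffineMap.lineMap_continuous
      have := h1.tendsto 0
      rw [AffineMap.lineMap_apply_zero] at this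
      exact this.mono_left nhdsWithin_le_nhds
    have hev := hlim.eventually (T.isOpen_domain.mem_nhds hxΩ)
    have hlt : ∀ᶠ t in 𝓝[>] (0 : ℝ), t < 1 :=
      nhdsWithin_le_nhds (Iio_mem_nhds one_pos)
    obtain ⟨t, ht1, ht2, ht0⟩ := (hev.and (hlt.and self_mem_nhdsWithin)).exists
    have ht0' : (0 : ℝ) < t := ht0
    refine ⟨_, ht1, ?_, fun j hj => ?_⟩
    · rw [AffineMap.apply_lineMap, hxK.1, hzi]; simp
    · rw [AffineMap.apply_lineMap, AffineMap.lineMap_apply]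
      simp only [vsub_eq_sub, smul_eq_mul, vadd_eq_add]
      have h1 := hxK.2 j
      have h2 := hzj j hj
      nlinarith
  have hyK : y ∈ T.cellSet K := by
    rw [cellSet, mem_closedInterior_iff]
    intro j
    by_cases hj : j = i
    · rw [hj, hyi]
    · exact (hyj j hj).le
  -- a cell that is met by points approaching `y` from outside `K`
  have hlim : Tendsto (fun τ : ℝ => y + τ • unitNormal s i) (𝓝[>] 0) (𝓝 y) := by
    have h1 : Continuous fun τ : ℝ => y + τ • unitNormal s i := by fun_prop
    have := h1.tendsto 0
    rw [zero_smul, add_zero] at this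
    exact this.mono_left nhdsWithin_le_nhds
  have hcov : ∀ᶠ τ in 𝓝[>] (0 : ℝ), ∃ K', y + τ • unitNormal s i ∈ T.cellSet K' := by
    filter_upwards [hlim.eventually (T.isOpen_domain.mem_nhds hyΩ)] with τ hτ
    rw [T.domain_eq] at hτ
    exact Set.mem_iUnion.1 (interior_subset hτ)
  obtain ⟨K', hfreq⟩ : ∃ K', ∃ᶠ τ in 𝓝[>] (0 : ℝ), y + τ • unitNormal s i ∈ T.cellSet K' := by
    by_contra hno
    push Not at hno
    have h2 : ∀ᶠ τ in 𝓝[>] (0 : ℝ), ∀ K', y + τ • unitNormal s i ∉ T.cellSet K' :=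
      eventually_all.2 fun K' => by simpa using hno K'
    obtain ⟨τ, ⟨K', h3⟩, h4⟩ := (hcov.and h2).exists
    exact h4 K' h3
  have hyK' : y ∈ T.cellSet K' :=
    (T.cell K').isClosed_closedInterior.mem_of_frequently_of_tendsto hfreq hlim
  have hne : K ≠ K' := by
    rintro rfl
    obtain ⟨τ, hτ, hτ0⟩ := (hfreq.and_eventually self_mem_nhdsWithin).exists
    have h1 := (mem_closedInterior_iff s _).1 hτ i
    rw [coord_add_eq, hyi, inner_smul_left, inner_unitNormal_self] at h1
    have h2 : 0 < τ / s.height i := div_pos hτ0 hH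
    simp at h1
    linarith
  have hsub : T.facetVertices K i ⊆ Set.range (T.cell K').points := by
    rintro _ ⟨j, hj, rfl⟩
    exact T.points_mem_range_of_coord_ne_zero hyK hyK' (hyj j hj).ne'
  have hcard : ∀ (K : Fin T.numCells) i, (T.facetVertices K i).ncard = d := fun K i => by
    rw [facetVertices, Set.ncard_image_of_injective _ (T.cell K).independent.injective,
      Set.ncard_compl]
    simp
  -- the remaining vertex of the second cell
  obtain ⟨i', hi'⟩ : ∃ i', (T.cell K').points i' ∉ T.facetVertices K i := by
    by_contra hno
    push Not at hno
    have h1 : Set.range (T.cell K').points ⊆ T.facetVertices K i := by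
      rintro _ ⟨j, rfl⟩; exact hno j
    have h2 := Set.ncard_le_ncard h1 ((Set.toFinite _).image _)
    rw [hcard, Set.ncard_range_of_injective (T.cell K').independent.injective] at h2
    simp at h2
  have hfv : T.facetVertices K i = T.facetVertices K' i' := by
    refine Set.eq_of_subset_of_ncard_le ?_ (by rw [hcard, hcard]) ((Set.toFinite _).image _)
    intro p hp
    obtain ⟨m, rfl⟩ := hsub hp
    refine ⟨m, ?_, rfl⟩
    rintro rfl
    exact hi' hp
  obtain ⟨c, hc, hn⟩ := T.coord_eq_mul_of_facetVertices_eq hfv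
  refine ⟨K', i', hfv.symm, ?_⟩
  have hH' := (T.cell K').height_pos i'
  have hc0 : c ≤ 0 := by
    obtain ⟨τ, hτ, hτ0⟩ := (hfreq.and_eventually self_mem_nhdsWithin).exists
    have h1 := (mem_closedInterior_iff _ _).1 hτ i'
    rw [hc, coord_add_eq, hyi, inner_smul_left, inner_unitNormal_self] at h1
    have h2 : 0 < τ / s.height i := div_pos hτ0 hH
    simp at h1
    nlinarith
  have h1 : |c * (T.cell K').height i' / s.height i| = 1 := by
    have h2 := congrArg norm hn
    rw [norm_smul, normal_eq, normal_eq, norm_unitNormal, norm_unitNormal, mul_one] at h2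
    exact h2.symm
  have h2 : c * (T.cell K').height i' / s.height i ≤ 0 :=
    div_nonpos_of_nonpos_of_nonneg (mul_nonpos_of_nonpos_of_nonneg hc0 hH'.le) hH.le
  rw [abs_of_nonpos h2] at h1
  have h3 : c * (T.cell K').height i' / s.height i = -1 := by linarith
  rw [hn, h3, neg_one_smul]

/-- At most one cell lies on a given side of a facet. -/
lemma eq_of_facetVertices_eq {K K' : Fin T.numCells} {i i' : Fin (d + 1)}
    (h : T.facetVertices K i = T.facetVertices K' i') (hn : T.normal K' i' = T.normal K i) :
    K = K' ∧ i = i' := by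
  set s := T.cell K with hs
  set s' := T.cell K' with hs'
  obtain ⟨c, hc, hnc⟩ := T.coord_eq_mul_of_facetVertices_eq h
  have hH := s.height_pos i
  have hH' := s'.height_pos i'
  have hc0 : 0 < c := by
    have h1 : inner ℝ (T.normal K' i') (T.normal K i) = 1 := by
      rw [hn]; exact inner_unitNormal_self s i
    rw [hnc, inner_smul_left, normal_eq, inner_unitNormal_self] at h1
    by_contra hle
    have h2 : c * s'.height i' / s.height i ≤ 0 :=
      div_nonpos_of_nonpos_of_nonneg (mul_nonpos_of_nonpos_of_nonneg (not_lt.1 hle) hH'.le) hH.le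
    simp only [conj_trivial, mul_one] at h1
    linarith
  obtain ⟨y, hyi, hyj⟩ := exists_coord_pos s i
  have hyi' : (bary s').coord i' y = 0 := by rw [hc, hyi, mul_zero]
  have hyj' : ∀ j, j ≠ i' → 0 < (bary s').coord j y := by
    intro l hl
    have hmem : s'.points l ∈ T.facetVertices K i := by rw [h]; exact ⟨l, hl, rfl⟩
    obtain ⟨m, hm, hml⟩ := hmem
    have h1 := (bary s).affineCombination_coord_eq_self y
    have h2 := congrArg ((bary s').coord l) h1
    rw [Finset.map_affineCombination _ _ _ ((bary s).sum_coord_apply_eq_one y),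
      Finset.affineCombination_eq_linear_combination _ _ _ ((bary s).sum_coord_apply_eq_one y)] at h2
    rw [← h2]
    simp only [Function.comp_apply, smul_eq_mul]
    refine Finset.sum_pos' (fun j _ => ?_) ⟨m, Finset.mem_univ m, ?_⟩
    · by_cases hj : j = i
      · rw [hj, hyi, zero_mul]
      · refine mul_nonneg (hyj j hj).le ?_
        have hmem : s.points j ∈ T.facetVertices K' i' := by rw [← h]; exact ⟨j, hj, rfl⟩
        obtain ⟨j', -, hj'⟩ := hmem
        rw [bary_apply, ← hj', coord_point]
        split_ifs <;> simp
    · rw [bary_apply, hml, coord_point, if_pos rfl, mul_one]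
      exact hyj m hm
  -- points slightly inside lie in both cells
  have hlim : Tendsto (fun τ : ℝ => y - τ • unitNormal s i) (𝓝[>] 0) (𝓝 y) := by
    have h1 : Continuous fun τ : ℝ => y - τ • unitNormal s i := by fun_prop
    have := h1.tendsto 0
    rw [zero_smul, sub_zero] at this
    exact this.mono_left nhdsWithin_le_nhds
  have hpos : ∀ᶠ τ in 𝓝[>] (0 : ℝ), 0 < (bary s).coord i (y - τ • unitNormal s i) := by
    filter_upwards [self_mem_nhdsWithin] with τ hτ
    rw [sub_eq_add_neg, coord_add_eq, hyi, inner_neg_left, inner_smul_left, inner_unitNormal_self]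
    have h2 : 0 < τ / s.height i := div_pos hτ hH
    simpa [neg_div] using h2
  have hin : ∀ᶠ τ in 𝓝[>] (0 : ℝ), ∀ j, 0 < (bary s).coord j (y - τ • unitNormal s i) :=
    eventually_all.2 fun j => by
      by_cases hj : j = i
      · rw [hj]; exact hpos
      · exact (((continuous_coord s j).tendsto y).comp hlim).eventually (lt_mem_nhds (hyj j hj))
  have hin' : ∀ᶠ τ in 𝓝[>] (0 : ℝ), ∀ j, 0 < (bary s').coord j (y - τ • unitNormal s i) :=
    eventually_all.2 fun j => by
      by_cases hj : j = i'
      · filter_upwards [hpos] with τ hτ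
        rw [hj, hc]; exact mul_pos hc0 hτ
      · exact (((continuous_coord s' j).tendsto y).comp hlim).eventually (lt_mem_nhds (hyj' j hj))
  obtain ⟨τ, h1, h2⟩ := (hin.and hin').exists
  have hK : K = K' := by
    refine T.eq_of_mem_interior (y := y - τ • unitNormal s i) ?_ ?_
    · rw [cellSet, interior_closedInterior]; exact h1
    · rw [cellSet, mem_closedInterior_iff]; exact fun j => (h2 j).le
  refine ⟨hK, ?_⟩
  by_contra hii
  have hmem : s.points i' ∈ T.facetVertices K i := ⟨i', fun h => hii h.symm, rfl⟩
  rw [h] at hmem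
  obtain ⟨m, hm, hm'⟩ := hmem
  rw [hs] at hm'
  subst hK
  exact hm ((T.cell K).independent.injective hm')

open Classical in
lemma sum_eq_sum_of_neg_pairing {ι : Type*} [Fintype ι] {Q : ι → Prop} {f : ι → ℝ}
    {g : {p // ¬ Q p} → {p // ¬ Q p}} (hinj : Function.Injective g)
    (hneg : ∀ p, f (g p) = -f p) : ∑ p, f p = ∑ p, if Q p then f p else 0 := by
  have hzero : ∑ p : {p // ¬ Q p}, f p = 0 := by
    have h1 : ∑ p, f (g p) = ∑ p : {p // ¬ Q p}, f p :=
      Function.Bijective.sum_comp (Finite.injective_iff_bijective.1 hinj)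
        fun p : {p // ¬ Q p} => f p
    simp only [hneg, Finset.sum_neg_distrib] at h1
    linarith
  rw [← Finset.sum_filter_add_sum_filter_not Finset.univ Q, ← Finset.sum_filter, add_eq_left,
    ← hzero]
  exact Finset.sum_subtype (p := fun p => ¬ Q p) _ (by simp) f

open Classical in
/-- Contributions of interior facets cancel: each is counted twice with opposite normals. -/
lemma sum_facet_eq_sum_boundary (a : E d → E d) (w : E d → ℝ) :
    ∑ K, ∑ i, ∫ x in T.facet K i, inner ℝ (a x) (T.normal K i) * w x ∂μHE[d - 1] =
      ∑ K, ∑ i, if T.IsBoundary K i then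
        ∫ x in T.facet K i, inner ℝ (a x) (T.normal K i) * w x ∂μHE[d - 1] else 0 := by
  let f : Fin T.numCells × Fin (d + 1) → ℝ := fun p =>
    ∫ x in T.facet p.1 p.2, inner ℝ (a x) (T.normal p.1 p.2) * w x ∂μHE[d - 1]
  have hg : ∀ p : {p : Fin T.numCells × Fin (d + 1) // ¬ T.IsBoundary p.1 p.2},
      ∃ q : {p : Fin T.numCells × Fin (d + 1) // ¬ T.IsBoundary p.1 p.2},
        T.facetVertices q.1.1 q.1.2 = T.facetVertices p.1.1 p.1.2 ∧
          T.normal q.1.1 q.1.2 = -T.normal p.1.1 p.1.2 := by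
    rintro ⟨⟨K, i⟩, hp⟩
    obtain ⟨K', i', h1, h2⟩ := T.exists_neighbour hp
    refine ⟨⟨(K', i'), ?_⟩, h1, h2⟩
    rw [IsBoundary, facet_eq_convexHull] at hp ⊢
    simp only at h1
    rwa [h1]
  choose g hg1 hg2 using hg
  have hinj : Function.Injective g := by
    intro p q hpq
    have e1 : T.facetVertices p.1.1 p.1.2 = T.facetVertices q.1.1 q.1.2 := by
      rw [← hg1 p, hpq, hg1 q]
    have e2 : -T.normal q.1.1 q.1.2 = -T.normal p.1.1 p.1.2 := by rw [← hg2 q, ← hpq, hg2 p]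
    have h1 := T.eq_of_facetVertices_eq e1 (neg_injective e2)
    exact Subtype.ext (Prod.ext h1.1 h1.2)
  have hneg : ∀ p, f (g p).1 = -f p.1 := by
    intro p
    simp only [f]
    rw [facet_eq_convexHull, facet_eq_convexHull, hg1, hg2, ← integral_neg]
    simp only [inner_neg_right, neg_mul]
  have h1 := sum_eq_sum_of_neg_pairing hinj hneg
  rw [Fintype.sum_prod_type, Fintype.sum_prod_type] at h1
  exact h1

end Triangulation


/-! ### Weighted `L²` products -/

section WeightedProduct

variable {X : Type*} [MeasurableSpace X] {ν : Measure X}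

/-- The `L²` product of `f` and `g` with weight `c`. -/
def wprod (ν : Measure X) (c f g : X → ℝ) : ℝ := ∫ x, c x * f x * g x ∂ν

/-- Measurable weights bounded by `1`. -/
structure IsWeight (ν : Measure X) (c : X → ℝ) : Prop where
  aesm : AEStronglyMeasurable c ν
  bound : ∀ᵐ x ∂ν, |c x| ≤ 1

lemma isWeight_one : IsWeight ν fun _ => 1 :=
  ⟨aestronglyMeasurable_const, Eventually.of_forall fun _ => by simp⟩

variable {c c' f f' g : X → ℝ}

lemma IsWeight.memLp (hc : IsWeight ν c) (hf : MemLp f 2 ν) : MemLp (fun x => c x * f x) 2 ν := by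
  refine hf.of_le (hc.aesm.mul hf.1) ?_
  filter_upwards [hc.bound] with x hx
  rw [norm_mul]
  exact mul_le_of_le_one_left (norm_nonneg _) hx

lemma IsWeight.integrable (hc : IsWeight ν c) (hf : MemLp f 2 ν) (hg : MemLp g 2 ν) :
    Integrable (fun x => c x * f x * g x) ν :=
  (hc.memLp hf).integrable_mul hg

lemma wprod_comm (c f g : X → ℝ) : wprod ν c f g = wprod ν c g f := by
  unfold wprod; congr 1; funext x; ring

lemma wprod_add_smul_left (hc : IsWeight ν c) (hf : MemLp f 2 ν) (hf' : MemLp f' 2 ν)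
    (hg : MemLp g 2 ν) (t : ℝ) :
    wprod ν c (f + t • f') g = wprod ν c f g + t * wprod ν c f' g := by
  unfold wprod
  rw [← integral_const_mul, ← integral_add (hc.integrable hf hg)
    ((hc.integrable hf' hg).const_mul t)]
  congr 1; funext x
  simp only [Pi.add_apply, Pi.smul_apply, smul_eq_mul]; ring

lemma wprod_add_smul_right (hc : IsWeight ν c) (hf : MemLp f 2 ν) (hf' : MemLp f' 2 ν)
    (hg : MemLp g 2 ν) (t : ℝ) :
    wprod ν c g (f + t • f') = wprod ν c g f + t * wprod ν c g f' := by
  rw [wprod_comm, wprod_add_smul_left hc hf hf' hg, wprod_comm c f g, wprod_comm c f' g]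

lemma wprod_sub_right (hc : IsWeight ν c) (hf : MemLp f 2 ν) (hf' : MemLp f' 2 ν)
    (hg : MemLp g 2 ν) : wprod ν c g (f - f') = wprod ν c g f - wprod ν c g f' := by
  have h := wprod_add_smul_right hc hf hf' hg (-1)
  rw [neg_one_smul, ← sub_eq_add_neg] at h
  linarith

lemma wprod_sub_left (hc : IsWeight ν c) (hf : MemLp f 2 ν) (hf' : MemLp f' 2 ν)
    (hg : MemLp g 2 ν) : wprod ν c (f - f') g = wprod ν c f g - wprod ν c f' g := by
  rw [wprod_comm, wprod_sub_right hc hf hf' hg, wprod_comm c g f, wprod_comm c g f']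

lemma wprod_zero_right (c f : X → ℝ) : wprod ν c f 0 = 0 := by simp [wprod]

lemma wprod_add_weight (hc : IsWeight ν c) (hc' : IsWeight ν c') (hf : MemLp f 2 ν)
    (hg : MemLp g 2 ν) :
    wprod ν (fun x => c x + c' x) f g = wprod ν c f g + wprod ν c' f g := by
  unfold wprod
  rw [← integral_add (hc.integrable hf hg) (hc'.integrable hf hg)]
  congr 1; funext x; ring

lemma wprod_sub_weight (hc : IsWeight ν c) (hc' : IsWeight ν c') (hf : MemLp f 2 ν)
    (hg : MemLp g 2 ν) :
    wprod ν (fun x => c x - c' x) f g = wprod ν c f g - wprod ν c' f g := by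
  unfold wprod
  rw [← integral_sub (hc.integrable hf hg) (hc'.integrable hf hg)]
  congr 1; funext x; ring

lemma wprod_self_nonneg (h0 : ∀ x, 0 ≤ c x) (f : X → ℝ) : 0 ≤ wprod ν c f f :=
  integral_nonneg fun x => by
    rw [Pi.zero_apply, mul_assoc]; exact mul_nonneg (h0 x) (mul_self_nonneg _)

/-- The Cauchy-Schwarz inequality for quadratic forms with values on a line. -/
lemma abs_le_sqrt_mul_sqrt {A B C : ℝ} (h : ∀ t : ℝ, 0 ≤ A + 2 * t * B + t ^ 2 * C) (hA : 0 ≤ A) :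
    |B| ≤ √A * √C := by
  have h1 := discrim_le_zero (a := C) (b := 2 * B) (c := A) fun t => by linarith [h t]
  rw [discrim] at h1
  rw [← Real.sqrt_mul hA]
  exact Real.abs_le_sqrt (by nlinarith)

lemma abs_wprod_le (hc : IsWeight ν c) (h0 : ∀ x, 0 ≤ c x) (hf : MemLp f 2 ν) (hg : MemLp g 2 ν) :
    |wprod ν c f g| ≤ √(wprod ν c f f) * √(wprod ν c g g) := by
  refine abs_le_sqrt_mul_sqrt (fun t => ?_) (wprod_self_nonneg h0 f)
  have h := wprod_self_nonneg (ν := ν) h0 (f + t • g)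
  rw [wprod_add_smul_left hc hf hg (hf.add (hg.const_smul t)), wprod_add_smul_right hc hf hg hf,
    wprod_add_smul_right hc hf hg hg, wprod_comm c g f] at h
  linarith

/-- Cauchy-Schwarz with a free positive parameter, as it is used for the weights `h_K`. -/
lemma abs_wprod_le_of_pos (hc : IsWeight ν c) (h0 : ∀ x, 0 ≤ c x) (hf : MemLp f 2 ν)
    (hg : MemLp g 2 ν) {α : ℝ} (hα : 0 < α) :
    |wprod ν c f g| ≤ √(α⁻¹ * wprod ν c f f) * √(α * wprod ν c g g) := by
  refine (abs_wprod_le hc h0 hf hg).trans_eq ?_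
  rw [Real.sqrt_mul (by positivity), Real.sqrt_mul hα.le, Real.sqrt_inv]
  have := (Real.sqrt_pos.2 hα).ne'
  field_simp

/-- Young's inequality. -/
lemma abs_wprod_le_add (hc : IsWeight ν c) (h0 : ∀ x, 0 ≤ c x) (hf : MemLp f 2 ν)
    (hg : MemLp g 2 ν) {α : ℝ} (hα : 0 < α) :
    |wprod ν c f g| ≤ α⁻¹ / 2 * wprod ν c f f + α / 2 * wprod ν c g g := by
  refine (abs_wprod_le_of_pos hc h0 hf hg hα).trans ?_
  have h1 : 0 ≤ α⁻¹ * wprod ν c f f := mul_nonneg (by positivity) (wprod_self_nonneg h0 f)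
  have h2 : 0 ≤ α * wprod ν c g g := mul_nonneg (by positivity) (wprod_self_nonneg h0 g)
  have h3 := two_mul_le_add_sq (√(α⁻¹ * wprod ν c f f)) (√(α * wprod ν c g g))
  rw [Real.sq_sqrt h1, Real.sq_sqrt h2] at h3
  linarith

lemma wprod_self_mono (hc : IsWeight ν c) (hc' : IsWeight ν c') (h : ∀ᵐ x ∂ν, c x ≤ c' x)
    (hf : MemLp f 2 ν) : wprod ν c f f ≤ wprod ν c' f f := by
  refine integral_mono_ae (hc.integrable hf hf) (hc'.integrable hf hf) ?_
  filter_upwards [h] with x hx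
  rw [mul_assoc, mul_assoc]
  exact mul_le_mul_of_nonneg_right hx (mul_self_nonneg _)

lemma abs_sum_le_mul {ι : Type*} [Fintype ι] {x A B : ι → ℝ} {N M : ℝ} (hA : ∀ j, 0 ≤ A j)
    (hB : ∀ j, 0 ≤ B j) (hN : 0 ≤ N) (hM : 0 ≤ M) (hx : ∀ j, |x j| ≤ √(A j) * √(B j))
    (hAN : ∑ j, A j ≤ N ^ 2) (hBM : ∑ j, B j ≤ M ^ 2) : |∑ j, x j| ≤ N * M := by
  calc |∑ j, x j| ≤ ∑ j, |x j| := Finset.abs_sum_le_sum_abs _ _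
    _ ≤ ∑ j, √(A j) * √(B j) := Finset.sum_le_sum fun j _ => hx j
    _ ≤ √(∑ j, A j) * √(∑ j, B j) := Real.sum_sqrt_mul_sqrt_le _ hA hB
    _ ≤ √(N ^ 2) * √(M ^ 2) := by gcongr
    _ = N * M := by rw [Real.sqrt_sq hN, Real.sqrt_sq hM]

lemma abs_sum_sum_le_mul {ι κ : Type*} [Fintype ι] [Fintype κ] {x A B : ι → κ → ℝ} {N M : ℝ}
    (hA : ∀ j i, 0 ≤ A j i) (hB : ∀ j i, 0 ≤ B j i) (hN : 0 ≤ N) (hM : 0 ≤ M)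
    (hx : ∀ j i, |x j i| ≤ √(A j i) * √(B j i)) (hAN : ∑ j, ∑ i, A j i ≤ N ^ 2)
    (hBM : ∑ j, ∑ i, B j i ≤ M ^ 2) : |∑ j, ∑ i, x j i| ≤ N * M := by
  rw [← Fintype.sum_prod_type'] at hAN hBM ⊢
  exact abs_sum_le_mul (fun q => hA q.1 q.2) (fun q => hB q.1 q.2) hN hM
    (fun q => hx q.1 q.2) hAN hBM

end WeightedProduct

namespace Triangulation

variable {d : ℕ} [NeZero d] {Ω : Set (E d)} (T : Triangulation Ω)

/-- Lebesgue measure on a cell. -/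
def cellMeas (K : Fin T.numCells) : Measure (E d) := volume.restrict (T.cellSet K)

/-- Surface measure on a facet. -/
def facetMeas (K : Fin T.numCells) (i : Fin (d + 1)) : Measure (E d) :=
  (μHE[d - 1] : Measure (E d)).restrict (T.facet K i)

/-- The normal component of `a` on a facet. -/
def bn (a : E d → E d) (K : Fin T.numCells) (i : Fin (d + 1)) (x : E d) : ℝ :=
  inner ℝ (a x) (T.normal K i)

/-- The positive part of the normal component. -/
def bpos (a : E d → E d) (K : Fin T.numCells) (i : Fin (d + 1)) (x : E d) : ℝ :=
  max (T.bn a K i x) 0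

/-- The negative part of the normal component. -/
def bneg (a : E d → E d) (K : Fin T.numCells) (i : Fin (d + 1)) (x : E d) : ℝ :=
  max (-T.bn a K i x) 0

lemma bn_eq (a : E d → E d) (K : Fin T.numCells) (i : Fin (d + 1)) :
    T.bn a K i = fun x => T.bpos a K i x - T.bneg a K i x := by
  funext x; simp only [bpos, bneg]
  rcases le_total (T.bn a K i x) 0 with h | h
  · rw [max_eq_right h, max_eq_left (by linarith)]; ring
  · rw [max_eq_left h, max_eq_right (by linarith)]; ring

lemma abs_bn_eq (a : E d → E d) (K : Fin T.numCells) (i : Fin (d + 1)) :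
    (fun x => |T.bn a K i x|) = fun x => T.bpos a K i x + T.bneg a K i x := by
  funext x; simp only [bpos, bneg]
  rcases le_total (T.bn a K i x) 0 with h | h
  · rw [max_eq_right h, max_eq_left (by linarith), abs_of_nonpos h]; ring
  · rw [max_eq_left h, max_eq_right (by linarith), abs_of_nonneg h]; ring

lemma bpos_nonneg (a : E d → E d) (K : Fin T.numCells) (i : Fin (d + 1)) (x : E d) :
    0 ≤ T.bpos a K i x := le_max_right _ _

lemma bneg_nonneg (a : E d → E d) (K : Fin T.numCells) (i : Fin (d + 1)) (x : E d) :
    0 ≤ T.bneg a K i x := le_max_right _ _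

lemma facet_subset_closure (K : Fin T.numCells) (i : Fin (d + 1)) : T.facet K i ⊆ closure Ω :=
  (faceOpposite_subset _ i).trans (T.cellSet_subset_closure K)

lemma isCompact_facet (K : Fin T.numCells) (i : Fin (d + 1)) : IsCompact (T.facet K i) :=
  isCompact_faceOpposite _ _

lemma isCompact_cellSet (K : Fin T.numCells) : IsCompact (T.cellSet K) :=
  (T.cell K).isCompact_closedInterior

lemma measurableSet_facet (K : Fin T.numCells) (i : Fin (d + 1)) : MeasurableSet (T.facet K i) :=
  (T.isCompact_facet K i).isClosed.measurableSet

lemma measurableSet_cellSet (K : Fin T.numCells) : MeasurableSet (T.cellSet K) :=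
  (T.isCompact_cellSet K).isClosed.measurableSet

section Field

variable {a : E d → E d}

lemma continuousOn_bn (ha : ContinuousOn a (closure Ω)) (K : Fin T.numCells) (i : Fin (d + 1)) :
    ContinuousOn (T.bn a K i) (T.facet K i) :=
  (ha.mono (T.facet_subset_closure K i)).inner continuousOn_const

lemma abs_bn_le (hb : ∀ x ∈ closure Ω, ‖a x‖ ≤ 1) (K : Fin T.numCells) (i : Fin (d + 1)) {x : E d}
    (hx : x ∈ T.facet K i) : |T.bn a K i x| ≤ 1 := by
  refine (abs_real_inner_le_norm _ _).trans ?_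
  rw [normal_eq, norm_unitNormal, mul_one]
  exact hb x (T.facet_subset_closure K i hx)

lemma isWeight_comp_bn (ha : ContinuousOn a (closure Ω)) (hb : ∀ x ∈ closure Ω, ‖a x‖ ≤ 1)
    (K : Fin T.numCells) (i : Fin (d + 1)) {φ : ℝ → ℝ} (hφ : Continuous φ)
    (h : ∀ t, |φ t| ≤ |t|) : IsWeight (T.facetMeas K i) fun x => φ (T.bn a K i x) := by
  refine ⟨(hφ.comp_continuousOn (T.continuousOn_bn ha K i)).aestronglyMeasurable_of_isCompact
    (T.isCompact_facet K i) (T.measurableSet_facet K i), ?_⟩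
  refine (ae_restrict_iff' (T.measurableSet_facet K i)).2 (Eventually.of_forall fun x hx => ?_)
  exact (h _).trans (T.abs_bn_le hb K i hx)

variable (ha : ContinuousOn a (closure Ω)) (hb : ∀ x ∈ closure Ω, ‖a x‖ ≤ 1)

include ha hb

lemma isWeight_bn (K : Fin T.numCells) (i : Fin (d + 1)) :
    IsWeight (T.facetMeas K i) (T.bn a K i) :=
  T.isWeight_comp_bn ha hb K i (φ := id) continuous_id fun _ => le_rfl

lemma isWeight_abs_bn (K : Fin T.numCells) (i : Fin (d + 1)) :
    IsWeight (T.facetMeas K i) fun x => |T.bn a K i x| :=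
  T.isWeight_comp_bn ha hb K i (φ := fun t => |t|) continuous_abs fun t => (abs_abs t).le

lemma isWeight_bpos (K : Fin T.numCells) (i : Fin (d + 1)) :
    IsWeight (T.facetMeas K i) (T.bpos a K i) :=
  T.isWeight_comp_bn ha hb K i (φ := fun t => max t 0) (by fun_prop) fun t => by
    rcases le_total t 0 with h | h
    · simp [max_eq_right h]
    · simp [max_eq_left h]

lemma isWeight_bneg (K : Fin T.numCells) (i : Fin (d + 1)) :
    IsWeight (T.facetMeas K i) (T.bneg a K i) :=
  T.isWeight_comp_bn ha hb K i (φ := fun t => max (-t) 0) (by fun_prop) fun t => by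
    rcases le_total t 0 with h | h
    · rw [max_eq_left (by linarith), abs_neg]
    · rw [max_eq_right (by linarith)]; simp

omit hb in
lemma measurableSet_outflow (K : Fin T.numCells) (i : Fin (d + 1)) :
    MeasurableSet (T.outflow a K i) :=
  ((T.continuousOn_bn ha K i).preimage_isClosed_of_isClosed (T.isCompact_facet K i).isClosed
    isClosed_Ici).measurableSet

omit hb in
lemma measurableSet_inflow (K : Fin T.numCells) (i : Fin (d + 1)) :
    MeasurableSet (T.inflow a K i) := by
  have h : T.inflow a K i = T.facet K i \ T.outflow a K i := by
    ext x
    simp only [inflow, outflow, Set.mem_ofPred_eq, Set.mem_sdiff, not_and, not_le]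
    exact ⟨fun h => ⟨h.1, fun _ => h.2⟩, fun h => ⟨h.1, h.2 h.1⟩⟩
  rw [h]
  exact (T.measurableSet_facet K i).diff (T.measurableSet_outflow ha K i)

omit hb in
lemma setIntegral_outflow {φ ψ : E d → ℝ} (K : Fin T.numCells) (i : Fin (d + 1))
    (h1 : ∀ x, 0 ≤ T.bn a K i x → φ x = ψ x) (h2 : ∀ x, T.bn a K i x ≤ 0 → ψ x = 0) :
    ∫ x in T.outflow a K i, φ x ∂μHE[d - 1] = ∫ x, ψ x ∂(T.facetMeas K i) := by
  rw [facetMeas, ← integral_indicator (T.measurableSet_outflow ha K i),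
    ← integral_indicator (T.measurableSet_facet K i)]
  congr 1; funext x
  by_cases hx : x ∈ T.outflow a K i
  · rw [Set.indicator_of_mem hx, Set.indicator_of_mem hx.1, h1 x hx.2]
  · rw [Set.indicator_of_notMem hx]
    by_cases hF : x ∈ T.facet K i
    · rw [Set.indicator_of_mem hF, h2 x (not_le.1 fun h => hx ⟨hF, h⟩).le]
    · rw [Set.indicator_of_notMem hF]

omit hb in
lemma setIntegral_inflow {φ ψ : E d → ℝ} (K : Fin T.numCells) (i : Fin (d + 1))
    (h1 : ∀ x, T.bn a K i x < 0 → φ x = ψ x) (h2 : ∀ x, 0 ≤ T.bn a K i x → ψ x = 0) :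
    ∫ x in T.inflow a K i, φ x ∂μHE[d - 1] = ∫ x, ψ x ∂(T.facetMeas K i) := by
  rw [facetMeas, ← integral_indicator (T.measurableSet_inflow ha K i),
    ← integral_indicator (T.measurableSet_facet K i)]
  congr 1; funext x
  by_cases hx : x ∈ T.inflow a K i
  · rw [Set.indicator_of_mem hx, Set.indicator_of_mem hx.1, h1 x hx.2]
  · rw [Set.indicator_of_notMem hx]
    by_cases hF : x ∈ T.facet K i
    · rw [Set.indicator_of_mem hF, h2 x (not_lt.1 fun h => hx ⟨hF, h⟩)]
    · rw [Set.indicator_of_notMem hF]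

end Field

end Triangulation


/-! ### The bilinear form and the norms as weighted products -/

/-- The linear combination `v + t w` of pairs. -/
def comb {m d : ℕ} (v : Pair m d) (t : ℝ) (w : Pair m d) : Pair m d :=
  (⟨fun K => v.1.val K + t • w.1.val K, fun K => v.1.grad K + t • w.1.grad K,
    fun K => v.1.tr K + t • w.1.tr K⟩, v.2 + t • w.2)

lemma sub_eq_comb {m d : ℕ} (v w : Pair m d) : v - w = comb v (-1) w := by
  have h : v - w = (⟨v.1.val - w.1.val, v.1.grad - w.1.grad, v.1.tr - w.1.tr⟩, v.2 - w.2) := rfl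
  rw [h, comb]
  simp only [neg_one_smul, ← sub_eq_add_neg]
  rfl

/-- The advective derivative `a · ∇v` on the cell `K`. -/
def adv {m d : ℕ} (a : E d → E d) (v : Pair m d) (K : Fin m) (x : E d) : ℝ :=
  inner ℝ (a x) (v.1.grad K x)

/-- The difference of the facet function and the trace from the cell `K`. -/
def jump {m d : ℕ} (v : Pair m d) (K : Fin m) : E d → ℝ := v.2 - v.1.tr K

lemma adv_comb {m d : ℕ} (a : E d → E d) (v : Pair m d) (t : ℝ) (w : Pair m d) (K : Fin m) :
    adv a (comb v t w) K = adv a v K + t • adv a w K := by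
  funext x
  simp [adv, comb, inner_add_right, inner_smul_right]

lemma jump_comb {m d : ℕ} (v : Pair m d) (t : ℝ) (w : Pair m d) (K : Fin m) :
    jump (comb v t w) K = jump v K + t • jump w K := by
  funext x
  simp only [jump, comb, Pi.sub_apply, Pi.add_apply, Pi.smul_apply, smul_eq_mul]
  ring

namespace Triangulation

variable {d : ℕ} [NeZero d] {Ω : Set (E d)} (T : Triangulation Ω)

/-- All functions that enter the bilinear form are square integrable. -/
structure IsL2Pair (a : E d → E d) (v : Pair T.numCells d) : Prop where
  val : ∀ K, MemLp (v.1.val K) 2 (T.cellMeas K)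
  adv : ∀ K, MemLp (adv a v K) 2 (T.cellMeas K)
  tr : ∀ K i, MemLp (v.1.tr K) 2 (T.facetMeas K i)
  bar : ∀ K i, MemLp v.2 2 (T.facetMeas K i)

variable {T}

lemma IsL2Pair.jump {a : E d → E d} {v : Pair T.numCells d} (hv : T.IsL2Pair a v)
    (K : Fin T.numCells) (i : Fin (d + 1)) : MemLp (jump v K) 2 (T.facetMeas K i) :=
  (hv.bar K i).sub (hv.tr K i)

lemma IsL2Pair.comb {a : E d → E d} {v w : Pair T.numCells d} (hv : T.IsL2Pair a v)
    (hw : T.IsL2Pair a w) (t : ℝ) : T.IsL2Pair a (comb v t w) where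
  val K := (hv.val K).add ((hw.val K).const_smul t)
  adv K := by rw [adv_comb]; exact (hv.adv K).add ((hw.adv K).const_smul t)
  tr K i := (hv.tr K i).add ((hw.tr K i).const_smul t)
  bar K i := (hv.bar K i).add ((hw.bar K i).const_smul t)

variable (T)

open Classical in
/-- The indicator of the boundary facets. -/
def bd (K : Fin T.numCells) (i : Fin (d + 1)) : ℝ := if T.IsBoundary K i then 1 else 0

lemma bd_nonneg (K : Fin T.numCells) (i : Fin (d + 1)) : 0 ≤ T.bd K i := by
  unfold bd; split_ifs <;> norm_num

lemma bd_mul (K : Fin T.numCells) (i : Fin (d + 1)) [Decidable (T.IsBoundary K i)] (x : ℝ) :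
    (if T.IsBoundary K i then x else 0) = T.bd K i * x := by
  unfold bd; split_ifs <;> simp

lemma size_pos (K : Fin T.numCells) : 0 < T.size K := by
  have hd : 0 < d := Nat.pos_of_ne_zero (NeZero.ne d)
  have : Nontrivial (Fin (d + 1)) := Fin.nontrivial_iff_two_le.2 (by omega)
  obtain ⟨m, hm⟩ := exists_ne (0 : Fin (d + 1))
  refine (dist_pos.2 ((T.cell K).independent.injective.ne hm)).trans_le ?_
  exact Metric.dist_le_diam_of_mem (T.isCompact_cellSet K).isBounded
    ((T.cell K).point_mem_closedInterior m) ((T.cell K).point_mem_closedInterior 0)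

/-- The bilinear form in terms of weighted `L²` products over cells and facets. -/
lemma BA_eq {a : E d → E d} (ha : ContinuousOn a (closure Ω)) (μ : ℝ) (w v : Pair T.numCells d) :
    T.BA μ a w v =
      ∑ K, μ * wprod (T.cellMeas K) (fun _ => 1) (w.1.val K) (v.1.val K)
      - ∑ K, wprod (T.cellMeas K) (fun _ => 1) (w.1.val K) (adv a v K)
      - ∑ K, ∑ i, wprod (T.facetMeas K i) (T.bpos a K i) (w.1.tr K) (jump v K)
      + ∑ K, ∑ i, wprod (T.facetMeas K i) (T.bneg a K i) w.2 (jump v K)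
      + ∑ K, ∑ i, T.bd K i * wprod (T.facetMeas K i) (T.bpos a K i) w.2 v.2 := by
  have hp : ∀ K i x, 0 ≤ T.bn a K i x → T.bpos a K i x = T.bn a K i x :=
    fun K i x h => max_eq_left h
  have hp0 : ∀ K i x, T.bn a K i x ≤ 0 → T.bpos a K i x = 0 := fun K i x h => max_eq_right h
  have hn : ∀ K i x, T.bn a K i x < 0 → T.bneg a K i x = -T.bn a K i x :=
    fun K i x h => max_eq_left (by linarith)
  have hn0 : ∀ K i x, 0 ≤ T.bn a K i x → T.bneg a K i x = 0 :=
    fun K i x h => max_eq_right (by linarith)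
  have e1 : ∀ K, ∫ x in T.cellSet K, μ * w.1.val K x * v.1.val K x =
      μ * wprod (T.cellMeas K) (fun _ => 1) (w.1.val K) (v.1.val K) := fun K => by
    rw [wprod, ← integral_const_mul, cellMeas]
    congr 1; funext x; ring
  have e2 : ∀ K, ∫ x in T.cellSet K, w.1.val K x * inner ℝ (a x) (v.1.grad K x) =
      wprod (T.cellMeas K) (fun _ => 1) (w.1.val K) (adv a v K) := fun K => by
    rw [wprod, cellMeas]
    congr 1; funext x; rw [one_mul]; rfl
  have e3 : ∀ K i, ∫ x in T.outflow a K i, inner ℝ (a x) (T.normal K i) * w.1.tr K x *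
      (v.2 x - v.1.tr K x) ∂μHE[d - 1] =
      wprod (T.facetMeas K i) (T.bpos a K i) (w.1.tr K) (jump v K) := fun K i =>
    T.setIntegral_outflow ha K i (fun x h => by rw [hp K i x h]; rfl)
      (fun x h => by rw [hp0 K i x h]; ring)
  have e4 : ∀ K i, ∫ x in T.inflow a K i, inner ℝ (a x) (T.normal K i) * w.2 x *
      (v.2 x - v.1.tr K x) ∂μHE[d - 1] =
      -wprod (T.facetMeas K i) (T.bneg a K i) w.2 (jump v K) := fun K i => by
    rw [wprod, ← integral_neg]
    refine T.setIntegral_inflow ha K i (fun x h => ?_) (fun x h => by rw [hn0 K i x h]; ring)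
    rw [hn K i x h, neg_mul, neg_mul, neg_neg]; rfl
  have e5 : ∀ K i, ∫ x in T.outflow a K i, inner ℝ (a x) (T.normal K i) * w.2 x *
      v.2 x ∂μHE[d - 1] =
      wprod (T.facetMeas K i) (T.bpos a K i) w.2 v.2 := fun K i =>
    T.setIntegral_outflow ha K i (fun x h => by rw [hp K i x h]; rfl)
      (fun x h => by rw [hp0 K i x h]; ring)
  simp only [BA, e1, e2, e3, e4, e5, bd_mul, Finset.sum_neg_distrib, sub_neg_eq_add]

/-- The inner product that induces the stability norm. -/
def formA (μ : ℝ) (a : E d → E d) (w v : Pair T.numCells d) : ℝ :=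
  ∑ K, μ * wprod (T.cellMeas K) (fun _ => 1) (w.1.val K) (v.1.val K)
  + ∑ K, T.size K * wprod (T.cellMeas K) (fun _ => 1) (adv a w K) (adv a v K)
  + ∑ K, ∑ i, wprod (T.facetMeas K i) (fun x => |T.bn a K i x|) (jump w K) (jump v K)
  + ∑ K, ∑ i, T.bd K i * wprod (T.facetMeas K i) (fun x => |T.bn a K i x|) w.2 v.2

lemma formA_comm (μ : ℝ) (a : E d → E d) (w v : Pair T.numCells d) :
    T.formA μ a w v = T.formA μ a v w := by
  unfold formA
  simp only [fun K : Fin T.numCells => wprod_comm (ν := T.cellMeas K) (fun _ => 1) (w.1.val K),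
    fun K : Fin T.numCells => wprod_comm (ν := T.cellMeas K) (fun _ => 1) (adv a w K),
    fun (K : Fin T.numCells) (i : Fin (d + 1)) => wprod_comm (ν := T.facetMeas K i)
      (fun x => |T.bn a K i x|) (jump w K),
    fun (K : Fin T.numCells) (i : Fin (d + 1)) => wprod_comm (ν := T.facetMeas K i)
      (fun x => |T.bn a K i x|) w.2]

lemma wprod_one_self {X : Type*} [MeasurableSpace X] (ν : Measure X) (f : X → ℝ) :
    wprod ν (fun _ => 1) f f = ∫ x, f x ^ 2 ∂ν := by
  simp only [wprod, one_mul, sq]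

lemma wprod_self {X : Type*} [MeasurableSpace X] (ν : Measure X) (c f : X → ℝ) :
    wprod ν c f f = ∫ x, c x * f x ^ 2 ∂ν := by
  unfold wprod; congr 1; funext x; ring

lemma formA_self_nonneg {μ : ℝ} (hμ : 0 ≤ μ) (a : E d → E d) (v : Pair T.numCells d) :
    0 ≤ T.formA μ a v v := by
  refine add_nonneg (add_nonneg (add_nonneg ?_ ?_) ?_) ?_
  · exact Finset.sum_nonneg fun K _ => mul_nonneg hμ (wprod_self_nonneg (fun _ => zero_le_one) _)
  · exact Finset.sum_nonneg fun K _ => mul_nonneg (T.size_pos K).le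
      (wprod_self_nonneg (fun _ => zero_le_one) _)
  · exact Finset.sum_nonneg fun K _ => Finset.sum_nonneg fun i _ =>
      wprod_self_nonneg (fun _ => abs_nonneg _) _
  · exact Finset.sum_nonneg fun K _ => Finset.sum_nonneg fun i _ =>
      mul_nonneg (T.bd_nonneg K i) (wprod_self_nonneg (fun _ => abs_nonneg _) _)

lemma normA_eq_sqrt (μ : ℝ) (a : E d → E d) (v : Pair T.numCells d) :
    T.normA μ a v = √(T.formA μ a v v) := by
  unfold normA formA
  simp only [wprod_self, one_mul, bd_mul, Finset.mul_sum]
  rfl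

lemma normA_nonneg (μ : ℝ) (a : E d → E d) (v : Pair T.numCells d) : 0 ≤ T.normA μ a v :=
  Real.sqrt_nonneg _

lemma normA_sq {μ : ℝ} (hμ : 0 ≤ μ) (a : E d → E d) (v : Pair T.numCells d) :
    T.normA μ a v ^ 2 = T.formA μ a v v := by
  rw [normA_eq_sqrt, Real.sq_sqrt (T.formA_self_nonneg hμ a v)]

lemma normA'_sq {a : E d → E d} (ha : ContinuousOn a (closure Ω)) (μ : ℝ)
    (v : Pair T.numCells d) :
    T.normA' μ a v ^ 2 = T.normA μ a v ^ 2
      + ∑ K, (T.size K)⁻¹ * wprod (T.cellMeas K) (fun _ => 1) (v.1.val K) (v.1.val K)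
      + ∑ K, ∑ i, wprod (T.facetMeas K i) (T.bneg a K i) v.2 v.2
      + ∑ K, ∑ i, wprod (T.facetMeas K i) (T.bpos a K i) (v.1.tr K) (v.1.tr K) := by
  have e1 : ∀ K i, ∫ x in T.inflow a K i, |inner ℝ (a x) (T.normal K i)| * v.2 x ^ 2 ∂μHE[d - 1] =
      wprod (T.facetMeas K i) (T.bneg a K i) v.2 v.2 := fun K i => by
    rw [wprod_self]
    refine T.setIntegral_inflow ha K i (fun x h => ?_) fun x h => ?_
    · rw [bneg, max_eq_left (by linarith)]
      exact congrArg (· * v.2 x ^ 2) (abs_of_neg h)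
    · rw [bneg, max_eq_right (by linarith), zero_mul]
  have e2 : ∀ K i, ∫ x in T.outflow a K i,
      |inner ℝ (a x) (T.normal K i)| * v.1.tr K x ^ 2 ∂μHE[d - 1] =
      wprod (T.facetMeas K i) (T.bpos a K i) (v.1.tr K) (v.1.tr K) := fun K i => by
    rw [wprod_self]
    refine T.setIntegral_outflow ha K i (fun x h => ?_) fun x h => ?_
    · rw [bpos, max_eq_left h]
      exact congrArg (· * v.1.tr K x ^ 2) (abs_of_nonneg h)
    · rw [bpos, max_eq_right h, zero_mul]
  unfold normA'
  rw [Real.sq_sqrt]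
  · simp only [e1, e2, wprod_one_self]; rfl
  · simp only [e1, e2]
    refine add_nonneg (add_nonneg (add_nonneg (sq_nonneg _) ?_) ?_) ?_
    · exact Finset.sum_nonneg fun K _ => mul_nonneg (inv_nonneg.2 (T.size_pos K).le)
        (integral_nonneg fun x => sq_nonneg _)
    · exact Finset.sum_nonneg fun K _ => Finset.sum_nonneg fun i _ =>
        wprod_self_nonneg (T.bneg_nonneg a K i) _
    · exact Finset.sum_nonneg fun K _ => Finset.sum_nonneg fun i _ =>
        wprod_self_nonneg (T.bpos_nonneg a K i) _

lemma normA'_nonneg (μ : ℝ) (a : E d → E d) (v : Pair T.numCells d) : 0 ≤ T.normA' μ a v :=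
  Real.sqrt_nonneg _

section Forms

variable {a : E d → E d} (ha : ContinuousOn a (closure Ω)) (hb : ∀ x ∈ closure Ω, ‖a x‖ ≤ 1)
  {μ : ℝ} {v w z : Pair T.numCells d}

include ha hb

lemma BA_comb_left (hv : T.IsL2Pair a v) (hw : T.IsL2Pair a w) (hz : T.IsL2Pair a z) (t : ℝ) :
    T.BA μ a (comb v t w) z = T.BA μ a v z + t * T.BA μ a w z := by
  have e1 : ∀ K, wprod (T.cellMeas K) (fun _ => 1) ((comb v t w).1.val K) (z.1.val K) = _ :=
    fun K => wprod_add_smul_left isWeight_one (hv.val K) (hw.val K) (hz.val K) t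
  have e2 : ∀ K, wprod (T.cellMeas K) (fun _ => 1) ((comb v t w).1.val K) (adv a z K) = _ :=
    fun K => wprod_add_smul_left isWeight_one (hv.val K) (hw.val K) (hz.adv K) t
  have e3 : ∀ K i, wprod (T.facetMeas K i) (T.bpos a K i) ((comb v t w).1.tr K) (jump z K) = _ :=
    fun K i => wprod_add_smul_left (T.isWeight_bpos ha hb K i) (hv.tr K i) (hw.tr K i)
      (hz.jump K i) t
  have e4 : ∀ K i, wprod (T.facetMeas K i) (T.bneg a K i) (comb v t w).2 (jump z K) = _ :=
    fun K i => wprod_add_smul_left (T.isWeight_bneg ha hb K i) (hv.bar K i) (hw.bar K i)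
      (hz.jump K i) t
  have e5 : ∀ K i, wprod (T.facetMeas K i) (T.bpos a K i) (comb v t w).2 z.2 = _ :=
    fun K i => wprod_add_smul_left (T.isWeight_bpos ha hb K i) (hv.bar K i) (hw.bar K i)
      (hz.bar K i) t
  rw [T.BA_eq ha, T.BA_eq ha, T.BA_eq ha]
  simp only [e1, e2, e3, e4, e5, mul_add, Finset.sum_add_distrib, mul_left_comm _ t,
    ← Finset.mul_sum]
  ring

lemma BA_comb_right (hv : T.IsL2Pair a v) (hw : T.IsL2Pair a w) (hz : T.IsL2Pair a z) (t : ℝ) :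
    T.BA μ a z (comb v t w) = T.BA μ a z v + t * T.BA μ a z w := by
  have e1 : ∀ K, wprod (T.cellMeas K) (fun _ => 1) (z.1.val K) ((comb v t w).1.val K) = _ :=
    fun K => wprod_add_smul_right isWeight_one (hv.val K) (hw.val K) (hz.val K) t
  have e2 : ∀ K, wprod (T.cellMeas K) (fun _ => 1) (z.1.val K) (adv a v K + t • adv a w K) = _ :=
    fun K => wprod_add_smul_right isWeight_one (hv.adv K) (hw.adv K) (hz.val K) t
  have e3 : ∀ K i, wprod (T.facetMeas K i) (T.bpos a K i) (z.1.tr K)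
      (jump v K + t • jump w K) = _ :=
    fun K i => wprod_add_smul_right (T.isWeight_bpos ha hb K i) (hv.jump K i) (hw.jump K i)
      (hz.tr K i) t
  have e4 : ∀ K i, wprod (T.facetMeas K i) (T.bneg a K i) z.2 (jump v K + t • jump w K) = _ :=
    fun K i => wprod_add_smul_right (T.isWeight_bneg ha hb K i) (hv.jump K i) (hw.jump K i)
      (hz.bar K i) t
  have e5 : ∀ K i, wprod (T.facetMeas K i) (T.bpos a K i) z.2 (comb v t w).2 = _ :=
    fun K i => wprod_add_smul_right (T.isWeight_bpos ha hb K i) (hv.bar K i) (hw.bar K i)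
      (hz.bar K i) t
  rw [T.BA_eq ha, T.BA_eq ha, T.BA_eq ha]
  simp only [adv_comb, jump_comb, e1, e2, e3, e4, e5, mul_add, Finset.sum_add_distrib,
    mul_left_comm _ t, ← Finset.mul_sum]
  ring

lemma formA_comb_left (hv : T.IsL2Pair a v) (hw : T.IsL2Pair a w) (hz : T.IsL2Pair a z) (t : ℝ) :
    T.formA μ a (comb v t w) z = T.formA μ a v z + t * T.formA μ a w z := by
  have e1 : ∀ K, wprod (T.cellMeas K) (fun _ => 1) ((comb v t w).1.val K) (z.1.val K) = _ :=
    fun K => wprod_add_smul_left isWeight_one (hv.val K) (hw.val K) (hz.val K) t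
  have e2 : ∀ K, wprod (T.cellMeas K) (fun _ => 1) (adv a v K + t • adv a w K) (adv a z K) = _ :=
    fun K => wprod_add_smul_left isWeight_one (hv.adv K) (hw.adv K) (hz.adv K) t
  have e3 : ∀ K i, wprod (T.facetMeas K i) (fun x => |T.bn a K i x|) (jump v K + t • jump w K)
      (jump z K) = _ :=
    fun K i => wprod_add_smul_left (T.isWeight_abs_bn ha hb K i) (hv.jump K i) (hw.jump K i)
      (hz.jump K i) t
  have e4 : ∀ K i, wprod (T.facetMeas K i) (fun x => |T.bn a K i x|) (comb v t w).2 z.2 = _ :=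
    fun K i => wprod_add_smul_left (T.isWeight_abs_bn ha hb K i) (hv.bar K i) (hw.bar K i)
      (hz.bar K i) t
  unfold formA
  simp only [adv_comb, jump_comb, e1, e2, e3, e4, mul_add, Finset.sum_add_distrib,
    mul_left_comm _ t, ← Finset.mul_sum]
  ring

lemma formA_comb_self (hv : T.IsL2Pair a v) (hw : T.IsL2Pair a w) (t : ℝ) :
    T.formA μ a (comb v t w) (comb v t w) =
      T.formA μ a v v + 2 * t * T.formA μ a v w + t ^ 2 * T.formA μ a w w := by
  rw [T.formA_comb_left ha hb hv hw (hv.comb hw t), T.formA_comm μ a v, T.formA_comm μ a w,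
    T.formA_comb_left ha hb hv hw hv, T.formA_comb_left ha hb hv hw hw, T.formA_comm μ a w v]
  ring

/-- The triangle inequality for the stability norm. -/
lemma normA_comb_le (hμ : 0 ≤ μ) (hv : T.IsL2Pair a v) (hw : T.IsL2Pair a w) (t : ℝ) :
    T.normA μ a (comb v t w) ≤ T.normA μ a v + |t| * T.normA μ a w := by
  have hcs : |T.formA μ a v w| ≤ T.normA μ a v * T.normA μ a w := by
    rw [normA_eq_sqrt, normA_eq_sqrt]
    refine abs_le_sqrt_mul_sqrt (fun t => ?_) (T.formA_self_nonneg hμ a v)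
    rw [← T.formA_comb_self ha hb hv hw t]
    exact T.formA_self_nonneg hμ a _
  have h1 := T.normA_nonneg μ a v
  have h2 := T.normA_nonneg μ a w
  refine abs_le_of_sq_le_sq' ?_ (by positivity) |>.2
  rw [T.normA_sq hμ, T.formA_comb_self ha hb hv hw t, ← T.normA_sq hμ, ← T.normA_sq hμ]
  have h3 : t * T.formA μ a v w ≤ |t| * (T.normA μ a v * T.normA μ a w) := by
    calc _ ≤ |t * T.formA μ a v w| := le_abs_self _
      _ = |t| * |T.formA μ a v w| := abs_mul _ _
      _ ≤ _ := by gcongr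
  have h4 : |t| ^ 2 = t ^ 2 := sq_abs t
  calc T.normA μ a v ^ 2 + 2 * t * T.formA μ a v w + t ^ 2 * T.normA μ a w ^ 2
      ≤ T.normA μ a v ^ 2 + 2 * (|t| * (T.normA μ a v * T.normA μ a w)) +
        |t| ^ 2 * T.normA μ a w ^ 2 := by rw [h4]; linarith
    _ = _ := by ring

set_option maxHeartbeats 800000 in
/-- Continuity of the bilinear form, for all square integrable pairs. -/
lemma abs_BA_le (hμ : 0 ≤ μ) (hw : T.IsL2Pair a w) (hv : T.IsL2Pair a v) :
    |T.BA μ a w v| ≤ 5 * T.normA' μ a w * T.normA μ a v := by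
  have hN := T.normA'_nonneg μ a w
  have hM := T.normA_nonneg μ a v
  have hN2 := T.normA'_sq ha μ w
  have hM2 := T.normA_sq hμ a v
  have hwA := T.normA_sq hμ a w
  rw [formA] at hM2 hwA
  have one0 : ∀ x : E d, (0 : ℝ) ≤ (fun _ => 1) x := fun _ => zero_le_one
  -- nonnegativity of all parts of the norms
  have p1 : ∀ v : Pair T.numCells d, ∀ K,
      0 ≤ μ * wprod (T.cellMeas K) (fun _ => 1) (v.1.val K) (v.1.val K) :=
    fun v K => mul_nonneg hμ (wprod_self_nonneg one0 _)
  have p2 : ∀ v : Pair T.numCells d, ∀ K,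
      0 ≤ T.size K * wprod (T.cellMeas K) (fun _ => 1) (adv a v K) (adv a v K) :=
    fun v K => mul_nonneg (T.size_pos K).le (wprod_self_nonneg one0 _)
  have p3 : ∀ v : Pair T.numCells d, ∀ K i,
      0 ≤ wprod (T.facetMeas K i) (fun x => |T.bn a K i x|) (jump v K) (jump v K) :=
    fun v K i => wprod_self_nonneg (fun _ => abs_nonneg _) _
  have p4 : ∀ v : Pair T.numCells d, ∀ K i,
      0 ≤ T.bd K i * wprod (T.facetMeas K i) (fun x => |T.bn a K i x|) v.2 v.2 :=
    fun v K i => mul_nonneg (T.bd_nonneg K i) (wprod_self_nonneg (fun _ => abs_nonneg _) _)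
  have p5 : ∀ K, 0 ≤ (T.size K)⁻¹ * wprod (T.cellMeas K) (fun _ => 1) (w.1.val K) (w.1.val K) :=
    fun K => mul_nonneg (inv_nonneg.2 (T.size_pos K).le) (wprod_self_nonneg one0 _)
  have p6 : ∀ K i, 0 ≤ wprod (T.facetMeas K i) (T.bneg a K i) w.2 w.2 :=
    fun K i => wprod_self_nonneg (T.bneg_nonneg a K i) _
  have p7 : ∀ K i, 0 ≤ wprod (T.facetMeas K i) (T.bpos a K i) (w.1.tr K) (w.1.tr K) :=
    fun K i => wprod_self_nonneg (T.bpos_nonneg a K i) _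
  have s1 := fun v => Finset.sum_nonneg fun K (_ : K ∈ Finset.univ) => p1 v K
  have s2 := fun v => Finset.sum_nonneg fun K (_ : K ∈ Finset.univ) => p2 v K
  have s3 := fun v => Finset.sum_nonneg fun K (_ : K ∈ Finset.univ) =>
    Finset.sum_nonneg fun i (_ : i ∈ Finset.univ) => p3 v K i
  have s4 := fun v => Finset.sum_nonneg fun K (_ : K ∈ Finset.univ) =>
    Finset.sum_nonneg fun i (_ : i ∈ Finset.univ) => p4 v K i
  have s5 := Finset.sum_nonneg fun K (_ : K ∈ Finset.univ) => p5 K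
  have s6 := Finset.sum_nonneg fun K (_ : K ∈ Finset.univ) =>
    Finset.sum_nonneg fun i (_ : i ∈ Finset.univ) => p6 K i
  have s7 := Finset.sum_nonneg fun K (_ : K ∈ Finset.univ) =>
    Finset.sum_nonneg fun i (_ : i ∈ Finset.univ) => p7 K i
  -- the positive and negative parts are dominated by the absolute value
  have lpos : ∀ K i (f : E d → ℝ), MemLp f 2 (T.facetMeas K i) →
      wprod (T.facetMeas K i) (T.bpos a K i) f f ≤
        wprod (T.facetMeas K i) (fun x => |T.bn a K i x|) f f := fun K i f hf =>
    wprod_self_mono (T.isWeight_bpos ha hb K i) (T.isWeight_abs_bn ha hb K i)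
      (Eventually.of_forall fun x => max_le (le_abs_self _) (abs_nonneg _)) hf
  have lneg : ∀ K i (f : E d → ℝ), MemLp f 2 (T.facetMeas K i) →
      wprod (T.facetMeas K i) (T.bneg a K i) f f ≤
        wprod (T.facetMeas K i) (fun x => |T.bn a K i x|) f f := fun K i f hf =>
    wprod_self_mono (T.isWeight_bneg ha hb K i) (T.isWeight_abs_bn ha hb K i)
      (Eventually.of_forall fun x => max_le (neg_le_abs _) (abs_nonneg _)) hf
  have b1 : |∑ K, μ * wprod (T.cellMeas K) (fun _ => 1) (w.1.val K) (v.1.val K)| ≤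
      T.normA' μ a w * T.normA μ a v := by
    refine abs_sum_le_mul (p1 w) (p1 v) hN hM (fun K => ?_) ?_ ?_
    · rw [abs_mul, abs_of_nonneg hμ, Real.sqrt_mul hμ, Real.sqrt_mul hμ, mul_mul_mul_comm,
        Real.mul_self_sqrt hμ]
      exact mul_le_mul_of_nonneg_left (abs_wprod_le isWeight_one one0 (hw.val K) (hv.val K)) hμ
    · linarith [s2 w, s3 w, s4 w]
    · linarith [s2 v, s3 v, s4 v]
  have b2 : |∑ K, wprod (T.cellMeas K) (fun _ => 1) (w.1.val K) (adv a v K)| ≤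
      T.normA' μ a w * T.normA μ a v := by
    refine abs_sum_le_mul p5 (p2 v) hN hM (fun K => ?_) ?_ ?_
    · exact abs_wprod_le_of_pos isWeight_one one0 (hw.val K) (hv.adv K) (T.size_pos K)
    · linarith [s1 w, s2 w, s3 w, s4 w]
    · linarith [s1 v, s3 v, s4 v]
  have b3 : |∑ K, ∑ i, wprod (T.facetMeas K i) (T.bpos a K i) (w.1.tr K) (jump v K)| ≤
      T.normA' μ a w * T.normA μ a v := by
    refine abs_sum_sum_le_mul p7 (p3 v) hN hM (fun K i => ?_) ?_ ?_
    · refine (abs_wprod_le (T.isWeight_bpos ha hb K i) (T.bpos_nonneg a K i)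
        (hw.tr K i) (hv.jump K i)).trans ?_
      exact mul_le_mul_of_nonneg_left (Real.sqrt_le_sqrt (lpos _ _ _ (hv.jump K i)))
        (Real.sqrt_nonneg _)
    · linarith [s1 w, s2 w, s3 w, s4 w]
    · linarith [s1 v, s2 v, s4 v]
  have b4 : |∑ K, ∑ i, wprod (T.facetMeas K i) (T.bneg a K i) w.2 (jump v K)| ≤
      T.normA' μ a w * T.normA μ a v := by
    refine abs_sum_sum_le_mul p6 (p3 v) hN hM (fun K i => ?_) ?_ ?_
    · refine (abs_wprod_le (T.isWeight_bneg ha hb K i) (T.bneg_nonneg a K i)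
        (hw.bar K i) (hv.jump K i)).trans ?_
      exact mul_le_mul_of_nonneg_left (Real.sqrt_le_sqrt (lneg _ _ _ (hv.jump K i)))
        (Real.sqrt_nonneg _)
    · linarith [s1 w, s2 w, s3 w, s4 w]
    · linarith [s1 v, s2 v, s4 v]
  have b5 : |∑ K, ∑ i, T.bd K i * wprod (T.facetMeas K i) (T.bpos a K i) w.2 v.2| ≤
      T.normA' μ a w * T.normA μ a v := by
    refine abs_sum_sum_le_mul (p4 w) (p4 v) hN hM (fun K i => ?_) ?_ ?_
    · have h0 := T.bd_nonneg K i
      rw [abs_mul, abs_of_nonneg h0, Real.sqrt_mul h0, Real.sqrt_mul h0, mul_mul_mul_comm,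
        Real.mul_self_sqrt h0]
      refine mul_le_mul_of_nonneg_left ?_ h0
      refine (abs_wprod_le (T.isWeight_bpos ha hb K i) (T.bpos_nonneg a K i)
        (hw.bar K i) (hv.bar K i)).trans ?_
      exact mul_le_mul (Real.sqrt_le_sqrt (lpos _ _ _ (hw.bar K i)))
        (Real.sqrt_le_sqrt (lpos _ _ _ (hv.bar K i))) (Real.sqrt_nonneg _) (Real.sqrt_nonneg _)
    · linarith [s1 w, s2 w, s3 w]
    · linarith [s1 v, s2 v, s3 v]
  rw [T.BA_eq ha]
  rw [mul_assoc]
  generalize T.normA' μ a w * T.normA μ a v = R at *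
  obtain ⟨l1, u1⟩ := abs_le.1 b1
  obtain ⟨l2, u2⟩ := abs_le.1 b2
  obtain ⟨l3, u3⟩ := abs_le.1 b3
  obtain ⟨l4, u4⟩ := abs_le.1 b4
  obtain ⟨l5, u5⟩ := abs_le.1 b5
  exact abs_le.2 ⟨by linarith, by linarith⟩

end Forms

end Triangulation


/-! ### Square integrability of discrete and `H¹` pairs -/

namespace Triangulation

variable {d : ℕ} [NeZero d] {Ω : Set (E d)} (T : Triangulation Ω)

lemma cellMeas_le (K : Fin T.numCells) : T.cellMeas K ≤ volume.restrict Ω := by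
  have h : T.cellMeas K ≤ volume.restrict (interior (T.cellSet K)) := by
    refine Measure.restrict_mono_ae ?_
    have := (ae_restrict_iff' (T.measurableSet_cellSet K)).1 (ae_mem_interior (T.cell K))
    filter_upwards [this] with x hx using hx
  exact h.trans (Measure.restrict_mono_set _ (T.interior_cellSet_subset K))

lemma facet_subset_skeleton (K : Fin T.numCells) (i : Fin (d + 1)) : T.facet K i ⊆ T.skeleton :=
  Set.subset_iUnion_of_subset K (Set.subset_iUnion_of_subset i le_rfl)

lemma facetMeas_le (K : Fin T.numCells) (i : Fin (d + 1)) : T.facetMeas K i ≤ T.surf :=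
  Measure.restrict_mono_set _ (T.facet_subset_skeleton K i)

lemma memLp_cellMeas {F : Type*} [NormedAddCommGroup F] {f : E d → F} (K : Fin T.numCells)
    (hf : ContinuousOn f (T.cellSet K)) : MemLp f 2 (T.cellMeas K) :=
  memLp_of_continuous_of_isCompact (T.isCompact_cellSet K) (T.measurableSet_cellSet K)
    (T.isCompact_cellSet K).measure_lt_top hf

lemma memLp_facetMeas {F : Type*} [NormedAddCommGroup F] {f : E d → F} (K : Fin T.numCells)
    (i : Fin (d + 1)) (hf : ContinuousOn f (T.facet K i)) : MemLp f 2 (T.facetMeas K i) :=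
  memLp_of_continuous_of_isCompact (T.isCompact_facet K i) (T.measurableSet_facet K i)
    (hausdorff_facet_lt_top (T.cell K) i) hf

lemma continuous_gradient {f : E d → ℝ} (hf : ContDiff ℝ ∞ f) : Continuous (gradient f) :=
  (LinearIsometryEquiv.continuous _).comp (hf.continuous_fderiv (by simp))

lemma memLp_inner_cellMeas {a G : E d → E d} (ha : ContinuousOn a (closure Ω))
    (hb : ∀ x ∈ closure Ω, ‖a x‖ ≤ 1) (K : Fin T.numCells) (hG : MemLp G 2 (T.cellMeas K)) :
    MemLp (fun x => inner ℝ (a x) (G x)) 2 (T.cellMeas K) := by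
  refine hG.of_le (AEStronglyMeasurable.inner
    ((ha.mono (T.cellSet_subset_closure K)).aestronglyMeasurable_of_isCompact
      (T.isCompact_cellSet K) (T.measurableSet_cellSet K)) hG.1) ?_
  refine (ae_restrict_iff' (T.measurableSet_cellSet K)).2 (Eventually.of_forall fun x hx => ?_)
  refine (norm_inner_le_norm _ _).trans ?_
  exact mul_le_of_le_one_left (norm_nonneg _) (hb x (T.cellSet_subset_closure K hx))

lemma memLp_facetMeas_of_HSob {l : ℝ} {w : E d → ℝ} (hw : w ∈ T.HSob l) (K : Fin T.numCells)
    (i : Fin (d + 1)) : MemLp w 2 (T.facetMeas K i) :=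
  hw.1.mono_measure (T.facetMeas_le K i)

/-- The cell function with the polynomials `q K`. -/
def ofPoly (q : Fin T.numCells → E d → ℝ) : CellFn T.numCells d :=
  ⟨q, fun K => gradient (q K), q⟩

lemma ofPoly_mem_Wh {k : ℕ} {q : Fin T.numCells → E d → ℝ} (hq : ∀ K, IsPoly k (q K)) :
    T.ofPoly q ∈ T.Wh k :=
  fun K => ⟨hq K, rfl, rfl⟩

lemma gradient_add_smul {p q : E d → ℝ} (hp : Differentiable ℝ p) (hq : Differentiable ℝ q)
    (t : ℝ) : gradient (p + t • q) = gradient p + t • gradient q := by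
  funext x
  simp only [gradient, Pi.add_apply, Pi.smul_apply]
  rw [fderiv_add (hp x) ((hq x).const_smul t), fderiv_const_smul (hq x), map_add, map_smul]

lemma comb_mem_Wh {k : ℕ} {v w : Pair T.numCells d} (hv : v.1 ∈ T.Wh k) (hw : w.1 ∈ T.Wh k)
    (t : ℝ) : (comb v t w).1 ∈ T.Wh k := fun K => by
  obtain ⟨h1, h2, h3⟩ := hv K
  obtain ⟨h1', h2', h3'⟩ := hw K
  refine ⟨h1.add_smul h1' t, ?_, ?_⟩
  · simp only [comb]
    rw [h2, h2', gradient_add_smul ((contDiff_of_isPoly h1).differentiable (by simp))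
      ((contDiff_of_isPoly h1').differentiable (by simp))]
  · simp only [comb]
    rw [h3, h3']

section Field

variable {a : E d → E d} (ha : ContinuousOn a (closure Ω)) (hb : ∀ x ∈ closure Ω, ‖a x‖ ≤ 1)

include ha

lemma isL2Pair_of_mem_Wh {k : ℕ} {v : Pair T.numCells d} (hv : v.1 ∈ T.Wh k)
    (hv2 : ∀ K i, MemLp v.2 2 (T.facetMeas K i)) : T.IsL2Pair a v where
  val K := T.memLp_cellMeas K (contDiff_of_isPoly (hv K).1).continuous.continuousOn
  adv K := T.memLp_cellMeas K <| (ha.mono (T.cellSet_subset_closure K)).inner (by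
    rw [(hv K).2.1]; exact (continuous_gradient_of_isPoly (hv K).1).continuousOn)
  tr K i := T.memLp_facetMeas K i (by
    rw [(hv K).2.2]; exact (contDiff_of_isPoly (hv K).1).continuous.continuousOn)
  bar := hv2

lemma isL2Pair_of_mem_WhStar {k : ℕ} {l : ℝ} {v : Pair T.numCells d} (hv : v ∈ T.WhStar k l) :
    T.IsL2Pair a v :=
  T.isL2Pair_of_mem_Wh ha hv.1 (T.memLp_facetMeas_of_HSob hv.2.1)

include hb

lemma isL2Pair_ofH1 {u t z : E d → ℝ} {G : E d → E d} (hu : IsH1 Ω T.skeleton u G t)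
    (hz : ∀ K i, MemLp z 2 (T.facetMeas K i)) : T.IsL2Pair a (T.ofH1 u G t, z) where
  val K := hu.memLp.mono_measure (T.cellMeas_le K)
  adv K := T.memLp_inner_cellMeas ha hb K (hu.grad_memLp.mono_measure (T.cellMeas_le K))
  tr K i := hu.trace_memLp.mono_measure (T.facetMeas_le K i)
  bar := hz

lemma isL2Pair_of_mem_WStarExt {k : ℕ} {l : ℝ} {v : Pair T.numCells d}
    (hv : v ∈ T.WStarExt k l) : T.IsL2Pair a v := by
  obtain ⟨⟨w, hw, u, G, t, hu, h1⟩, ⟨w', hw', z, hz, h2⟩⟩ := hv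
  have h : v = comb (w, w') 1 (T.ofH1 u G t, z) := by
    refine Prod.ext (h1.trans ?_) (h2.trans ?_)
    · simp only [comb, one_smul]; rfl
    · simp only [comb, one_smul]
  rw [h]
  exact (T.isL2Pair_of_mem_WhStar ha (k := k) (l := l) ⟨hw, hw'⟩).comb
    (T.isL2Pair_ofH1 ha hb hu (T.memLp_facetMeas_of_HSob hz)) 1

omit hb in
/-- Integration by parts on a cell, from the divergence theorem for the product `p q`. -/
lemma integration_by_parts (hdiv : DivergenceFree Ω a) (K : Fin T.numCells) {p q : E d → ℝ}
    (hp : ContDiff ℝ ∞ p) (hq : ContDiff ℝ ∞ q) :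
    wprod (T.cellMeas K) (fun _ => 1) p (fun x => inner ℝ (a x) (gradient q x)) +
      wprod (T.cellMeas K) (fun _ => 1) q (fun x => inner ℝ (a x) (gradient p x)) =
      ∑ i, wprod (T.facetMeas K i) (T.bn a K i) p q := by
  have haK := ha.mono (T.cellSet_subset_closure K)
  have hm : ∀ r : E d → ℝ, ContDiff ℝ ∞ r →
      MemLp (fun x => inner ℝ (a x) (gradient r x)) 2 (T.cellMeas K) := fun r hr =>
    T.memLp_cellMeas K (haK.inner (continuous_gradient hr).continuousOn)
  have hc : ∀ r : E d → ℝ, ContDiff ℝ ∞ r → MemLp r 2 (T.cellMeas K) := fun r hr =>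
    T.memLp_cellMeas K hr.continuous.continuousOn
  have h := divergence_theorem_of_divergenceFree (T.cell K) (T.interior_cellSet_subset K) haK hdiv
    (hp.mul hq)
  have h2 : ∀ i, wprod (T.facetMeas K i) (T.bn a K i) p q =
      ∫ x in ((T.cell K).faceOpposite i).closedInterior,
        inner ℝ (a x) (unitNormal (T.cell K) i) * (p x * q x) ∂μHE[d - 1] := fun i => by
    unfold wprod
    refine integral_congr_ae (Eventually.of_forall fun x => ?_)
    simp only [mul_assoc]; rfl
  rw [Finset.sum_congr rfl fun i _ => h2 i, ← h]
  unfold wprod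
  rw [← integral_add (isWeight_one.integrable (hc p hp) (hm q hq))
    (isWeight_one.integrable (hc q hq) (hm p hp))]
  refine integral_congr_ae (Eventually.of_forall fun x => ?_)
  have hf := fderiv_mul (hp.differentiable (by simp) x) (hq.differentiable (by simp) x)
  simp only [inner_gradient_eq]
  have hg : fderiv ℝ (fun x => p x * q x) x = p x • fderiv ℝ q x + q x • fderiv ℝ p x := hf
  simp [hg]

end Field

end Triangulation


/-! ### Energy identities and the streamline function -/

namespace Triangulation

variable {d : ℕ} [NeZero d] {Ω : Set (E d)} (T : Triangulation Ω)

section Energy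

variable {a : E d → E d} (ha : ContinuousOn a (closure Ω)) (hb : ∀ x ∈ closure Ω, ‖a x‖ ≤ 1)

include ha hb

lemma wprod_bn {K : Fin T.numCells} {i : Fin (d + 1)} {f g : E d → ℝ}
    (hf : MemLp f 2 (T.facetMeas K i)) (hg : MemLp g 2 (T.facetMeas K i)) :
    wprod (T.facetMeas K i) (T.bn a K i) f g =
      wprod (T.facetMeas K i) (T.bpos a K i) f g - wprod (T.facetMeas K i) (T.bneg a K i) f g := by
  rw [bn_eq, wprod_sub_weight (T.isWeight_bpos ha hb K i) (T.isWeight_bneg ha hb K i) hf hg]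

lemma wprod_abs_bn {K : Fin T.numCells} {i : Fin (d + 1)} {f g : E d → ℝ}
    (hf : MemLp f 2 (T.facetMeas K i)) (hg : MemLp g 2 (T.facetMeas K i)) :
    wprod (T.facetMeas K i) (fun x => |T.bn a K i x|) f g =
      wprod (T.facetMeas K i) (T.bpos a K i) f g + wprod (T.facetMeas K i) (T.bneg a K i) f g := by
  rw [abs_bn_eq, wprod_add_weight (T.isWeight_bpos ha hb K i) (T.isWeight_bneg ha hb K i) hf hg]

omit ha hb in
/-- The normal fluxes of a single-valued facet function cancel across interior facets. -/
lemma sum_wprod_bn_eq (f g : E d → ℝ) :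
    ∑ K, ∑ i, wprod (T.facetMeas K i) (T.bn a K i) f g =
      ∑ K, ∑ i, T.bd K i * wprod (T.facetMeas K i) (T.bn a K i) f g := by
  classical
  have h := T.sum_facet_eq_sum_boundary a fun x => f x * g x
  simp only [← bd_mul, wprod, mul_assoc]
  convert h using 6 <;> rfl

/-- The bilinear form on the diagonal: the part of the stability norm without the streamline
term. -/
lemma BA_self (hdiv : DivergenceFree Ω a) (μ : ℝ) {k : ℕ} {v : Pair T.numCells d}
    (hv : v.1 ∈ T.Wh k) (hv2 : ∀ K i, MemLp v.2 2 (T.facetMeas K i)) :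
    T.BA μ a v v = ∑ K, μ * wprod (T.cellMeas K) (fun _ => 1) (v.1.val K) (v.1.val K)
      + 1 / 2 * ∑ K, ∑ i, wprod (T.facetMeas K i) (fun x => |T.bn a K i x|) (jump v K) (jump v K)
      + 1 / 2 * ∑ K, ∑ i, T.bd K i *
        wprod (T.facetMeas K i) (fun x => |T.bn a K i x|) v.2 v.2 := by
  have hL := T.isL2Pair_of_mem_Wh ha hv hv2
  have h1 : ∀ K, wprod (T.cellMeas K) (fun _ => 1) (v.1.val K) (adv a v K) =
      1 / 2 * ∑ i, wprod (T.facetMeas K i) (T.bn a K i) (v.1.tr K) (v.1.tr K) := fun K => by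
    have h := T.integration_by_parts ha hdiv K (contDiff_of_isPoly (hv K).1)
      (contDiff_of_isPoly (hv K).1)
    rw [(hv K).2.2, ← h]
    have : adv a v K = fun x => inner ℝ (a x) (gradient (v.1.val K) x) := by
      funext x; rw [adv, (hv K).2.1]
    rw [this]; ring
  have h2 : ∀ K i, 1 / 2 * wprod (T.facetMeas K i) (T.bn a K i) (v.1.tr K) (v.1.tr K)
      + wprod (T.facetMeas K i) (T.bpos a K i) (v.1.tr K) (jump v K)
      - wprod (T.facetMeas K i) (T.bneg a K i) v.2 (jump v K) =
      1 / 2 * wprod (T.facetMeas K i) (T.bn a K i) v.2 v.2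
      - 1 / 2 * wprod (T.facetMeas K i) (fun x => |T.bn a K i x|) (jump v K) (jump v K) :=
    fun K i => by
    have ht := hL.tr K i
    have hB := hL.bar K i
    rw [T.wprod_abs_bn ha hb (hL.jump K i) (hL.jump K i), T.wprod_bn ha hb ht ht,
      T.wprod_bn ha hb hB hB]
    have hp := T.isWeight_bpos ha hb K i
    have hn := T.isWeight_bneg ha hb K i
    simp only [jump]
    rw [wprod_sub_right hp hB ht ht, wprod_sub_right hn hB ht hB,
      wprod_sub_left hp hB ht (hB.sub ht), wprod_sub_left hn hB ht (hB.sub ht),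
      wprod_sub_right hp hB ht hB, wprod_sub_right hp hB ht ht,
      wprod_sub_right hn hB ht hB, wprod_sub_right hn hB ht ht,
      wprod_comm (T.bpos a K i) v.2 (v.1.tr K), wprod_comm (T.bneg a K i) (v.1.tr K) v.2]
    ring
  have h3 := Finset.sum_congr rfl fun K (_ : K ∈ Finset.univ) =>
    Finset.sum_congr rfl fun i (_ : i ∈ Finset.univ) => h2 K i
  simp only [Finset.sum_add_distrib, Finset.sum_sub_distrib, ← Finset.mul_sum] at h3
  have h4 := T.sum_wprod_bn_eq (a := a) v.2 v.2
  have h5 : ∀ K i, wprod (T.facetMeas K i) (T.bn a K i) v.2 v.2 =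
      2 * wprod (T.facetMeas K i) (T.bpos a K i) v.2 v.2
      - wprod (T.facetMeas K i) (fun x => |T.bn a K i x|) v.2 v.2 := fun K i => by
    rw [T.wprod_abs_bn ha hb (hv2 K i) (hv2 K i), T.wprod_bn ha hb (hv2 K i) (hv2 K i)]; ring
  rw [h4] at h3
  simp only [h5, mul_sub, Finset.sum_sub_distrib, mul_left_comm _ (2 : ℝ), ← Finset.mul_sum] at h3
  rw [T.BA_eq ha]
  simp only [h1, ← Finset.mul_sum]
  linarith

/-- The bilinear form on a test pair without facet part, after integration by parts. -/
lemma BA_ofPoly (hdiv : DivergenceFree Ω a) (μ : ℝ) {k : ℕ} {v : Pair T.numCells d}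
    (hv : v.1 ∈ T.Wh k) (hv2 : ∀ K i, MemLp v.2 2 (T.facetMeas K i))
    {z : Fin T.numCells → E d → ℝ} (hz : ∀ K, IsPoly k (z K)) :
    T.BA μ a v (T.ofPoly z, 0) = ∑ K, (μ * wprod (T.cellMeas K) (fun _ => 1) (v.1.val K) (z K)
      + wprod (T.cellMeas K) (fun _ => 1) (z K) (adv a v K)
      - ∑ i, wprod (T.facetMeas K i) (T.bneg a K i) (jump v K) (z K)) := by
  have hL := T.isL2Pair_of_mem_Wh ha hv hv2
  have hzL : ∀ K i, MemLp (z K) 2 (T.facetMeas K i) := fun K i =>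
    T.memLp_facetMeas K i (contDiff_of_isPoly (hz K)).continuous.continuousOn
  have h1 : ∀ K, wprod (T.cellMeas K) (fun _ => 1) (v.1.val K) (adv a (T.ofPoly z, 0) K) =
      ∑ i, wprod (T.facetMeas K i) (T.bn a K i) (v.1.tr K) (z K)
        - wprod (T.cellMeas K) (fun _ => 1) (z K) (adv a v K) := fun K => by
    have h := T.integration_by_parts ha hdiv K (contDiff_of_isPoly (hv K).1)
      (contDiff_of_isPoly (hz K))
    have e : adv a v K = fun x => inner ℝ (a x) (gradient (v.1.val K) x) := by
      funext x; rw [adv, (hv K).2.1]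
    have e' : adv a ((T.ofPoly z, 0) : Pair T.numCells d) K =
      fun x => inner ℝ (a x) (gradient (z K) x) := rfl
    rw [(hv K).2.2, ← h, e, e']; ring
  have hj : ∀ K, jump ((T.ofPoly z, 0) : Pair T.numCells d) K = (0 : E d → ℝ) - z K :=
    fun K => rfl
  have h0 : ∀ K i, MemLp (0 : E d → ℝ) 2 (T.facetMeas K i) := fun K i => MemLp.zero
  have h2 : ∀ K i, wprod (T.facetMeas K i) (T.bpos a K i) (v.1.tr K)
      (jump ((T.ofPoly z, 0) : Pair T.numCells d) K) =
      -wprod (T.facetMeas K i) (T.bpos a K i) (v.1.tr K) (z K) := fun K i => by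
    rw [hj, wprod_sub_right (T.isWeight_bpos ha hb K i) (h0 K i) (hzL K i) (hL.tr K i),
      wprod_zero_right, zero_sub]
  have h3 : ∀ K i, wprod (T.facetMeas K i) (T.bneg a K i) v.2
      (jump ((T.ofPoly z, 0) : Pair T.numCells d) K) =
      -wprod (T.facetMeas K i) (T.bneg a K i) v.2 (z K) := fun K i => by
    rw [hj, wprod_sub_right (T.isWeight_bneg ha hb K i) (h0 K i) (hzL K i) (hL.bar K i),
      wprod_zero_right, zero_sub]
  have h4 : ∀ K i, wprod (T.facetMeas K i) (T.bneg a K i) (jump v K) (z K) =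
      wprod (T.facetMeas K i) (T.bneg a K i) v.2 (z K)
      - wprod (T.facetMeas K i) (T.bneg a K i) (v.1.tr K) (z K) := fun K i =>
    wprod_sub_left (T.isWeight_bneg ha hb K i) (hL.bar K i) (hL.tr K i) (hzL K i)
  have h5 : ∀ K i, wprod (T.facetMeas K i) (T.bn a K i) (v.1.tr K) (z K) = _ := fun K i =>
    T.wprod_bn ha hb (hL.tr K i) (hzL K i)
  rw [T.BA_eq ha]
  simp only [h1, h2, h3, h4, h5, wprod_zero_right, mul_zero, Finset.sum_const_zero,
    Finset.sum_add_distrib, Finset.sum_sub_distrib, Finset.sum_neg_distrib]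
  simp only [ofPoly]
  ring

end Energy

/-- Inverse and trace inequalities with constant `C` for polynomials of degree at most `k` on all
cells. -/
def HasInverseConst (k : ℕ) (C : ℝ) : Prop :=
  ∀ K, ∀ q : E d → ℝ, IsPoly k q →
    T.size K ^ 2 * ∫ x, ‖gradient q x‖ ^ 2 ∂(T.cellMeas K) ≤
      C * wprod (T.cellMeas K) (fun _ => 1) q q ∧
    ∀ i, T.size K * wprod (T.facetMeas K i) (fun _ => 1) q q ≤
      C * wprod (T.cellMeas K) (fun _ => 1) q q

variable {T}

lemma ShapeRegular.hasInverseConst {k : ℕ} {σ C : ℝ}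
    (hC : ∀ (s : Affine.Simplex ℝ (E d) d) (c : E d) (r : ℝ), 0 < r →
      Metric.closedBall c r ⊆ s.closedInterior → Metric.diam s.closedInterior ≤ σ * r →
      ∀ q : E d → ℝ, IsPoly k q →
        Metric.diam s.closedInterior ^ 2 * ∫ x in s.closedInterior, ‖gradient q x‖ ^ 2 ≤
          C * ∫ x in s.closedInterior, q x ^ 2 ∧
        ∀ i, Metric.diam s.closedInterior *
          ∫ x in (s.faceOpposite i).closedInterior, q x ^ 2 ∂μHE[d - 1] ≤
          C * ∫ x in s.closedInterior, q x ^ 2)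
    (hT : T.ShapeRegular σ) : T.HasInverseConst k C := fun K q hq => by
  obtain ⟨c, r, hr, hball, hdiam⟩ := hT K
  obtain ⟨h1, h2⟩ := hC (T.cell K) c r hr hball hdiam q hq
  simp only [wprod_one_self]
  exact ⟨h1, h2⟩

variable (T)

/-- The value of `h_K a · ∇q` on the cell `K`, with `a` frozen at a vertex of the cell: a
polynomial that approximates the streamline derivative. -/
def streamline (a : E d → E d) (K : Fin T.numCells) (q : E d → ℝ) (x : E d) : ℝ :=
  T.size K * inner ℝ (a ((T.cell K).points 0)) (gradient q x)

lemma isPoly_streamline {k : ℕ} (a : E d → E d) (K : Fin T.numCells) {q : E d → ℝ}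
    (hq : IsPoly k q) : IsPoly k (T.streamline a K q) :=
  (isPoly_inner_gradient hq _).const_mul _

section Estimates

variable {T} {a : E d → E d} {k : ℕ} {C : ℝ} {q : E d → ℝ}
  (hb : ∀ x ∈ closure Ω, ‖a x‖ ≤ 1) (hC : T.HasInverseConst k C) (hq : IsPoly k q)

include hb hC hq

/-- The streamline function is bounded by `q` in `L²`, by the inverse inequality. -/
lemma wprod_streamline_self_le (K : Fin T.numCells) :
    wprod (T.cellMeas K) (fun _ => 1) (T.streamline a K q) (T.streamline a K q) ≤
      C * wprod (T.cellMeas K) (fun _ => 1) q q := by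
  refine le_trans ?_ (hC K q hq).1
  have hg := (T.memLp_cellMeas K (continuous_gradient_of_isPoly hq).continuousOn).norm
  rw [wprod_one_self, ← integral_const_mul]
  refine integral_mono (T.memLp_cellMeas K
    (contDiff_of_isPoly (T.isPoly_streamline a K hq)).continuous.continuousOn).integrable_sq
    (hg.integrable_sq.const_mul _) fun x => ?_
  have h1 : ‖a ((T.cell K).points 0)‖ ≤ 1 :=
    hb _ (T.cellSet_subset_closure K ((T.cell K).point_mem_closedInterior 0))
  have h2 : |inner ℝ (a ((T.cell K).points 0)) (gradient q x)| ≤ ‖gradient q x‖ :=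
    (abs_real_inner_le_norm _ _).trans (mul_le_of_le_one_left (norm_nonneg _) h1)
  simp only [streamline, mul_pow]
  exact mul_le_mul_of_nonneg_left (sq_le_sq' (abs_le.1 h2).1 (abs_le.1 h2).2) (sq_nonneg _)

variable (ha : ContinuousOn a (closure Ω))

include ha

lemma size_mul_wprod_adv_le (K : Fin T.numCells) :
    T.size K * wprod (T.cellMeas K) (fun _ => 1) (fun x => inner ℝ (a x) (gradient q x))
      (fun x => inner ℝ (a x) (gradient q x)) ≤
      C * ((T.size K)⁻¹ * wprod (T.cellMeas K) (fun _ => 1) q q) := by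
  have hh := T.size_pos K
  have hg := T.memLp_cellMeas K (continuous_gradient_of_isPoly hq).continuousOn
  have h1 : wprod (T.cellMeas K) (fun _ => 1) (fun x => inner ℝ (a x) (gradient q x))
      (fun x => inner ℝ (a x) (gradient q x)) ≤ ∫ x, ‖gradient q x‖ ^ 2 ∂(T.cellMeas K) := by
    rw [wprod_one_self]
    refine integral_mono_ae (T.memLp_inner_cellMeas ha hb K hg).integrable_sq
      hg.norm.integrable_sq ?_
    refine (ae_restrict_iff' (T.measurableSet_cellSet K)).2 (Eventually.of_forall fun x hx => ?_)
    have h2 : |inner ℝ (a x) (gradient q x)| ≤ ‖gradient q x‖ :=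
      (abs_real_inner_le_norm _ _).trans (mul_le_of_le_one_left (norm_nonneg _)
        (hb x (T.cellSet_subset_closure K hx)))
    exact sq_le_sq' (abs_le.1 h2).1 (abs_le.1 h2).2
  calc _ ≤ T.size K * ∫ x, ‖gradient q x‖ ^ 2 ∂(T.cellMeas K) := by gcongr
    _ = (T.size K)⁻¹ * (T.size K ^ 2 * ∫ x, ‖gradient q x‖ ^ 2 ∂(T.cellMeas K)) := by
      field_simp
    _ ≤ (T.size K)⁻¹ * (C * wprod (T.cellMeas K) (fun _ => 1) q q) := by
      exact mul_le_mul_of_nonneg_left (hC K q hq).1 (inv_nonneg.2 hh.le)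
    _ = _ := by ring

lemma sum_wprod_abs_bn_le (K : Fin T.numCells) :
    ∑ i, wprod (T.facetMeas K i) (fun x => |T.bn a K i x|) q q ≤
      (d + 1) * C * ((T.size K)⁻¹ * wprod (T.cellMeas K) (fun _ => 1) q q) := by
  have hh := T.size_pos K
  have h : ∀ i ∈ Finset.univ, wprod (T.facetMeas K i) (fun x => |T.bn a K i x|) q q ≤
      C * ((T.size K)⁻¹ * wprod (T.cellMeas K) (fun _ => 1) q q) := fun i _ => by
    have hqL : MemLp q 2 (T.facetMeas K i) :=
      T.memLp_facetMeas K i (contDiff_of_isPoly hq).continuous.continuousOn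
    have hw := T.isWeight_abs_bn ha hb K i
    calc _ ≤ wprod (T.facetMeas K i) (fun _ => 1) q q :=
          wprod_self_mono hw isWeight_one (hw.bound.mono fun x hx => (le_abs_self _).trans hx) hqL
      _ = (T.size K)⁻¹ * (T.size K * wprod (T.facetMeas K i) (fun _ => 1) q q) := by field_simp
      _ ≤ (T.size K)⁻¹ * (C * wprod (T.cellMeas K) (fun _ => 1) q q) := by
        exact mul_le_mul_of_nonneg_left ((hC K q hq).2 i) (inv_nonneg.2 hh.le)
      _ = _ := by ring
  refine (Finset.sum_le_sum h).trans_eq ?_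
  simp [mul_assoc]

variable {Λ : ℝ≥0} (hΛ : LipschitzOnWith Λ a (closure Ω)) (h1 : ∀ K, T.size K ≤ 1)

include hΛ h1

/-- The streamline function is `h_K (a · ∇q + r)` with a perturbation `r` that is controlled by the
`L²` norm of `q`, since `a` varies by `O(h_K)` over the cell. -/
lemma exists_streamline_eq (K : Fin T.numCells) :
    ∃ r : E d → ℝ, MemLp r 2 (T.cellMeas K) ∧
      T.streamline a K q =
        (0 : E d → ℝ) + T.size K • ((fun x => inner ℝ (a x) (gradient q x)) + (1 : ℝ) • r) ∧
      wprod (T.cellMeas K) (fun _ => 1) r r ≤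
        Λ ^ 2 * C * wprod (T.cellMeas K) (fun _ => 1) q q := by
  set p := (T.cell K).points 0
  have hp : p ∈ T.cellSet K := (T.cell K).point_mem_closedInterior 0
  have hg := T.memLp_cellMeas K (continuous_gradient_of_isPoly hq).continuousOn
  have hr : MemLp (fun x => inner ℝ (a p - a x) (gradient q x)) 2 (T.cellMeas K) :=
    T.memLp_cellMeas K ((continuousOn_const.sub (ha.mono (T.cellSet_subset_closure K))).inner
      (continuous_gradient_of_isPoly hq).continuousOn)
  refine ⟨fun x => inner ℝ (a p - a x) (gradient q x), hr, ?_, ?_⟩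
  · funext x
    simp only [streamline, Pi.add_apply, Pi.smul_apply, Pi.zero_apply, smul_eq_mul, zero_add,
      one_mul, ← inner_add_left]
    congr 2
    exact (add_sub_cancel _ _).symm
  · rw [mul_assoc]
    refine le_trans ?_ (mul_le_mul_of_nonneg_left (hC K q hq).1 (sq_nonneg _))
    rw [wprod_one_self, ← mul_assoc, ← mul_pow, ← integral_const_mul]
    refine integral_mono_ae hr.integrable_sq (hg.norm.integrable_sq.const_mul _) ?_
    refine (ae_restrict_iff' (T.measurableSet_cellSet K)).2 (Eventually.of_forall fun x hx => ?_)
    have h2 : ‖a p - a x‖ ≤ Λ * T.size K := by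
      rw [← dist_eq_norm]
      refine (hΛ.dist_le_mul _ (T.cellSet_subset_closure K hp) _
        (T.cellSet_subset_closure K hx)).trans ?_
      gcongr
      exact Metric.dist_le_diam_of_mem (T.isCompact_cellSet K).isBounded hp hx
    have h3 : |inner ℝ (a p - a x) (gradient q x)| ≤ Λ * T.size K * ‖gradient q x‖ :=
      (abs_real_inner_le_norm _ _).trans (mul_le_mul_of_nonneg_right h2 (norm_nonneg _))
    simp only [← mul_pow]
    exact sq_le_sq' (abs_le.1 h3).1 (abs_le.1 h3).2

/-- With the weight `1 / h_K`, the streamline function is bounded by the weighted streamline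
derivative and the `L²` norm of `q`; this uses `h_K ≤ 1`. -/
lemma inv_size_mul_wprod_streamline_le (K : Fin T.numCells) :
    (T.size K)⁻¹ *
        wprod (T.cellMeas K) (fun _ => 1) (T.streamline a K q) (T.streamline a K q) ≤
      2 * (T.size K * wprod (T.cellMeas K) (fun _ => 1) (fun x => inner ℝ (a x) (gradient q x))
        (fun x => inner ℝ (a x) (gradient q x))) +
      2 * (Λ ^ 2 * C * wprod (T.cellMeas K) (fun _ => 1) q q) := by
  obtain ⟨r, hr, hz, hle⟩ := exists_streamline_eq hb hC hq ha hΛ h1 K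
  have hg := T.memLp_inner_cellMeas ha hb K
    (T.memLp_cellMeas K (continuous_gradient_of_isPoly hq).continuousOn)
  set g : E d → ℝ := fun x => inner ℝ (a x) (gradient q x)
  have hs := hg.add (hr.const_smul (1 : ℝ))
  have hh := T.size_pos K
  have h0 : MemLp (0 : E d → ℝ) 2 (T.cellMeas K) := MemLp.zero
  have e : wprod (T.cellMeas K) (fun _ => 1) (T.streamline a K q) (T.streamline a K q) =
      T.size K ^ 2 * (wprod (T.cellMeas K) (fun _ => 1) g g
        + 2 * wprod (T.cellMeas K) (fun _ => 1) g r + wprod (T.cellMeas K) (fun _ => 1) r r) := by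
    rw [hz, wprod_add_smul_left isWeight_one h0 hs (h0.add (hs.const_smul _)),
      wprod_add_smul_right isWeight_one h0 hs h0, wprod_add_smul_right isWeight_one h0 hs hs,
      wprod_add_smul_left isWeight_one hg hr hs, wprod_add_smul_right isWeight_one hg hr hg,
      wprod_add_smul_right isWeight_one hg hr hr, wprod_comm _ r g,
      wprod_comm _ 0 (g + (1 : ℝ) • r), wprod_zero_right, wprod_zero_right]
    ring
  have hy := (le_abs_self _).trans
    (abs_wprod_le_add isWeight_one (fun _ => zero_le_one) hg hr one_pos)
  have hr0 := wprod_self_nonneg (ν := T.cellMeas K) (c := fun _ => 1) (fun _ => zero_le_one) r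
  rw [e]
  calc _ = T.size K * (wprod (T.cellMeas K) (fun _ => 1) g g
        + 2 * wprod (T.cellMeas K) (fun _ => 1) g r + wprod (T.cellMeas K) (fun _ => 1) r r) := by
        field_simp
    _ ≤ T.size K * (2 * wprod (T.cellMeas K) (fun _ => 1) g g
        + 2 * wprod (T.cellMeas K) (fun _ => 1) r r) := by
        gcongr ?_ * ?_; linarith
    _ = 2 * (T.size K * wprod (T.cellMeas K) (fun _ => 1) g g)
        + 2 * (T.size K * wprod (T.cellMeas K) (fun _ => 1) r r) := by ring
    _ ≤ _ := by
        exact add_le_add le_rfl (mul_le_mul_of_nonneg_left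
          ((mul_le_of_le_one_left hr0 (h1 K)).trans hle) zero_le_two)

/-- Testing with the streamline function controls the weighted streamline derivative. -/
lemma le_wprod_streamline_adv (K : Fin T.numCells) :
    1 / 2 * (T.size K * wprod (T.cellMeas K) (fun _ => 1)
        (fun x => inner ℝ (a x) (gradient q x)) (fun x => inner ℝ (a x) (gradient q x))) -
      1 / 2 * (Λ ^ 2 * C * wprod (T.cellMeas K) (fun _ => 1) q q) ≤
    wprod (T.cellMeas K) (fun _ => 1) (T.streamline a K q)
      (fun x => inner ℝ (a x) (gradient q x)) := by
  obtain ⟨r, hr, hz, hle⟩ := exists_streamline_eq hb hC hq ha hΛ h1 K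
  have hg := T.memLp_inner_cellMeas ha hb K
    (T.memLp_cellMeas K (continuous_gradient_of_isPoly hq).continuousOn)
  set g : E d → ℝ := fun x => inner ℝ (a x) (gradient q x)
  have hs := hg.add (hr.const_smul (1 : ℝ))
  have hh := T.size_pos K
  have h0 : MemLp (0 : E d → ℝ) 2 (T.cellMeas K) := MemLp.zero
  have e : wprod (T.cellMeas K) (fun _ => 1) (T.streamline a K q) g =
      T.size K * (wprod (T.cellMeas K) (fun _ => 1) g g
        + wprod (T.cellMeas K) (fun _ => 1) r g) := by
    rw [hz, wprod_add_smul_left isWeight_one h0 hs hg,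
      wprod_add_smul_left isWeight_one hg hr hg, wprod_comm _ 0 g, wprod_zero_right]
    ring
  have hy := (abs_le.1
    (abs_wprod_le_add isWeight_one (fun _ => zero_le_one) hr hg one_pos)).1
  have hr0 := wprod_self_nonneg (ν := T.cellMeas K) (c := fun _ => 1) (fun _ => zero_le_one) r
  have h2 := (mul_le_of_le_one_left hr0 (h1 K)).trans hle
  rw [e]
  have h3 : T.size K * (1 / 2 * wprod (T.cellMeas K) (fun _ => 1) g g
      - 1 / 2 * wprod (T.cellMeas K) (fun _ => 1) r r) ≤
      T.size K * (wprod (T.cellMeas K) (fun _ => 1) g g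
        + wprod (T.cellMeas K) (fun _ => 1) r g) := by
    gcongr ?_ * ?_; linarith
  linarith

end Estimates

end Triangulation


/-! ### Test pairs for the inf-sup condition -/

namespace Triangulation

variable {d : ℕ} [NeZero d] {Ω : Set (E d)} (T : Triangulation Ω)

section Estimates

variable {T} {a : E d → E d} {k : ℕ} {C μ : ℝ} {v : Pair T.numCells d} {Λ : ℝ≥0}
  (ha : ContinuousOn a (closure Ω)) (hb : ∀ x ∈ closure Ω, ‖a x‖ ≤ 1)
  (hΛ : LipschitzOnWith Λ a (closure Ω)) (hμ : 0 < μ) (hC0 : 0 < C) (hC : T.HasInverseConst k C)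
  (h1 : ∀ K, T.size K ≤ 1)
  (hv : v.1 ∈ T.Wh k) (hv2 : ∀ K i, MemLp v.2 2 (T.facetMeas K i))

/-- The test pair that controls the streamline derivative of `v`. -/
def streamlinePair (T : Triangulation Ω) (a : E d → E d) (v : Pair T.numCells d) :
    Pair T.numCells d :=
  (T.ofPoly fun K => T.streamline a K (v.1.val K), 0)

lemma adv_eq_of_mem_Wh (a : E d → E d) (hv : v.1 ∈ T.Wh k) (K : Fin T.numCells) :
    adv a v K = fun x => inner ℝ (a x) (gradient (v.1.val K) x) := by
  funext x; rw [adv, (hv K).2.1]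

include ha hb hΛ hμ hC0 hC h1 hv

/-- The streamline pair is bounded by `v` in the stability norm. -/
lemma formA_streamlinePair_le :
    T.formA μ a (T.streamlinePair a v) (T.streamlinePair a v) ≤
      (C + (d + 2) * C * (2 + 2 * (Λ ^ 2 * C / μ))) * T.formA μ a v v := by
  set z : Fin T.numCells → E d → ℝ := fun K => T.streamline a K (v.1.val K) with hz
  have hzP : ∀ K, IsPoly k (z K) := fun K => T.isPoly_streamline a K (hv K).1
  have hj : ∀ K i, wprod (T.facetMeas K i) (fun x => |T.bn a K i x|)
      (jump (T.streamlinePair a v) K) (jump (T.streamlinePair a v) K) =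
      wprod (T.facetMeas K i) (fun x => |T.bn a K i x|) (z K) (z K) := fun K i => by
    rw [wprod_self, wprod_self]
    have : jump (T.streamlinePair a v) K = (0 : E d → ℝ) - z K := rfl
    simp [this]
  have h0 : (T.streamlinePair a v).2 = 0 := rfl
  have hval : ∀ K, (T.streamlinePair a v).1.val K = z K := fun K => rfl
  have hadv : ∀ K, adv a (T.streamlinePair a v) K = fun x => inner ℝ (a x) (gradient (z K) x) :=
    fun K => rfl
  have hcell : ∀ K ∈ Finset.univ,
      μ * wprod (T.cellMeas K) (fun _ => 1) (z K) (z K)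
      + T.size K * wprod (T.cellMeas K) (fun _ => 1) (fun x => inner ℝ (a x) (gradient (z K) x))
        (fun x => inner ℝ (a x) (gradient (z K) x))
      + ∑ i, wprod (T.facetMeas K i) (fun x => |T.bn a K i x|) (z K) (z K) ≤
      (C + (d + 2) * C * (2 + 2 * (Λ ^ 2 * C / μ))) *
        (μ * wprod (T.cellMeas K) (fun _ => 1) (v.1.val K) (v.1.val K)
          + T.size K * wprod (T.cellMeas K) (fun _ => 1) (adv a v K) (adv a v K)) := fun K _ => by
    have e1 := wprod_streamline_self_le hb hC (hv K).1 K
    have e2 := inv_size_mul_wprod_streamline_le hb hC (hv K).1 ha hΛ h1 K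
    have e3 := size_mul_wprod_adv_le hb hC (hzP K) ha K
    have e4 := sum_wprod_abs_bn_le hb hC (hzP K) ha K
    rw [adv_eq_of_mem_Wh a hv K]
    have hV : 0 ≤ wprod (T.cellMeas K) (fun _ => 1) (v.1.val K) (v.1.val K) :=
      wprod_self_nonneg (fun _ => zero_le_one) _
    have hS : 0 ≤ T.size K * wprod (T.cellMeas K) (fun _ => 1)
        (fun x => inner ℝ (a x) (gradient (v.1.val K) x))
        (fun x => inner ℝ (a x) (gradient (v.1.val K) x)) :=
      mul_nonneg (T.size_pos K).le (wprod_self_nonneg (fun _ => zero_le_one) _)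
    simp only [hz] at e3 e4 ⊢
    set S := T.size K * wprod (T.cellMeas K) (fun _ => 1)
        (fun x => inner ℝ (a x) (gradient (v.1.val K) x))
        (fun x => inner ℝ (a x) (gradient (v.1.val K) x))
    set V := wprod (T.cellMeas K) (fun _ => 1) (v.1.val K) (v.1.val K)
    set Y := (T.size K)⁻¹ * wprod (T.cellMeas K) (fun _ => 1) (T.streamline a K (v.1.val K))
      (T.streamline a K (v.1.val K))
    have hL : (0 : ℝ) ≤ Λ ^ 2 * C / μ := by positivity
    have hdC : 0 ≤ ((d : ℝ) + 2) * C := by positivity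
    have e2' : Y ≤ 2 * S + 2 * (Λ ^ 2 * C / μ) * (μ * V) := by
      refine e2.trans_eq ?_
      field_simp
    have hμV : 0 ≤ μ * V := by positivity
    calc _ ≤ μ * (C * V) + C * Y + (d + 1) * C * Y :=
          add_le_add (add_le_add (mul_le_mul_of_nonneg_left e1 hμ.le) e3) e4
      _ = C * (μ * V) + (d + 2) * C * Y := by ring
      _ ≤ C * (μ * V + S) + (d + 2) * C * ((2 + 2 * (Λ ^ 2 * C / μ)) * (μ * V + S)) := by
          refine add_le_add (mul_le_mul_of_nonneg_left (by linarith) hC0.le)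
            (mul_le_mul_of_nonneg_left (e2'.trans ?_) hdC)
          nlinarith [mul_nonneg hL hS]
      _ = _ := by ring
  have hD : 0 ≤ C + (d + 2) * C * (2 + 2 * (Λ ^ 2 * C / μ)) := by positivity
  have hsum := Finset.sum_le_sum hcell
  rw [← Finset.mul_sum] at hsum
  have hJ : 0 ≤ ∑ K, ∑ i, wprod (T.facetMeas K i) (fun x => |T.bn a K i x|) (jump v K)
      (jump v K) := Finset.sum_nonneg fun K _ => Finset.sum_nonneg fun i _ =>
      wprod_self_nonneg (fun _ => abs_nonneg _) _
  have hG : 0 ≤ ∑ K, ∑ i, T.bd K i * wprod (T.facetMeas K i) (fun x => |T.bn a K i x|) v.2 v.2 :=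
    Finset.sum_nonneg fun K _ => Finset.sum_nonneg fun i _ =>
      mul_nonneg (T.bd_nonneg K i) (wprod_self_nonneg (fun _ => abs_nonneg _) _)
  simp only [Finset.sum_add_distrib] at hsum
  simp only [formA, h0, hj, hval, hadv, wprod_zero_right, mul_zero, Finset.sum_const_zero,
    add_zero]
  exact hsum.trans (mul_le_mul_of_nonneg_left (by linarith) hD)

include hv2

/-- The streamline pair controls the streamline derivative, up to the parts of the stability norm
that the diagonal of the form controls. -/
lemma le_BA_streamlinePair (hdiv : DivergenceFree Ω a) :
    1 / 4 * ∑ K, T.size K * wprod (T.cellMeas K) (fun _ => 1) (adv a v K) (adv a v K)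
      - 2 * ((d + 1) * C) *
        ∑ K, ∑ i, wprod (T.facetMeas K i) (fun x => |T.bn a K i x|) (jump v K) (jump v K)
      - (1 + C + Λ ^ 2 * C / μ) *
        ∑ K, μ * wprod (T.cellMeas K) (fun _ => 1) (v.1.val K) (v.1.val K) ≤
    T.BA μ a v (T.streamlinePair a v) := by
  set z : Fin T.numCells → E d → ℝ := fun K => T.streamline a K (v.1.val K) with hz
  have hzP : ∀ K, IsPoly k (z K) := fun K => T.isPoly_streamline a K (hv K).1
  have hL := T.isL2Pair_of_mem_Wh ha hv hv2
  rw [streamlinePair, T.BA_ofPoly ha hb hdiv μ hv hv2 hzP]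
  simp only [Finset.mul_sum _ _ (1 / 4 : ℝ), Finset.mul_sum _ _ (2 * (((d : ℝ) + 1) * C)),
    Finset.mul_sum _ _ (1 + C + Λ ^ 2 * C / μ)]
  simp only [← Finset.sum_sub_distrib]
  refine Finset.sum_le_sum fun K _ => ?_
  rw [← Finset.mul_sum]
  have e1 := wprod_streamline_self_le hb hC (hv K).1 K
  have e2 := inv_size_mul_wprod_streamline_le hb hC (hv K).1 ha hΛ h1 K
  have e3 := le_wprod_streamline_adv hb hC (hv K).1 ha hΛ h1 K
  have e4 := sum_wprod_abs_bn_le hb hC (hzP K) ha K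
  have hδ : 0 < ((d : ℝ) + 1) * C := by positivity
  -- Young's inequality on the facets, with the weight chosen to absorb the constant in `e4`
  have e5 : ∀ i ∈ Finset.univ,
      wprod (T.facetMeas K i) (T.bneg a K i) (jump v K) (z K) ≤
      2 * ((d + 1) * C) *
        wprod (T.facetMeas K i) (fun x => |T.bn a K i x|) (jump v K) (jump v K) +
      (8 * ((d + 1) * C))⁻¹ *
        wprod (T.facetMeas K i) (fun x => |T.bn a K i x|) (z K) (z K) := fun i _ => by
    have hzL : MemLp (z K) 2 (T.facetMeas K i) :=
      T.memLp_facetMeas K i (contDiff_of_isPoly (hzP K)).continuous.continuousOn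
    have hn := T.isWeight_bneg ha hb K i
    have hab := T.isWeight_abs_bn ha hb K i
    have hle : ∀ᵐ x ∂(T.facetMeas K i), T.bneg a K i x ≤ |T.bn a K i x| :=
      Eventually.of_forall fun x => max_le (neg_le_abs _) (abs_nonneg _)
    have y := (le_abs_self _).trans (abs_wprod_le_add hn (T.bneg_nonneg a K i) (hL.jump K i) hzL
      (α := (4 * (((d : ℝ) + 1) * C))⁻¹) (by positivity))
    refine y.trans (add_le_add ?_ ?_)
    · refine le_trans (le_of_eq ?_) (mul_le_mul_of_nonneg_left
        (wprod_self_mono hn hab hle (hL.jump K i)) (by positivity))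
      rw [inv_inv]; ring
    · refine le_trans (le_of_eq ?_) (mul_le_mul_of_nonneg_left
        (wprod_self_mono hn hab hle hzL) (by positivity))
      field_simp; norm_num; ring
  have e6 := Finset.sum_le_sum e5
  rw [Finset.sum_add_distrib, ← Finset.mul_sum, ← Finset.mul_sum] at e6
  have e7 := (abs_le.1 (abs_wprod_le_add isWeight_one (fun _ => zero_le_one) (hL.val K)
    (T.memLp_cellMeas K (contDiff_of_isPoly (hzP K)).continuous.continuousOn) one_pos)).1
  rw [adv_eq_of_mem_Wh a hv K]
  simp only [hz] at e4 e6 e7 ⊢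
  have hV : 0 ≤ wprod (T.cellMeas K) (fun _ => 1) (v.1.val K) (v.1.val K) :=
    wprod_self_nonneg (fun _ => zero_le_one) _
  set S := T.size K * wprod (T.cellMeas K) (fun _ => 1)
      (fun x => inner ℝ (a x) (gradient (v.1.val K) x))
      (fun x => inner ℝ (a x) (gradient (v.1.val K) x))
  set V := wprod (T.cellMeas K) (fun _ => 1) (v.1.val K) (v.1.val K)
  set Y := (T.size K)⁻¹ * wprod (T.cellMeas K) (fun _ => 1) (T.streamline a K (v.1.val K))
    (T.streamline a K (v.1.val K))
  set Z := ∑ i, wprod (T.facetMeas K i) (fun x => |T.bn a K i x|) (T.streamline a K (v.1.val K))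
    (T.streamline a K (v.1.val K))
  have e8 : (8 * (((d : ℝ) + 1) * C))⁻¹ * Z ≤ 1 / 8 * Y := by
    calc _ ≤ (8 * (((d : ℝ) + 1) * C))⁻¹ * ((d + 1) * C * Y) :=
          mul_le_mul_of_nonneg_left e4 (by positivity)
      _ = _ := by field_simp
  have e9 : (1 + C + Λ ^ 2 * C / μ) * (μ * V) = μ * V + C * (μ * V) + Λ ^ 2 * C * V := by
    field_simp
  have e10 := mul_le_mul_of_nonneg_left e7 hμ.le
  have e11 := mul_le_mul_of_nonneg_left e1 hμ.le
  have hCV : 0 ≤ C * (μ * V) := by positivity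
  have hμV : 0 ≤ μ * V := by positivity
  have hLV : 0 ≤ Λ ^ 2 * C * V := by positivity
  rw [e9]
  linarith

end Estimates

/-- **Inf-sup stability** with an explicit test pair: `v` plus a small multiple of its streamline
function. The facet part of the test pair is that of `v`, so the estimate does not depend on the
choice of the space for the facet functions. -/
theorem exists_testPair {a : E d → E d} {Λ : ℝ≥0} (hΛ : LipschitzOnWith Λ a (closure Ω))
    (hb : ∀ x ∈ closure Ω, ‖a x‖ ≤ 1) (hdiv : DivergenceFree Ω a) {μ : ℝ} (hμ : 0 < μ)
    (k : ℕ) (σ : ℝ) : ∃ β > 0, ∃ c > 0, ∀ T : Triangulation Ω, T.ShapeRegular σ →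
      (∀ K, T.size K ≤ 1) → ∀ v : Pair T.numCells d, v.1 ∈ T.Wh k →
        (∀ K i, MemLp v.2 2 (T.facetMeas K i)) →
          ∃ y : Pair T.numCells d, y.1 ∈ T.Wh k ∧ y.2 = v.2 ∧
            T.normA μ a y ≤ c * T.normA μ a v ∧ β * T.normA μ a v ^ 2 ≤ T.BA μ a v y := by
  obtain ⟨C, hC0, hC⟩ := exists_inverse_const d k σ
  have ha := hΛ.continuousOn
  have hL : (0 : ℝ) ≤ Λ ^ 2 * C / μ := by positivity
  set c₁ : ℝ := 2 * ((d + 1) * C) with hc₁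
  set c₂ : ℝ := 1 + C + Λ ^ 2 * C / μ with hc₂
  set D : ℝ := C + (d + 2) * C * (2 + 2 * (Λ ^ 2 * C / μ)) with hD
  have h₁ : 0 < c₁ := by positivity
  have h₂ : 0 < c₂ := by positivity
  -- the multiple of the streamline pair is so small that its negative part is absorbed
  set γ : ℝ := (4 * (1 + c₁ + c₂))⁻¹ with hγ
  have hγ0 : 0 < γ := by positivity
  have hγ1 : γ * (1 + c₁ + c₂) = 1 / 4 := by rw [hγ]; field_simp
  refine ⟨γ / 4, by positivity, 1 + γ * √D, by positivity, fun T hT h1 v hv hv2 => ?_⟩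
  have hI : T.HasInverseConst k C := hT.hasInverseConst hC
  have hvL := T.isL2Pair_of_mem_Wh ha hv hv2
  have hsW : (T.streamlinePair a v).1 ∈ T.Wh k :=
    T.ofPoly_mem_Wh fun K => T.isPoly_streamline a K (hv K).1
  have hsL := T.isL2Pair_of_mem_Wh ha hsW fun K i => MemLp.zero
  refine ⟨comb v γ (T.streamlinePair a v), T.comb_mem_Wh hv hsW γ, ?_, ?_, ?_⟩
  · simp [comb, streamlinePair]
  · refine (T.normA_comb_le ha hb hμ.le hvL hsL γ).trans ?_
    have h : T.normA μ a (T.streamlinePair a v) ≤ √D * T.normA μ a v := by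
      rw [T.normA_eq_sqrt, T.normA_eq_sqrt, ← Real.sqrt_mul (by positivity)]
      exact Real.sqrt_le_sqrt (formA_streamlinePair_le ha hb hΛ hμ hC0 hI h1 hv)
    rw [abs_of_pos hγ0, add_mul, one_mul, mul_assoc]
    exact add_le_add le_rfl (mul_le_mul_of_nonneg_left h hγ0.le)
  · rw [T.BA_comb_right ha hb hvL hsL hvL, T.BA_self ha hb hdiv μ hv hv2, T.normA_sq hμ.le, formA]
    have e := le_BA_streamlinePair ha hb hΛ hμ hC0 hI h1 hv hv2 hdiv
    rw [← hc₁, ← hc₂] at e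
    have hM : 0 ≤ ∑ K, μ * wprod (T.cellMeas K) (fun _ => 1) (v.1.val K) (v.1.val K) :=
      Finset.sum_nonneg fun K _ => mul_nonneg hμ.le (wprod_self_nonneg (fun _ => zero_le_one) _)
    have hJ : 0 ≤ ∑ K, ∑ i, wprod (T.facetMeas K i) (fun x => |T.bn a K i x|) (jump v K)
        (jump v K) := Finset.sum_nonneg fun K _ => Finset.sum_nonneg fun i _ =>
        wprod_self_nonneg (fun _ => abs_nonneg _) _
    have hG : 0 ≤ ∑ K, ∑ i, T.bd K i *
        wprod (T.facetMeas K i) (fun x => |T.bn a K i x|) v.2 v.2 :=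
      Finset.sum_nonneg fun K _ => Finset.sum_nonneg fun i _ =>
        mul_nonneg (T.bd_nonneg K i) (wprod_self_nonneg (fun _ => abs_nonneg _) _)
    set M := ∑ K, μ * wprod (T.cellMeas K) (fun _ => 1) (v.1.val K) (v.1.val K)
    set J := ∑ K, ∑ i, wprod (T.facetMeas K i) (fun x => |T.bn a K i x|) (jump v K) (jump v K)
    set G := ∑ K, ∑ i, T.bd K i * wprod (T.facetMeas K i) (fun x => |T.bn a K i x|) v.2 v.2
    have e' := mul_le_mul_of_nonneg_left e hγ0.le
    have k₁ : γ * c₁ * J ≤ 1 / 4 * J := mul_le_mul_of_nonneg_right (by nlinarith) hJ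
    have k₂ : γ * c₂ * M ≤ 1 / 4 * M := mul_le_mul_of_nonneg_right (by nlinarith) hM
    have k₃ : γ ≤ 1 / 4 := by nlinarith
    have m₁ := mul_le_mul_of_nonneg_right k₃ hM
    have m₂ := mul_le_mul_of_nonneg_right k₃ hJ
    have m₃ := mul_le_mul_of_nonneg_right k₃ hG
    linarith

end Triangulation


/-! ### Consistency -/

lemma sqrt_wprod_one_self {X : Type*} [MeasurableSpace X] {ν : Measure X} {f : X → ℝ}
    (hf : MemLp f 2 ν) : √(wprod ν (fun _ => 1) f f) = (eLpNorm f 2 ν).toReal := by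
  have h : wprod ν (fun _ => 1) f f = (eLpNorm f 2 ν).toReal ^ 2 := by
    rw [← Lp.norm_toLp f hf, norm_toLp_sq hf]
    simp [wprod, sq]
  rw [h, Real.sqrt_sq ENNReal.toReal_nonneg]

/-- The weighted product is continuous under `L²` convergence. -/
lemma tendsto_wprod {X : Type*} [MeasurableSpace X] {ν : Measure X} {c g f : X → ℝ}
    {F : ℕ → X → ℝ} (hc : IsWeight ν c) (hF : ∀ n, MemLp (F n) 2 ν) (hf : MemLp f 2 ν)
    (hg : MemLp g 2 ν) (h : Tendsto (fun n => eLpNorm (F n - f) 2 ν) atTop (𝓝 0)) :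
    Tendsto (fun n => wprod ν c (F n) g) atTop (𝓝 (wprod ν c f g)) := by
  refine tendsto_iff_norm_sub_tendsto_zero.2 ?_
  have h1 : Tendsto (fun n => (eLpNorm (F n - f) 2 ν).toReal *
      √(wprod ν (fun _ => 1) (fun x => c x * g x) fun x => c x * g x)) atTop (𝓝 0) := by
    have h2 := ((ENNReal.tendsto_toReal ENNReal.zero_ne_top).comp h).mul_const
      √(wprod ν (fun _ => 1) (fun x => c x * g x) fun x => c x * g x)
    simpa using h2
  refine squeeze_zero (fun n => norm_nonneg _) (fun n => ?_) h1
  have hd := (hF n).sub hf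
  rw [← wprod_sub_left hc (hF n) hf hg, ← sqrt_wprod_one_self hd, Real.norm_eq_abs]
  have e : wprod ν c (F n - f) g = wprod ν (fun _ => 1) (F n - f) fun x => c x * g x := by
    unfold wprod; congr 1; funext x; ring
  rw [e]
  exact abs_wprod_le isWeight_one (fun _ => zero_le_one) hd (hc.memLp hg)

namespace Triangulation

variable {d : ℕ} [NeZero d] {Ω : Set (E d)} (T : Triangulation Ω)
  {a : E d → E d} (ha : ContinuousOn a (closure Ω)) (hb : ∀ x ∈ closure Ω, ‖a x‖ ≤ 1)

include ha hb

/-- Integration by parts on a cell for a function in `H¹(Ω)`, by smooth approximation. -/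
lemma integration_by_parts_H1 (hdiv : DivergenceFree Ω a) {u t : E d → ℝ} {G : E d → E d}
    (hu : IsH1 Ω T.skeleton u G t) (K : Fin T.numCells) {q : E d → ℝ} (hq : ContDiff ℝ ∞ q) :
    wprod (T.cellMeas K) (fun _ => 1) u (fun x => inner ℝ (a x) (gradient q x)) +
      wprod (T.cellMeas K) (fun _ => 1) (fun x => inner ℝ (a x) (G x)) q =
      ∑ i, wprod (T.facetMeas K i) (T.bn a K i) t q := by
  obtain ⟨φ, hφ, hφu, hφG, hφt⟩ := hu.trace
  have hK := T.cellMeas_le K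
  have hF := T.facetMeas_le K
  have hgrad : ∀ r : E d → ℝ, ContDiff ℝ ∞ r → MemLp (gradient r) 2 (T.cellMeas K) := fun r hr =>
    T.memLp_cellMeas K (continuous_gradient hr).continuousOn
  have hG := hu.grad_memLp.mono_measure hK
  have c1 : Tendsto (fun n => wprod (T.cellMeas K) (fun _ => 1) (φ n)
      (fun x => inner ℝ (a x) (gradient q x))) atTop (𝓝 _) :=
    tendsto_wprod isWeight_one (fun n => T.memLp_cellMeas K (hφ n).continuous.continuousOn)
      (hu.memLp.mono_measure hK) (T.memLp_inner_cellMeas ha hb K (hgrad q hq))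
      (tendsto_of_tendsto_of_tendsto_of_le_of_le tendsto_const_nhds hφu (fun _ => zero_le)
        fun n => eLpNorm_mono_measure _ hK)
  have c2 : Tendsto (fun n => wprod (T.cellMeas K) (fun _ => 1)
      (fun x => inner ℝ (a x) (gradient (φ n) x)) q) atTop (𝓝 _) :=
    tendsto_wprod isWeight_one (fun n => T.memLp_inner_cellMeas ha hb K (hgrad _ (hφ n)))
      (T.memLp_inner_cellMeas ha hb K hG) (T.memLp_cellMeas K hq.continuous.continuousOn)
      (tendsto_of_tendsto_of_tendsto_of_le_of_le tendsto_const_nhds hφG (fun _ => zero_le)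
        fun n => by
          refine le_trans (eLpNorm_mono_ae ?_) (eLpNorm_mono_measure _ hK)
          refine (ae_restrict_iff' (T.measurableSet_cellSet K)).2
            (Eventually.of_forall fun x hx => ?_)
          rw [Pi.sub_apply, Pi.sub_apply, ← inner_sub_right]
          exact (norm_inner_le_norm _ _).trans (mul_le_of_le_one_left (norm_nonneg _)
            (hb x (T.cellSet_subset_closure K hx))))
  have c3 : ∀ i, Tendsto (fun n => wprod (T.facetMeas K i) (T.bn a K i) (φ n) q) atTop
      (𝓝 (wprod (T.facetMeas K i) (T.bn a K i) t q)) := fun i =>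
    tendsto_wprod (T.isWeight_bn ha hb K i)
      (fun n => T.memLp_facetMeas K i (hφ n).continuous.continuousOn)
      (hu.trace_memLp.mono_measure (hF i)) (T.memLp_facetMeas K i hq.continuous.continuousOn)
      (tendsto_of_tendsto_of_tendsto_of_le_of_le tendsto_const_nhds hφt (fun _ => zero_le)
        fun n => eLpNorm_mono_measure _ (hF i))
  refine tendsto_nhds_unique ((c1.add c2).congr fun n => ?_)
    (tendsto_finsetSum Finset.univ fun i _ => c3 i)
  rw [← T.integration_by_parts ha hdiv K (hφ n) hq]
  congr 1
  exact wprod_comm _ _ _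

/-- **Consistency**: the exact solution satisfies the discrete equations. -/
lemma BA_strongSolution (hdiv : DivergenceFree Ω a) {μ : ℝ} {k : ℕ} {f g u t : E d → ℝ}
    {G : E d → E d} (hu : T.IsStrongSolution μ a f g u G t) {v : Pair T.numCells d}
    (hv : v.1 ∈ T.Wh k) (hv2 : ∀ K i, MemLp v.2 2 (T.facetMeas K i)) :
    T.BA μ a (T.ofH1 u G t, t) v = T.linForm a f g v := by
  have hL := T.isL2Pair_of_mem_Wh ha hv hv2
  have ht : ∀ K i, MemLp t 2 (T.facetMeas K i) := fun K i =>
    hu.isH1.trace_memLp.mono_measure (T.facetMeas_le K i)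
  have hw := T.isL2Pair_ofH1 ha hb hu.isH1 ht
  have h1 : ∀ K, wprod (T.cellMeas K) (fun _ => 1) u (adv a v K) =
      ∑ i, wprod (T.facetMeas K i) (T.bn a K i) t (v.1.tr K) -
        wprod (T.cellMeas K) (fun _ => 1) (fun x => inner ℝ (a x) (G x)) (v.1.val K) :=
    fun K => by
    have h := T.integration_by_parts_H1 ha hb hdiv hu.isH1 K (contDiff_of_isPoly (hv K).1)
    rw [(hv K).2.2, ← h, adv_eq_of_mem_Wh a hv K]; ring
  have h2 : ∀ K i, wprod (T.facetMeas K i) (T.bn a K i) t (v.1.tr K) =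
      wprod (T.facetMeas K i) (T.bn a K i) t v.2
      - wprod (T.facetMeas K i) (T.bpos a K i) t (jump v K)
      + wprod (T.facetMeas K i) (T.bneg a K i) t (jump v K) := fun K i => by
    have hbn := T.isWeight_bn ha hb K i
    rw [sub_add, ← T.wprod_bn ha hb (ht K i) (hL.jump K i), jump,
      wprod_sub_right hbn (hL.bar K i) (hL.tr K i) (ht K i)]
    ring
  have h3 : ∀ K, ∫ x in T.cellSet K, f x * v.1.val K x =
      μ * wprod (T.cellMeas K) (fun _ => 1) u (v.1.val K) +
      wprod (T.cellMeas K) (fun _ => 1) (fun x => inner ℝ (a x) (G x)) (v.1.val K) :=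
    fun K => by
    have i1 : Integrable (fun x => μ * (u x * v.1.val K x)) (T.cellMeas K) :=
      ((hw.val K).integrable_mul (hL.val K)).const_mul μ
    have i2 : Integrable (fun x => inner ℝ (a x) (G x) * v.1.val K x) (T.cellMeas K) :=
      (hw.adv K).integrable_mul (hL.val K)
    simp only [wprod, one_mul]
    rw [← integral_const_mul, ← integral_add i1 i2]
    refine integral_congr_ae ?_
    filter_upwards [ae_mono (T.cellMeas_le K) hu.equation] with x hx
    rw [← hx]; ring
  have h4 : ∀ K i, T.bd K i * ∫ x in T.inflow a K i, g x * v.2 x ∂μHE[d - 1] =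
      T.bd K i * wprod (T.facetMeas K i) (T.bneg a K i) t v.2 := fun K i => by
    by_cases hB : T.IsBoundary K i
    · congr 1
      have e : ∫ x in T.inflow a K i, g x * v.2 x ∂μHE[d - 1] =
          ∫ x in T.inflow a K i, -(t x) * inner ℝ (a x) (T.normal K i) * v.2 x ∂μHE[d - 1] := by
        refine integral_congr_ae ?_
        filter_upwards [hu.boundary K i hB] with x hx
        rw [hx]
      rw [e]
      refine T.setIntegral_inflow ha K i (fun x hx => ?_) fun x hx => ?_
      · rw [bneg, max_eq_left (by linarith), bn]; ring
      · rw [bneg, max_eq_right (by linarith)]; ring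
    · simp [bd, hB]
  have h5 := T.sum_wprod_bn_eq (a := a) t v.2
  have h6 : ∀ K i, wprod (T.facetMeas K i) (T.bn a K i) t v.2 = _ := fun K i =>
    T.wprod_bn ha hb (ht K i) (hv2 K i)
  have h7 : ∀ K i, T.bd K i * wprod (T.facetMeas K i) (T.bn a K i) t v.2 =
      T.bd K i * wprod (T.facetMeas K i) (T.bpos a K i) t v.2 -
      T.bd K i * wprod (T.facetMeas K i) (T.bneg a K i) t v.2 := fun K i => by
    rw [h6, mul_sub]
  simp only [h7, Finset.sum_sub_distrib] at h5
  rw [T.BA_eq ha, linForm]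
  simp only [bd_mul, h3, h4]
  simp only [ofH1, h1, h2, Finset.sum_add_distrib, Finset.sum_sub_distrib]
  linarith

end Triangulation


/-! ### Inf-sup stability and quasi-optimality -/

namespace Triangulation

variable {d : ℕ} [NeZero d] {Ω : Set (E d)} (T : Triangulation Ω)
  {a : E d → E d} (ha : ContinuousOn a (closure Ω)) (hb : ∀ x ∈ closure Ω, ‖a x‖ ≤ 1)
  {μ : ℝ} (hμ : 0 ≤ μ) {k : ℕ} {l β c : ℝ} (hβ : 0 < β) (hc : 0 < c)
  (hstab : ∀ v : Pair T.numCells d, v.1 ∈ T.Wh k → (∀ K i, MemLp v.2 2 (T.facetMeas K i)) →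
    ∃ y : Pair T.numCells d, y.1 ∈ T.Wh k ∧ y.2 = v.2 ∧
      T.normA μ a y ≤ c * T.normA μ a v ∧ β * T.normA μ a v ^ 2 ≤ T.BA μ a v y)

include ha hb hμ hβ hc hstab

lemma infSup_of_testPair : T.InfSup μ a k l (β / c) := by
  intro v hv
  have hvL := T.isL2Pair_of_mem_WhStar ha hv
  obtain ⟨y, hy1, hy2, hyn, hyB⟩ := hstab v hv.1 hvL.bar
  have hyW : y ∈ T.WhStar k l := ⟨hy1, by rw [hy2]; exact hv.2⟩
  have hbdd : BddAbove (Set.range fun w : T.WhStar k l => T.BA μ a v w / T.normA μ a w) := by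
    refine ⟨5 * T.normA' μ a v, ?_⟩
    rintro _ ⟨w, rfl⟩
    refine div_le_of_le_mul₀ (T.normA_nonneg μ a w)
      (mul_nonneg (by norm_num) (T.normA'_nonneg μ a v)) ?_
    exact (le_abs_self _).trans
      (T.abs_BA_le ha hb hμ hvL (T.isL2Pair_of_mem_WhStar ha w.2))
  refine le_trans ?_ (le_ciSup hbdd ⟨y, hyW⟩)
  have hv0 := T.normA_nonneg μ a v
  have hy0 := T.normA_nonneg μ a y
  rcases hy0.eq_or_lt with h0 | h0
  -- If the test pair has norm zero, then so has `v`, by continuity of the form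
  · have hB := (le_abs_self _).trans
      (T.abs_BA_le ha hb hμ hvL (T.isL2Pair_of_mem_WhStar ha hyW))
    rw [← h0, mul_zero] at hB
    have hz : T.normA μ a v = 0 := by
      have : β * T.normA μ a v ^ 2 ≤ 0 := hyB.trans hB
      have h2 : T.normA μ a v ^ 2 ≤ 0 := by
        by_contra! h3
        exact absurd this (not_le.2 (mul_pos hβ h3))
      exact pow_eq_zero_iff (two_ne_zero) |>.1 (le_antisymm h2 (sq_nonneg _))
    simp only [hz, ← h0, mul_zero, div_zero, le_refl]
  · rw [le_div_iff₀ h0]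
    calc β / c * T.normA μ a v * T.normA μ a y
        ≤ β / c * T.normA μ a v * (c * T.normA μ a v) := by gcongr
      _ = β * T.normA μ a v ^ 2 := by field_simp
      _ ≤ _ := hyB

/-- **Quasi-optimality**, by Céa's argument. The test pair `y` for `v_h - u_h` is a difference of two
discrete pairs, which is enough for Galerkin orthogonality. -/
lemma normA_sub_le (hdiv : DivergenceFree Ω a) {f g u t : E d → ℝ} {G : E d → E d}
    (hu : T.IsStrongSolution μ a f g u G t) {uh vh : Pair T.numCells d}
    (huh : T.IsDiscreteSolution μ a k l f g uh) (hvh : vh ∈ T.WhStar k l) :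
    T.normA μ a ((T.ofH1 u G t, t) - uh) ≤
      (1 + 5 / (β / c)) * T.normA' μ a ((T.ofH1 u G t, t) - vh) := by
  set U : Pair T.numCells d := (T.ofH1 u G t, t) with hU
  have hUL : T.IsL2Pair a U := T.isL2Pair_ofH1 ha hb hu.isH1 fun K i =>
    hu.isH1.trace_memLp.mono_measure (T.facetMeas_le K i)
  have huL := T.isL2Pair_of_mem_WhStar ha huh.1
  have hvL := T.isL2Pair_of_mem_WhStar ha hvh
  -- the discrete error `e = v_h - u_h`
  set e := comb vh (-1) uh with he
  have heL : T.IsL2Pair a e := hvL.comb huL _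
  obtain ⟨y, hy1, hy2, hyn, hyB⟩ := hstab e (T.comb_mem_Wh hvh.1 huh.1.1 _) heL.bar
  have hyL := T.isL2Pair_of_mem_Wh ha hy1 (by rw [hy2]; exact heL.bar)
  have hconsist : T.BA μ a U y = T.BA μ a uh y := by
    have hs : y = comb (y.1, vh.2) (-1) (T.ofPoly 0, uh.2) := by
      refine Prod.ext ?_ (hy2.trans rfl)
      have h0 : gradient (0 : E d → ℝ) = 0 := by
        funext x; simp [gradient]
      simp only [comb, ofPoly, Pi.zero_apply, smul_zero, add_zero, h0]
    have hm1 : ((y.1, vh.2) : Pair T.numCells d) ∈ T.WhStar k l := ⟨hy1, hvh.2⟩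
    have hm2 : ((T.ofPoly 0, uh.2) : Pair T.numCells d) ∈ T.WhStar k l :=
      ⟨T.ofPoly_mem_Wh fun K => isPoly_zero, huh.1.2⟩
    have hL1 := T.isL2Pair_of_mem_WhStar ha hm1
    have hL2 := T.isL2Pair_of_mem_WhStar ha hm2
    rw [hs, T.BA_comb_right ha hb hL1 hL2 hUL, T.BA_comb_right ha hb hL1 hL2 huL,
      T.BA_strongSolution ha hb hdiv hu hm1.1 hL1.bar,
      T.BA_strongSolution ha hb hdiv hu hm2.1 hL2.bar, huh.2 _ hm1, huh.2 _ hm2]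
  have hUvL : T.IsL2Pair a (comb U (-1) vh) := hUL.comb hvL _
  have hBe : T.BA μ a e y = -T.BA μ a (comb U (-1) vh) y := by
    rw [he, T.BA_comb_left ha hb hvL huL hyL, T.BA_comb_left ha hb hUL hvL hyL, hconsist]
    ring
  have hcont := T.abs_BA_le ha hb hμ hUvL hyL
  set N' := T.normA' μ a (comb U (-1) vh) with hN'
  have hN0 : 0 ≤ N' := T.normA'_nonneg _ _ _
  have he0 := T.normA_nonneg μ a e
  have h1 : β * T.normA μ a e ^ 2 ≤ 5 * N' * (c * T.normA μ a e) := by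
    calc _ ≤ T.BA μ a e y := hyB
      _ ≤ |T.BA μ a (comb U (-1) vh) y| := by rw [hBe]; exact neg_le_abs _
      _ ≤ 5 * N' * T.normA μ a y := hcont
      _ ≤ _ := by gcongr
  have h2 : T.normA μ a e ≤ 5 / (β / c) * N' := by
    rcases he0.eq_or_lt with h | h
    · rw [← h]; positivity
    · have h3 : β * T.normA μ a e ≤ 5 * N' * c := by
        refine le_of_mul_le_mul_right ?_ h
        linarith
      rw [div_div_eq_mul_div, div_mul_eq_mul_div, le_div_iff₀ hβ]
      linarith
  have h3 : T.normA μ a (comb U (-1) vh) ≤ N' := by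
    refine abs_le_of_sq_le_sq' ?_ hN0 |>.2
    rw [hN', T.normA'_sq ha]
    have p1 := Finset.sum_nonneg fun K (_ : K ∈ Finset.univ) =>
      mul_nonneg (inv_nonneg.2 (T.size_pos K).le) (wprod_self_nonneg (ν := T.cellMeas K)
        (c := fun _ => 1) (fun _ => zero_le_one) ((comb U (-1) vh).1.val K))
    have p2 := Finset.sum_nonneg fun K (_ : K ∈ Finset.univ) =>
      Finset.sum_nonneg fun i (_ : i ∈ Finset.univ) => wprod_self_nonneg (ν := T.facetMeas K i)
        (T.bneg_nonneg a K i) (comb U (-1) vh).2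
    have p3 := Finset.sum_nonneg fun K (_ : K ∈ Finset.univ) =>
      Finset.sum_nonneg fun i (_ : i ∈ Finset.univ) => wprod_self_nonneg (ν := T.facetMeas K i)
        (T.bpos_nonneg a K i) ((comb U (-1) vh).1.tr K)
    linarith
  have hsplit : U - uh = comb (comb U (-1) vh) 1 e := by
    rw [sub_eq_comb, he]
    simp only [comb, Prod.mk.injEq, CellFn.mk.injEq]
    exact ⟨⟨by funext K; module, by funext K; module, by funext K; module⟩, by module⟩
  rw [hsplit, sub_eq_comb U vh]
  have h4 := T.normA_comb_le ha hb hμ hUvL heL 1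
  rw [abs_one, one_mul] at h4
  rw [add_mul, one_mul]
  linarith

end Triangulation

end InterfaceStab

end

theorem mainTheorem5 {d : ℕ} [NeZero d] (hd : d ≤ 3)
    (Ω : Set (InterfaceStab.E d))
    (a : InterfaceStab.E d → InterfaceStab.E d) (Λ : ℝ≥0)
    (ha_lip : LipschitzOnWith Λ a (closure Ω))
    (ha_div : InterfaceStab.DivergenceFree Ω a)
    (ha_bound : ∀ x ∈ Ω, ‖a x‖ ≤ 1)
    (μ : ℝ) (hμ : 0 < μ) (k : ℕ) (l : ℝ) (hl : l ∈ Set.Icc (0 : ℝ) 1) (σ : ℝ) :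
    ∃ β > 0, ∃ C > 0, ∀ T : InterfaceStab.Triangulation Ω,
      T.ShapeRegular σ → (∀ K, T.size K ≤ 1) →
        T.InfSup μ a k l β ∧ T.Continuity μ a k l C ∧
        ∀ (f g u : InterfaceStab.E d → ℝ) (G : InterfaceStab.E d → InterfaceStab.E d)
          (t : InterfaceStab.E d → ℝ) (uh : InterfaceStab.Pair T.numCells d),
          T.IsStrongSolution μ a f g u G t →
          T.IsDiscreteSolution μ a k l f g uh →
            T.normA μ a ((T.ofH1 u G t, t) - uh) ≤
              (1 + C / β) *
                ⨅ vh : T.WhStar k l, T.normA' μ a ((T.ofH1 u G t, t) - (vh : InterfaceStab.Pair T.numCells d)) := by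
  have ha : ContinuousOn a (closure Ω) := ha_lip.continuousOn
  have hb : ∀ x ∈ closure Ω, ‖a x‖ ≤ 1 := fun x hx => by
    have h := (ha x hx).norm.mono subset_closure
    have : (𝓝[Ω] x).NeBot := mem_closure_iff_nhdsWithin_neBot.1 hx
    exact le_of_tendsto h (eventually_nhdsWithin_of_forall ha_bound)
  obtain ⟨β, hβ, c, hc, hstab⟩ :=
    InterfaceStab.Triangulation.exists_testPair ha_lip hb ha_div hμ k σ
  refine ⟨β / c, by positivity, 5, by norm_num, fun T hT h1 => ⟨?_, ?_, ?_⟩⟩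
  · exact T.infSup_of_testPair ha hb hμ.le hβ hc (hstab T hT h1)
  · exact fun w hw vh hvh => T.abs_BA_le ha hb hμ.le (T.isL2Pair_of_mem_WStarExt ha hb hw)
      (T.isL2Pair_of_mem_WhStar ha hvh)
  · intro f g u G t uh hu huh
    have : Nonempty (T.WhStar k l) := ⟨⟨uh, huh.1⟩⟩
    rw [Real.mul_iInf_of_nonneg (by positivity)]
    exact le_ciInf fun vh =>
      T.normA_sub_le ha hb hμ.le hβ hc (hstab T hT h1) ha_div hu huh vh.2
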